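/- Theorem 1.6. Let $(A,\mathfrak m)$ be a Cohen–Macaulay (Noetherian) local ring and let $I=(a_1,\dots,a_r)$ be an ideal of $A$ with $\operatorname{height} I>0$. Let $\mathcal R(I)=A[It]\subseteq A[t]$ be the Rees algebra and $\widehat{\mathcal R}(I)=A[It,t^{-1}]\subseteq A[t,t^{-1}]$ the extended Rees algebra of $I$. Let $J$ be the kernel of the $A$-algebra map $S=A[X_1,\dots,X_r]\to\mathcal R(I)$, $X_i\mapsto a_it$, and let $\widehat J$ be the kernel of the $A$-algebra map $\widehat S=A[X_1,\dots,X_r,T]\to\widehat{\mathcal R}(I)$, $X_i\mapsto a_it$, $T\mapsto t^{-1}$. Let $H_1(J)$ and $H_1(\widehat J)$ denote the first Koszul homology modules of finite generating sequences of the ideals $J$ and $\widehat J$; they are modules over $S/J\cong\mathcal R(I)$ and over $\widehat S/\widehat J\cong\widehat{\mathcal R}(I)$, respectively. A finitely generated module $E$ over a Noetherian ring $R$ of finite Krull dimension is called unmixed if every associated prime of $E$ is a minimal prime of $E$, and equidimensional if $\dim R/P=\dim E$ for every minimal prime $P$ of $E$ (so the zero module is both). Let $D_2(B|A,N)$ denote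 the second André–Quillen homology of an $A$-algebra $B$ with coefficients in a $B$-module $N$, that is, $H_2(L(B|A)\otimes_B N)$ with $L(B|A)$ the cotangent complex. (I) $H_1(J)$ is unmixed and equidimensional if and only if $D_2(\mathcal R(I)|A,\mathcal R(I))=0$. (II) $H_1(\widehat J)$ is unmixed and equidimensional if and only if $D_2(\widehat{\mathcal R}(I)|A,\widehat{\mathcal R}(I))=0$. Both equivalences hold for every choice of the finite generating sequences of $I$, $J$ and $\widehat J$. -/

import Mathlib

open CategoryTheory

universe u

/-! ### André–Quillen homology, by the standard simplicial polynomial resolution -/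

namespace AndreQuillen

section KaehlerTensor

open TensorProduct KaehlerDifferential

variable {A : Type u} [CommRing A] {B : Type u} [CommRing B] [Algebra A B]

/-- For `A`-algebras `f : P → B`, the `B`-module `B ⊗[P] Ω[P⁄A]`. -/
def KaehlerTensor {P : Type u} [CommRing P] [Algebra A P] (f : P →ₐ[A] B) : Type u :=
  letI := f.toRingHom.toAlgebra
  B ⊗[P] Ω[P⁄A]

variable {P : Type u} [CommRing P] [Algebra A P] (f : P →ₐ[A] B)
  {P' : Type u} [CommRing P'] [Algebra A P'] (f' : P' →ₐ[A] B)
  {P'' : Type u} [CommRing P''] [Algebra A P''] (f'' : P'' →ₐ[A] B)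

noncomputable instance : AddCommGroup (KaehlerTensor f) :=
  letI := f.toRingHom.toAlgebra
  (inferInstance : AddCommGroup (B ⊗[P] Ω[P⁄A]))

noncomputable instance : Module B (KaehlerTensor f) :=
  letI := f.toRingHom.toAlgebra
  (inferInstance : Module B (B ⊗[P] Ω[P⁄A]))

/-- The element `1 ⊗ dp` of `B ⊗[P] Ω[P⁄A]`. -/
noncomputable def KaehlerTensor.d (p : P) : KaehlerTensor f :=
  letI := f.toRingHom.toAlgebra
  (1 : B) ⊗ₜ[P] KaehlerDifferential.D A P p

theorem KaehlerTensor.hom_ext {M : Type u} [AddCommGroup M] [Module B M]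
    {φ ψ : KaehlerTensor f →ₗ[B] M}
    (h : ∀ p, φ (KaehlerTensor.d f p) = ψ (KaehlerTensor.d f p)) : φ = ψ := by
  let := f.toRingHom.toAlgebra
  let : Module P M := Module.compHom M f.toRingHom
  have : IsScalarTower P B M := ⟨fun p b m => by
    rw [Algebra.smul_def, mul_smul]; rfl⟩
  change ((B ⊗[P] Ω[P⁄A]) →ₗ[B] M) at φ
  change ((B ⊗[P] Ω[P⁄A]) →ₗ[B] M) at ψ
  refine TensorProduct.AlgebraTensorModule.curry_injective ?_
  refine LinearMap.ext_ring ?_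
  refine LinearMap.ext fun x => ?_
  have hx : x ∈ Submodule.span P (Set.range (KaehlerDifferential.D A P)) := by
    rw [KaehlerDifferential.span_range_derivation]; trivial
  induction hx using Submodule.span_induction with
  | mem x hx => obtain ⟨p, rfl⟩ := hx; exact h p
  | zero => simp
  | add x y _ _ hx hy => rw [map_add, map_add, hx, hy]
  | smul a x _ hx => rw [map_smul, map_smul, hx]

/-- A map `g : P → P'` of `A`-algebras over `B` induces the `B`-linear map
`B ⊗[P] Ω[P⁄A] → B ⊗[P'] Ω[P'⁄A]`, `b ⊗ dp ↦ b ⊗ d(g p)`. -/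
noncomputable def KaehlerTensor.map (g : P →ₐ[A] P') (h : f'.comp g = f) :
    KaehlerTensor f →ₗ[B] KaehlerTensor f' :=
  letI := f.toRingHom.toAlgebra
  letI := f'.toRingHom.toAlgebra
  letI := g.toRingHom.toAlgebra
  haveI : IsScalarTower P P' B :=
    IsScalarTower.of_algebraMap_eq fun p => (DFunLike.congr_fun h p).symm
  haveI : IsScalarTower A P P' := IsScalarTower.of_algebraMap_eq fun a => (g.commutes a).symm
  (LinearMap.liftBaseChange B
    (((TensorProduct.mk P' B Ω[P'⁄A] 1).restrictScalars P).comp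
      (KaehlerDifferential.map A A P P')) : (B ⊗[P] Ω[P⁄A]) →ₗ[B] (B ⊗[P'] Ω[P'⁄A]))

theorem KaehlerTensor.map_d (g : P →ₐ[A] P') (h : f'.comp g = f) (p : P) :
    KaehlerTensor.map f f' g h (KaehlerTensor.d f p) = KaehlerTensor.d f' (g p) := by
  let := f.toRingHom.toAlgebra
  let := f'.toRingHom.toAlgebra
  let := g.toRingHom.toAlgebra
  have : IsScalarTower P P' B :=
    IsScalarTower.of_algebraMap_eq fun p => (DFunLike.congr_fun h p).symm
  have : IsScalarTower A P P' := IsScalarTower.of_algebraMap_eq fun a => (g.commutes a).symm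
  change (LinearMap.liftBaseChange B
    (((TensorProduct.mk P' B Ω[P'⁄A] 1).restrictScalars P).comp
      (KaehlerDifferential.map A A P P')) : (B ⊗[P] Ω[P⁄A]) →ₗ[B] (B ⊗[P'] Ω[P'⁄A]))
      ((1 : B) ⊗ₜ[P] KaehlerDifferential.D A P p) = _
  rw [LinearMap.liftBaseChange_tmul, one_smul]
  change (1 : B) ⊗ₜ[P'] (KaehlerDifferential.map A A P P' (KaehlerDifferential.D A P p)) = _
  rw [KaehlerDifferential.map_D]
  rfl

theorem KaehlerTensor.map_comp_map (g : P →ₐ[A] P') (h : f'.comp g = f)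
    (g' : P' →ₐ[A] P'') (h' : f''.comp g' = f') (k : P →ₐ[A] P'') (hk : f''.comp k = f)
    (e : g'.comp g = k) :
    (KaehlerTensor.map f' f'' g' h').comp (KaehlerTensor.map f f' g h) =
      KaehlerTensor.map f f'' k hk := by
  subst e
  refine KaehlerTensor.hom_ext f fun p => ?_
  rw [LinearMap.comp_apply, KaehlerTensor.map_d, KaehlerTensor.map_d, KaehlerTensor.map_d]
  rfl

end KaehlerTensor

variable (A : Type u) [CommRing A] (B : Type u) [CommRing B] [Algebra A B]

/-- The iterated polynomial algebras `B`, `A[B]`, `A[A[B]]`, ...; here `A[X]` is the polynomial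
`A`-algebra with one variable for each element of `X`. The standard simplicial resolution of `B`
over `A` has the polynomial algebra `iterPoly A B (n + 1)` in degree `n`, and is augmented to
`iterPoly A B 0 = B`. -/
noncomputable def iterPoly : ℕ → CommAlgCat.{u} A
  | 0 => CommAlgCat.of A B
  | n + 1 => CommAlgCat.of A (MvPolynomial (iterPoly n) A)

/-- The face maps. `face 0 0` is the augmentation `A[B] → B`. The map `face (n + 1) i` is the
`i`-th face map from degree `n + 1` to degree `n` of the standard resolution: the zeroth one is
the evaluation `A[X] → X`, with `X` the `A`-algebra in degree `n`, and the `(i + 1)`-st one is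
obtained from the `i`-th one of the preceding stage by applying the functor `X ↦ A[X]`. -/
noncomputable def face : (n : ℕ) → Fin (n + 1) → (iterPoly A B (n + 1) →ₐ[A] iterPoly A B n)
  | 0, _ => (MvPolynomial.aeval id : MvPolynomial (iterPoly A B 0) A →ₐ[A] iterPoly A B 0)
  | n + 1, i => Fin.cases
      (MvPolynomial.aeval id :
        MvPolynomial (iterPoly A B (n + 1)) A →ₐ[A] iterPoly A B (n + 1))
      (fun j => (MvPolynomial.rename (face n j) :
        MvPolynomial (iterPoly A B (n + 1)) A →ₐ[A] MvPolynomial (iterPoly A B n) A)) i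

/-- The augmentations to `B`. -/
noncomputable def aug : (n : ℕ) → (iterPoly A B n →ₐ[A] B)
  | 0 => AlgHom.id A B
  | n + 1 => (aug n).comp (face A B n 0)

/-- The simplicial identities for the face maps. -/
theorem face_comp_face (n : ℕ) (i j : Fin (n + 1)) (hij : i ≤ j) :
    (face A B n i).comp (face A B (n + 1) j.succ) =
      (face A B n j).comp (face A B (n + 1) i.castSucc) := by
  induction n with
  | zero =>
    obtain rfl : i = 0 := Fin.fin_one_eq_zero _
    obtain rfl : j = 0 := Fin.fin_one_eq_zero _
    refine MvPolynomial.algHom_ext fun x => ?_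
    change MvPolynomial.aeval id (MvPolynomial.rename (face A B 0 0) (MvPolynomial.X x)) =
      face A B 0 0 (MvPolynomial.aeval id (MvPolynomial.X x))
    simp
  | succ n ih =>
    induction i using Fin.cases with
    | zero =>
      refine MvPolynomial.algHom_ext fun x => ?_
      change MvPolynomial.aeval id (MvPolynomial.rename (face A B (n + 1) j) (MvPolynomial.X x)) =
        face A B (n + 1) j (MvPolynomial.aeval id (MvPolynomial.X x))
      simp
    | succ i =>
      induction j using Fin.cases with
      | zero => exact absurd hij (by simp)
      | succ j =>
        have h := ih i j (by simpa using hij)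
        refine MvPolynomial.algHom_ext fun x => ?_
        change MvPolynomial.rename (face A B n i)
            (MvPolynomial.rename (face A B (n + 1) j.succ) (MvPolynomial.X x)) =
          MvPolynomial.rename (face A B n j)
            (MvPolynomial.rename (face A B (n + 1) i.castSucc) (MvPolynomial.X x))
        simp only [MvPolynomial.rename_X]
        exact congrArg _ (DFunLike.congr_fun h x)

theorem aug_comp_face (n : ℕ) (i : Fin (n + 1)) :
    (aug A B n).comp (face A B n i) = aug A B (n + 1) := by
  induction n with
  | zero => rw [Fin.fin_one_eq_zero i]; rfl
  | succ n ih =>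
    induction i using Fin.cases with
    | zero => rfl
    | succ j =>
      change ((aug A B n).comp (face A B n 0)).comp (face A B (n + 1) j.succ) = _
      rw [AlgHom.comp_assoc, face_comp_face A B n 0 j (Fin.zero_le j), ← AlgHom.comp_assoc, ih j]
      rfl

/-- The `n`-th module `B ⊗[Pₙ] Ω[Pₙ⁄A]` of the cotangent complex of `A → B`, where `P` is the
standard simplicial polynomial resolution of `B` over `A`. -/
abbrev cotangentModule (n : ℕ) : Type u := KaehlerTensor (aug A B (n + 1))

/-- The map that the `i`-th face map `Pₙ₊₁ → Pₙ` induces on the cotangent modules. -/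
noncomputable def cotangentFace (n : ℕ) (i : Fin (n + 2)) :
    cotangentModule A B (n + 1) →ₗ[B] cotangentModule A B n :=
  KaehlerTensor.map _ _ (face A B (n + 1) i) (aug_comp_face A B (n + 1) i)

theorem cotangentFace_comp (n : ℕ) (i j : Fin (n + 2)) (hij : i ≤ j) :
    (cotangentFace A B n i).comp (cotangentFace A B (n + 1) j.succ) =
      (cotangentFace A B n j).comp (cotangentFace A B (n + 1) i.castSucc) := by
  have hk : (aug A B (n + 1)).comp
      ((face A B (n + 1) j).comp (face A B (n + 2) i.castSucc)) = aug A B (n + 3) := by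
    rw [← AlgHom.comp_assoc, aug_comp_face, aug_comp_face]
  refine (KaehlerTensor.map_comp_map _ _ _ _ _ _ _ _ hk
    (face_comp_face A B (n + 1) i j hij)).trans
    (KaehlerTensor.map_comp_map _ _ _ _ _ _ _ _ hk rfl).symm

/-- The differential: the alternating sum of the faces. -/
noncomputable def cotangentD (n : ℕ) :
    cotangentModule A B (n + 1) →ₗ[B] cotangentModule A B n :=
  ∑ i : Fin (n + 2), (-1 : ℤ) ^ (i : ℕ) • cotangentFace A B n i

theorem cotangentD_comp (n : ℕ) : (cotangentD A B n).comp (cotangentD A B (n + 1)) = 0 := by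
  refine LinearMap.ext fun x => ?_
  simp only [cotangentD, LinearMap.comp_apply, LinearMap.sum_apply, LinearMap.smul_apply, map_sum,
    map_zsmul, LinearMap.zero_apply, Finset.smul_sum, smul_smul, ← pow_add]
  rw [← Finset.sum_product', Finset.univ_product_univ,
    ← Finset.sum_filter_add_sum_filter_not Finset.univ
      (fun p : Fin (n + 3) × Fin (n + 2) => (p.1 : ℕ) ≤ (p.2 : ℕ)),
    ← eq_neg_iff_add_eq_zero, ← Finset.sum_neg_distrib]
  refine Finset.sum_bij'
    (fun p hp => (p.2.succ, p.1.castLT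
      (lt_of_le_of_lt (Finset.mem_filter.1 hp).2 p.2.is_lt)))
    (fun p hp => (p.2.castSucc, p.1.pred (by
      intro h
      have := (Finset.mem_filter.1 hp).2
      rw [h] at this
      simp at this))) ?_ ?_ ?_ ?_ ?_
  · rintro ⟨i, j⟩ hp
    simp only [Finset.mem_filter, Finset.mem_univ, true_and, Fin.val_succ, Fin.val_castLT] at hp ⊢
    omega
  · rintro ⟨i, j⟩ hp
    simp only [Finset.mem_filter, Finset.mem_univ, true_and, Fin.val_castSucc, Fin.val_pred] at hp ⊢
    omega
  · rintro ⟨i, j⟩ hp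
    simp
  · rintro ⟨i, j⟩ hp
    simp
  · rintro ⟨i, j⟩ hp
    have hij : (i : ℕ) ≤ (j : ℕ) := (Finset.mem_filter.1 hp).2
    have hi : (i : ℕ) < n + 2 := lt_of_le_of_lt hij j.is_lt
    have key := LinearMap.congr_fun (cotangentFace_comp A B n (i.castLT hi) j hij) x
    rw [LinearMap.comp_apply, LinearMap.comp_apply, Fin.castSucc_castLT] at key
    dsimp only
    rw [key, ← neg_smul]
    congr 1
    simp only [Fin.val_succ, Fin.val_castLT]
    ring

/-- The cotangent complex `L(B|A)`: the chain complex of `B`-modules of the simplicial `B`-module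
`B ⊗[P] Ω[P⁄A]`, where `P` is the standard simplicial polynomial resolution of `B` over `A`. -/
noncomputable def cotangentComplex : ChainComplex (ModuleCat.{u} B) ℕ :=
  ChainComplex.of (fun n => ModuleCat.of B (cotangentModule A B n))
    (fun n => ModuleCat.ofHom (cotangentD A B n))
    (fun n => by rw [← ModuleCat.ofHom_comp, cotangentD_comp]; rfl)

/-- The André–Quillen homology module `D_n(B|A, N)`: the `n`-th homology of `L(B|A) ⊗[B] N`. -/
noncomputable def homology (n : ℕ) (N : Type u) [AddCommGroup N] [Module B N] : ModuleCat.{u} B :=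
  (((MonoidalCategory.tensorRight (ModuleCat.of B N)).mapHomologicalComplex
    (ComplexShape.down ℕ)).obj (cotangentComplex A B)).homology n

end AndreQuillen

/-! ### The first Koszul homology module -/

namespace Koszul

variable {S : Type u} [CommRing S] {s : ℕ} (u : Fin s → S)

/-- The differential `Kₛ,₁ = S^s → S`, `e_i ↦ u_i`, of the Koszul complex of `u_1, …, u_s`. -/
noncomputable def d₁ : (Fin s → S) →ₗ[S] S := Fintype.linearCombination S u

/-- The image of the differential `⋀² S^s → S^s`, `e_i ∧ e_j ↦ u_i e_j - u_j e_i`. -/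
noncomputable def boundaries : Submodule S (Fin s → S) :=
  Submodule.span S (Set.range fun p : Fin s × Fin s =>
    Pi.single p.2 (u p.1) - Pi.single p.1 (u p.2))

/-- The first Koszul homology module `H_1(u_1, …, u_s)`. -/
abbrev H₁ : Type u := LinearMap.ker (d₁ u) ⧸ (boundaries u).submoduleOf (LinearMap.ker (d₁ u))

theorem H₁_isTorsion :
    Module.IsTorsionBySet S (H₁ u) (Ideal.span (Set.range u) : Ideal S) := by
  rw [← Module.isTorsionBySet_iff_is_torsion_by_span]
  rintro x ⟨_, i, rfl⟩
  obtain ⟨⟨z, hz⟩, rfl⟩ := Submodule.Quotient.mk_surjective _ x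
  rw [← Submodule.Quotient.mk_smul, Submodule.Quotient.mk_eq_zero]
  change u i • z ∈ boundaries u
  have hz' : ∑ j, z j * u j = 0 := by
    simpa [d₁, Fintype.linearCombination_apply] using hz
  have : u i • z = ∑ j, z j • (Pi.single j (u i) - Pi.single i (u j) : Fin s → S) := by
    funext k
    simp only [smul_sub, Finset.sum_sub_distrib, Pi.sub_apply, Finset.sum_apply, Pi.smul_apply,
      Pi.single_apply, smul_eq_mul, mul_ite, mul_zero, Finset.sum_ite_eq, Finset.mem_univ,
      if_true]
    by_cases hk : k = i
    · have hz'' : ∑ j, u j * z j = 0 := by simpa only [mul_comm] using hz'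
      simp [hk, hz'', mul_comm]
    · simp [hk, mul_comm]
  rw [this]
  exact Submodule.sum_mem _ fun j _ =>
    Submodule.smul_mem _ _ (Submodule.subset_span ⟨(i, j), rfl⟩)

/-- `H_1(u_1, …, u_s)` is annihilated by `u_1, …, u_s`, so it is a module over the quotient. -/
noncomputable instance : Module (S ⧸ Ideal.span (Set.range u)) (H₁ u) :=
  (H₁_isTorsion u).module

end Koszul

/-! ### Dimension theory of finitely generated modules -/

/-- All associated primes of `E` are minimal primes of `E`. -/
def IsUnmixedModule (T E : Type*) [CommRing T] [AddCommGroup E] [Module T E] : Prop :=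
  ∀ P ∈ associatedPrimes T E, P ∈ (Module.annihilator T E).minimalPrimes

/-- `dim T/P = dim E` for all minimal primes `P` of `E`. -/
def IsEquidimensionalModule (T E : Type*) [CommRing T] [AddCommGroup E] [Module T E] : Prop :=
  ∀ P ∈ (Module.annihilator T E).minimalPrimes, ringKrullDim (T ⧸ P) = Module.supportDim T E

/-- A Noetherian local ring is Cohen–Macaulay if its depth is its dimension: its maximal ideal
contains a regular sequence whose length is the Krull dimension. -/
def IsCohenMacaulayLocal (A : Type*) [CommRing A] [IsLocalRing A] [IsNoetherianRing A] : Prop :=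
  ∃ rs : List A, (∀ r ∈ rs, r ∈ IsLocalRing.maximalIdeal A) ∧
    RingTheory.Sequence.IsRegular A rs ∧ (rs.length : WithBot ℕ∞) = ringKrullDim A

/-! ### Rees algebras and their presentations -/

namespace Rees

open LaurentPolynomial

variable {A : Type u} [CommRing A] (I : Ideal A)

/-- The extended Rees algebra `A[It, t⁻¹]`, as a subalgebra of `A[t, t⁻¹]`. -/
noncomputable def extended : Subalgebra A A[T;T⁻¹] :=
  Algebra.adjoin A ({T (-1)} ∪ {x | ∃ a ∈ I, x = C a * T 1})

variable {I} {r : ℕ} (a : Fin r → I)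

/-- The `A`-algebra map `A[X_1, …, X_r] → A[It]`, `X_i ↦ a_i t`. -/
noncomputable def presentation : MvPolynomial (Fin r) A →ₐ[A] reesAlgebra I :=
  MvPolynomial.aeval fun i => ⟨Polynomial.monomial 1 (a i : A),
    reesAlgebra.monomial_mem.2 (by rw [pow_one]; exact (a i).2)⟩

/-- The `A`-algebra map `A[X_1, …, X_r, T] → A[It, t⁻¹]`, `X_i ↦ a_i t`, `T ↦ t⁻¹`. The variable
`T` is indexed by `none`, and `X_i` by `some i`. -/
noncomputable def extendedPresentation : MvPolynomial (Option (Fin r)) A →ₐ[A] extended I :=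
  MvPolynomial.aeval fun i => i.elim
    ⟨T (-1), Algebra.subset_adjoin (Or.inl rfl)⟩
    (fun i => ⟨C (a i : A) * T 1, Algebra.subset_adjoin (Or.inr ⟨a i, (a i).2, rfl⟩)⟩)

end Rees

/-! ### The symmetric square of an ideal -/

/-! Let `π : S → B` be a surjection from a polynomial `A`-algebra with kernel J. Both sides of each
equivalence are compared with one property of J: it is syzygetic, that is, Sym²(J) → S is injective.

André–Quillen side (`AndreQuillen.isZero_homology_two_iff_isSyzygetic`). Let P be the standard
resolution and Iₙ the kernel of Pₙ → B. The kernel of Iₙ/Iₙ² → B ⊗ Ω is simplicially constant,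
because two algebra maps over B agree modulo squares on elements with zero differential; so in
degree two the cotangent complex has the homology of I/I². As I is acyclic, this is H₁ of the
simplicial ideal I², and it vanishes exactly when I₀ is syzygetic. The property passes between
polynomial presentations by a homotopy argument: algebra maps that agree modulo an ideal induce the
same map on the kernel of Sym² → S (`SymSq.map_eq_map`).

Koszul side. The kernel of Sym²(J) → S is the kernel of H₁ → (S/J)ˢ, the classes of cycles with
entries in J (`Koszul.isSyzygetic_iff`). If J is syzygetic, H₁ embeds into (S/J)ˢ, so its associated
primes are associated to S/J. Since S/J sits between A and A[t, t⁻¹], these come from associated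
primes p of A; as A is Cohen–Macaulay, each such p has height 0 and dim A/p = dim A. The primes of
S/J are therefore minimal, with quotients of dimension dim A + 1.

Conversely let H₁ be unmixed. The link is a chart (`MvPolynomial.IsChart`): after inverting some v
outside the relevant minimal prime P₀ of J, the presentation becomes a retraction that eliminates
all variables but one. Hence J is generated there by n - 1 elements, n being the number of
variables, and every cycle with entries in J is a boundary up to a power of v. If J is given by s <
n generators, then its height is at least n - 1 ≥ s, and H₁ = 0 because S is Cohen–Macaulay. If s ≥
n, a rank count shows that P₀ contains the annihilator of H₁. A nonzero class with entries in J then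
leads to an associated prime of H₁ which contains a power of v and, by unmixedness, is contained in
P₀; this is absurd.

For the Rees algebra one takes v = aᵢ outside p, which exists because I has positive height; for the
extended algebra v is the variable that maps to t⁻¹. -/

open TensorProduct in
/-- The symmetric square of an ideal, as an additive group. -/
def SymSq {R : Type*} [CommRing R] (I : Ideal R) : Type _ :=
  (I ⊗[R] I) ⧸ AddSubgroup.closure {t : I ⊗[R] I | ∃ x y : I, t = x ⊗ₜ[R] y - y ⊗ₜ[R] x}

namespace SymSq

open TensorProduct

section Basic

variable {R : Type*} [CommRing R] {I : Ideal R}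

noncomputable instance : AddCommGroup (SymSq I) :=
  inferInstanceAs (AddCommGroup ((I ⊗[R] I) ⧸ AddSubgroup.closure _))

/-- The product of two elements of `I` in the symmetric square. -/
def sq (x y : I) : SymSq I := QuotientAddGroup.mk (x ⊗ₜ[R] y)

theorem sq_comm (x y : I) : sq x y = sq y x := by
  refine (QuotientAddGroup.eq_iff_sub_mem).2 (AddSubgroup.subset_closure ⟨x, y, rfl⟩)

theorem add_sq (x x' y : I) : sq (x + x') y = sq x y + sq x' y := by
  unfold sq; rw [TensorProduct.add_tmul]; rfl

theorem sq_add (x y y' : I) : sq x (y + y') = sq x y + sq x y' := by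
  unfold sq; rw [TensorProduct.tmul_add]; rfl

theorem smul_sq (r : R) (x y : I) : sq (r • x) y = sq x (r • y) := by
  unfold sq; rw [TensorProduct.smul_tmul]

@[elab_as_elim]
theorem induction_on {p : SymSq I → Prop} (t : SymSq I) (h0 : p 0) (hsq : ∀ x y, p (sq x y))
    (hadd : ∀ a b, p a → p b → p (a + b)) : p t := by
  obtain ⟨t, rfl⟩ := QuotientAddGroup.mk_surjective t
  induction t using TensorProduct.induction_on with
  | zero => exact h0
  | tmul x y => exact hsq x y
  | add a b ha hb => exact hadd _ _ ha hb

/-- Additive maps on the symmetric square from balanced symmetric biadditive maps. -/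
noncomputable def lift {G : Type*} [AddCommGroup G] (β : I →+ I →+ G)
    (hb : ∀ (r : R) x y, β (r • x) y = β x (r • y)) (hs : ∀ x y, β x y = β y x) :
    SymSq I →+ G :=
  QuotientAddGroup.lift _ (TensorProduct.liftAddHom β hb) (by
    rw [AddSubgroup.closure_le]
    rintro _ ⟨x, y, rfl⟩
    change TensorProduct.liftAddHom β hb _ = 0
    rw [map_sub, TensorProduct.liftAddHom_tmul, TensorProduct.liftAddHom_tmul, hs, sub_self])

@[simp]
theorem lift_sq {G : Type*} [AddCommGroup G] (β : I →+ I →+ G) (hb) (hs) (x y : I) :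
    lift β hb hs (sq x y) = β x y :=
  TensorProduct.liftAddHom_tmul β hb x y

theorem hom_ext {G : Type*} [AddCommGroup G] {f g : SymSq I →+ G}
    (h : ∀ x y, f (sq x y) = g (sq x y)) : f = g := by
  ext t
  induction t using induction_on with
  | h0 => simp
  | hsq x y => exact h x y
  | hadd a b ha hb => rw [map_add, map_add, ha, hb]

/-- `sq` as a biadditive map. -/
noncomputable def sqHom : I →+ I →+ SymSq I :=
  AddMonoidHom.mk' (fun x => AddMonoidHom.mk' (sq x) (sq_add x))
    (fun x x' => AddMonoidHom.ext fun y => add_sq x x' y)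

@[simp] theorem sqHom_apply (x y : I) : sqHom x y = sq x y := rfl

@[simp] theorem sq_zero (x : I) : sq x 0 = 0 := (sqHom x).map_zero

@[simp] theorem zero_sq (x : I) : sq 0 x = 0 := by rw [sq_comm, sq_zero]

theorem sq_sub (x y y' : I) : sq x (y - y') = sq x y - sq x y' := (sqHom x).map_sub y y'

theorem sub_sq (x x' y : I) : sq (x - x') y = sq x y - sq x' y := by
  rw [sq_comm, sq_sub, sq_comm y, sq_comm y]

theorem sq_sum {ι : Type*} (s : Finset ι) (x : I) (y : ι → I) :
    sq x (∑ i ∈ s, y i) = ∑ i ∈ s, sq x (y i) := map_sum (sqHom x) y s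

theorem exists_sum_sq (t : SymSq I) :
    ∃ (n : ℕ) (x y : Fin n → I), t = ∑ i, sq (x i) (y i) := by
  induction t using induction_on with
  | h0 => exact ⟨0, Fin.elim0, Fin.elim0, by simp⟩
  | hsq x y => exact ⟨1, fun _ => x, fun _ => y, by simp⟩
  | hadd a b ha hb =>
    obtain ⟨n, x, y, rfl⟩ := ha
    obtain ⟨m, x', y', rfl⟩ := hb
    exact ⟨n + m, Fin.append x x', Fin.append y y', by simp [Fin.sum_univ_add]⟩

/-- The multiplication map from the symmetric square of `I` to the ring. -/
noncomputable def mul : SymSq I →+ R :=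
  lift (AddMonoidHom.mk' (fun x => AddMonoidHom.mk' (fun y : I => (x : R) * y)
      (fun y y' => by simp [mul_add])) (fun x x' => AddMonoidHom.ext fun y => by simp [add_mul]))
    (fun r x y => by simp; ring) (fun x y => by simp; ring)

@[simp] theorem mul_sq (x y : I) : mul (sq x y) = x * y := lift_sq _ _ _ x y

theorem mul_mem (t : SymSq I) : mul t ∈ I ^ 2 := by
  induction t using induction_on with
  | h0 => simp
  | hsq x y => rw [mul_sq, pow_two]; exact Ideal.mul_mem_mul x.2 y.2
  | hadd a b ha hb => rw [map_add]; exact add_mem ha hb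

theorem exists_mul_eq {w : R} (hw : w ∈ I ^ 2) : ∃ t : SymSq I, mul t = w := by
  rw [pow_two] at hw
  induction hw using Submodule.mul_induction_on' with
  | mem_mul_mem x hx y hy => exact ⟨sq ⟨x, hx⟩ ⟨y, hy⟩, by simp⟩
  | add x _ y _ hx hy =>
    obtain ⟨a, rfl⟩ := hx
    obtain ⟨b, rfl⟩ := hy
    exact ⟨a + b, map_add _ _ _⟩

end Basic

section Map

variable {R R' R'' : Type*} [CommRing R] [CommRing R'] [CommRing R'']
  {I : Ideal R} {I' : Ideal R'} {I'' : Ideal R''}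

/-- The additive map that a ring homomorphism induces on ideals. -/
def idealMap (f : R →+* R') (h : I ≤ I'.comap f) : I →+ I' :=
  AddMonoidHom.mk' (fun x => ⟨f x, h x.2⟩) (fun x y => Subtype.ext (by simp))

@[simp] theorem coe_idealMap (f : R →+* R') (h : I ≤ I'.comap f) (x : I) :
    (idealMap f h x : R') = f x := rfl

/-- Functoriality of the symmetric square. -/
noncomputable def map (f : R →+* R') (h : I ≤ I'.comap f) : SymSq I →+ SymSq I' :=
  lift ((sqHom.compl₂ (idealMap f h)).comp (idealMap f h))
    (fun r x y => by
      have e : ∀ x : I, idealMap f h (r • x) = f r • idealMap f h x :=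
        fun x => Subtype.ext (by simp)
      simp [e, smul_sq])
    (fun x y => by simp [sq_comm])

@[simp] theorem map_sq (f : R →+* R') (h : I ≤ I'.comap f) (x y : I) :
    map f h (sq x y) = sq ⟨f x, h x.2⟩ ⟨f y, h y.2⟩ := lift_sq _ _ _ x y

theorem mul_map (f : R →+* R') (h : I ≤ I'.comap f) (t : SymSq I) :
    mul (map f h t) = f (mul t) := by
  have : mul.comp (map f h) = (f : R →+ R').comp mul := hom_ext fun x y => by simp
  exact DFunLike.congr_fun this t

theorem map_map (f : R →+* R') (h : I ≤ I'.comap f) (g : R' →+* R'') (h' : I' ≤ I''.comap g)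
    (k : R →+* R'') (hk : g.comp f = k) (h'' : I ≤ I''.comap k) (t : SymSq I) :
    map g h' (map f h t) = map k h'' t := by
  subst hk
  have : (map g h').comp (map f h) = map (g.comp f) h'' := hom_ext fun x y => by simp
  exact DFunLike.congr_fun this t

theorem map_id (t : SymSq I) (f : R →+* R) (hf : f = RingHom.id R) (h : I ≤ I.comap f) :
    map f h t = t := by
  subst hf
  have : map (RingHom.id R) h = AddMonoidHom.id _ := hom_ext fun x y => by simp
  exact DFunLike.congr_fun this t

end Map

attribute [irreducible] SymSq sq lift mul map

/-! ### Homotopy invariance of the kernel of Sym²(I) → R. -/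

section Homotopy

open Polynomial

variable {R : Type*} [CommRing R] {I : Ideal R} {J : Ideal R[X]}

/-- Splitting f = f(0) + X · (f - f(0))/X in each factor, every term other than the constant one
contains a multiple of X, and balancedness and symmetry move it into the form u · X. -/
theorem exists_eq_map_C_add (t : SymSq J) (h0 : J ≤ I.comap constantCoeff) (hC : I ≤ J.comap C)
    (hX : X ∈ J) :
    ∃ u : J, t = map C hC (map constantCoeff h0 t) + sq u ⟨X, hX⟩ := by
  induction t using induction_on with
  | h0 => exact ⟨0, by simp⟩
  | hadd a b ha hb =>
    obtain ⟨u, hu⟩ := ha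
    obtain ⟨v, hv⟩ := hb
    refine ⟨u + v, ?_⟩
    rw [map_add, map_add, add_sq]
    nth_rw 1 [hu, hv]
    abel
  | hsq x y =>
    let X' : J := ⟨X, hX⟩
    let x0 : J := ⟨C (constantCoeff x.1), hC (h0 x.2)⟩
    let y0 : J := ⟨C (constantCoeff y.1), hC (h0 y.2)⟩
    have hx : x = x0 + (divX x.1) • X' := Subtype.ext (by
      simp only [x0, X', Submodule.coe_add, Submodule.coe_smul, smul_eq_mul]
      rw [add_comm]; exact (divX_mul_X_add x.1).symm)
    have hy : y = y0 + (divX y.1) • X' := Subtype.ext (by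
      simp only [y0, X', Submodule.coe_add, Submodule.coe_smul, smul_eq_mul]
      rw [add_comm]; exact (divX_mul_X_add y.1).symm)
    refine ⟨divX y.1 • x0 + divX x.1 • y, ?_⟩
    have : sq x y = sq x0 y0 + (sq (divX y.1 • x0) X' + sq (divX x.1 • y) X') := by
      nth_rw 1 [hx]
      rw [add_sq]
      nth_rw 1 [hy]
      rw [sq_add, ← smul_sq (divX y.1) x0, smul_sq (divX x.1) X' y, sq_comm X', add_assoc]
    rw [this, add_sq, map_add, map_add, map_add, map_add]
    have e : ∀ z : J,
        map (constantCoeff : R[X] →+* R) h0 (sq z X') = 0 := by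
      intro z
      rw [map_sq]
      convert sq_zero _
      simp [X']
    rw [e, e]
    simp [x0, y0, X']

/-- The remainder u · X is multiplied out to uX = 0, and X is a nonzerodivisor, so u = 0. -/
theorem eq_map_C_of_mul_eq_zero (t : SymSq J) (h0 : J ≤ I.comap constantCoeff)
    (hC : I ≤ J.comap C) (hX : X ∈ J) (ht : mul t = 0) :
    t = map C hC (map constantCoeff h0 t) := by
  obtain ⟨u, hu⟩ := exists_eq_map_C_add t h0 hC hX
  have h0 : mul (map C hC (map constantCoeff h0 t)) = 0 := by
    rw [mul_map, mul_map, ht, map_zero, map_zero]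
  have h1 : (u : R[X]) * X = 0 := by
    have := congrArg mul hu
    rw [ht, map_add, h0, zero_add, mul_sq] at this
    exact this.symm
  have hu0 : u = 0 := Subtype.ext (by simpa using h1)
  rw [hu0, zero_sq, add_zero] at hu
  exact hu

/-- Here `e` followed by `θ` is a path that starts at `φ` and ends at `ψ`. A relation pushed along
`e` into the preimage of `I` under X ↦ 0 is constant by the previous lemma, so both ends give the
same value. -/
theorem map_eq_map_of_path {R' : Type*} [CommRing R'] {I' : Ideal R'} (e : R →+* R[X])
    (he : ∀ x, constantCoeff (e x) = x) (θ : R[X] →+* R') (hθ : θ X ∈ I')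
    (φ ψ : R →+* R') (hφ' : θ.comp C = φ) (hψ' : θ.comp e = ψ)
    (hφ : I ≤ I'.comap φ) (hψ : I ≤ I'.comap ψ) (t : SymSq I) (ht : mul t = 0) :
    map φ hφ t = map ψ hψ t := by
  obtain ⟨J, hJ⟩ : ∃ J : Ideal R[X], J = I.comap constantCoeff := ⟨_, rfl⟩
  have mem (g : R[X]) : g ∈ J ↔ constantCoeff g ∈ I := by rw [hJ]; rfl
  have h0 : J ≤ I.comap constantCoeff := hJ.le
  have hI : I ≤ J.comap e := fun x hx => (mem _).2 (by rwa [he])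
  have hC : I ≤ J.comap C := fun x hx => (mem _).2 (by simpa using hx)
  have hX : X ∈ J := (mem _).2 (by simp)
  have hJ' : J ≤ I'.comap θ := by
    intro g hg
    change θ g ∈ I'
    rw [← divX_mul_X_add g, map_add, map_mul]
    refine add_mem (Ideal.mul_mem_left _ _ hθ) ?_
    have : θ (C (g.coeff 0)) = φ (g.coeff 0) := DFunLike.congr_fun hφ' _
    rw [this]; exact hφ ((mem g).1 hg)
  have key := eq_map_C_of_mul_eq_zero (map e hI t) h0 hC hX (by rw [mul_map, ht, map_zero])
  rw [map_map _ hI _ h0 (RingHom.id R) (RingHom.ext he) (fun x hx => hx),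
    map_id t _ rfl (fun x hx => hx)] at key
  rw [← map_map e hI θ hJ' _ hψ' hψ, key, map_map _ hC θ hJ' _ hφ' hφ]

end Homotopy

section Homotopy

variable {A : Type*} [CommRing A] {σ : Type*} {R' : Type*} [CommRing R'] [Algebra A R']
  {I : Ideal (MvPolynomial σ A)} {I' : Ideal R'}

theorem map_eq_map_of_eq_off (φ ψ : MvPolynomial σ A →ₐ[A] R') (i : σ)
    (hi : ∀ j ≠ i, φ (MvPolynomial.X j) = ψ (MvPolynomial.X j))
    (hφ : I ≤ I'.comap (φ : MvPolynomial σ A →+* R'))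
    (hψ : I ≤ I'.comap (ψ : MvPolynomial σ A →+* R'))
    (h : φ (MvPolynomial.X i) - ψ (MvPolynomial.X i) ∈ I') (t : SymSq I) (ht : mul t = 0) :
    map (φ : MvPolynomial σ A →+* R') hφ t = map (ψ : MvPolynomial σ A →+* R') hψ t := by
  classical
  -- The path translates the i-th variable by the parameter; `θ` sets the parameter to the
  -- difference of the two values, which lies in `I'`.
  let e : MvPolynomial σ A →ₐ[A] Polynomial (MvPolynomial σ A) :=
    MvPolynomial.aeval fun j => Polynomial.C (MvPolynomial.X j) + if j = i then Polynomial.X else 0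
  let θ : Polynomial (MvPolynomial σ A) →+* R' :=
    Polynomial.eval₂RingHom (φ : MvPolynomial σ A →+* R')
      (ψ (MvPolynomial.X i) - φ (MvPolynomial.X i))
  have he : (Polynomial.constantCoeff : Polynomial (MvPolynomial σ A) →+* _).comp
      (e : MvPolynomial σ A →+* _) = RingHom.id _ := by
    ext j
    · simp [e, Polynomial.algebraMap_apply]
    · by_cases hj : j = i <;> simp [e, hj]
  have hθe : θ.comp (e : MvPolynomial σ A →+* _) = (ψ : MvPolynomial σ A →+* R') := by
    ext j
    · simp [e, θ, Polynomial.algebraMap_apply, MvPolynomial.algebraMap_eq]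
    · by_cases hj : j = i
      · simp [e, θ, hj]
      · simp [e, θ, hj, hi j hj]
  have hθC : θ.comp Polynomial.C = (φ : MvPolynomial σ A →+* R') := by
    ext j <;> simp [θ]
  refine map_eq_map_of_path (e : MvPolynomial σ A →+* _) (fun x => DFunLike.congr_fun he x) θ ?_
    _ _ hθC hθe hφ hψ t ht
  have : θ Polynomial.X = -(φ (MvPolynomial.X i) - ψ (MvPolynomial.X i)) := by simp [θ]
  rw [this]; exact neg_mem h

/-- Algebra homomorphisms from a polynomial algebra that agree modulo an ideal induce the same map
on the relations of degree two. -/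
theorem map_eq_map (φ ψ : MvPolynomial σ A →ₐ[A] R')
    (hφ : I ≤ I'.comap (φ : MvPolynomial σ A →+* R'))
    (hψ : I ≤ I'.comap (ψ : MvPolynomial σ A →+* R'))
    (h : ∀ i, φ (MvPolynomial.X i) - ψ (MvPolynomial.X i) ∈ I') (t : SymSq I) (ht : mul t = 0) :
    map (φ : MvPolynomial σ A →+* R') hφ t = map (ψ : MvPolynomial σ A →+* R') hψ t := by
  classical
  -- Interpolation between `φ` and `ψ`, exchanging one variable at a time. For infinite `σ` finitely
  -- many exchanges suffice, since a given `t` involves finitely many variables.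
  let χ (F : Finset σ) : MvPolynomial σ A →ₐ[A] R' :=
    MvPolynomial.aeval fun j => if j ∈ F then ψ (MvPolynomial.X j) else φ (MvPolynomial.X j)
  have hmod (F : Finset σ) : ∀ x, φ x - χ F x ∈ I' := by
    intro x
    have : (Ideal.Quotient.mkₐ A I').comp φ = (Ideal.Quotient.mkₐ A I').comp (χ F) := by
      refine MvPolynomial.algHom_ext fun j => ?_
      simp only [AlgHom.comp_apply, χ, MvPolynomial.aeval_X]
      split_ifs
      · exact Ideal.Quotient.eq.2 (h j)
      · rfl
    exact Ideal.Quotient.eq.1 (DFunLike.congr_fun this x)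
  have hχ (F : Finset σ) : I ≤ I'.comap (χ F : MvPolynomial σ A →+* R') := fun x hx => by
    have := sub_mem (show φ x ∈ I' from hφ hx) (hmod F x)
    rwa [sub_sub_cancel] at this
  have step (F : Finset σ) : map (φ : MvPolynomial σ A →+* R') hφ t = map _ (hχ F) t := by
    induction F using Finset.induction_on with
    | empty =>
      have : (χ ∅) = φ := MvPolynomial.algHom_ext fun j => by simp [χ]
      simp [this]
    | insert i F hi ih =>
      rw [ih]
      refine map_eq_map_of_eq_off _ _ i (fun j hj => ?_) _ _ ?_ t ht
      · simp [χ, hj]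
      · simpa [χ, hi] using h i
  obtain ⟨n, x, y, rfl⟩ := exists_sum_sq t
  let F : Finset σ := Finset.univ.biUnion fun k => (x k : MvPolynomial σ A).vars ∪
    (y k : MvPolynomial σ A).vars
  have hF (p : MvPolynomial σ A) (hp : p.vars ⊆ F) : χ F p = ψ p := by
    have : ψ = MvPolynomial.aeval fun j => ψ (MvPolynomial.X j) :=
      MvPolynomial.algHom_ext fun j => by simp
    rw [this]
    refine MvPolynomial.eval₂Hom_congr' rfl ?_ rfl
    intro j hj _
    simp [hp hj]
  rw [step F, map_sum, map_sum]
  refine Finset.sum_congr rfl fun k _ => ?_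
  rw [map_sq, map_sq]
  congr 1 <;> refine Subtype.ext (hF _ ?_)
  · exact (Finset.subset_union_left).trans (Finset.subset_biUnion_of_mem
      (fun k => (x k : MvPolynomial σ A).vars ∪ (y k : MvPolynomial σ A).vars) (Finset.mem_univ k))
  · exact (Finset.subset_union_right).trans (Finset.subset_biUnion_of_mem
      (fun k => (x k : MvPolynomial σ A).vars ∪ (y k : MvPolynomial σ A).vars) (Finset.mem_univ k))

end Homotopy

end SymSq

/-- An ideal is syzygetic if its symmetric square maps injectively to the ring. -/
def Ideal.IsSyzygetic {R : Type*} [CommRing R] (I : Ideal R) : Prop :=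
  ∀ t : SymSq I, SymSq.mul t = 0 → t = 0

/-- By homotopy invariance a relation equals its image under ψ ∘ φ, and this image passes through
the relations of `I'`, which are zero. -/
theorem Ideal.IsSyzygetic.of_comp {A : Type*} [CommRing A] {σ : Type*} {R' : Type*}
    [CommRing R'] [Algebra A R'] {I : Ideal (MvPolynomial σ A)} {I' : Ideal R'}
    (hS : I'.IsSyzygetic) (φ : MvPolynomial σ A →ₐ[A] R')
    (ψ : R' →ₐ[A] MvPolynomial σ A) (χ : MvPolynomial σ A →ₐ[A] MvPolynomial σ A)
    (hχ : ψ.comp φ = χ) (hφ : I ≤ I'.comap (φ : MvPolynomial σ A →+* R'))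
    (hψ : I' ≤ I.comap (ψ : R' →+* MvPolynomial σ A))
    (h : ∀ i, MvPolynomial.X i - χ (MvPolynomial.X i) ∈ I) : I.IsSyzygetic := by
  intro t ht
  have hk : (ψ : R' →+* MvPolynomial σ A).comp (φ : MvPolynomial σ A →+* R') =
    (χ : MvPolynomial σ A →+* MvPolynomial σ A) := by rw [← hχ]; rfl
  have h3 : I ≤ I.comap (χ : MvPolynomial σ A →+* _) := by
    rw [← hk]; exact fun x hx => hψ (hφ hx)
  have h4 : I ≤ I.comap (AlgHom.id A (MvPolynomial σ A) : MvPolynomial σ A →+* _) :=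
    fun x hx => hx
  have e := SymSq.map_eq_map (AlgHom.id A _) χ h4 h3 h t ht
  rw [SymSq.map_id t _ (by rfl) h4] at e
  rw [e, ← SymSq.map_map _ hφ _ hψ _ hk h3,
    hS (SymSq.map _ hφ t) (by rw [SymSq.mul_map, ht, map_zero]), map_zero]

/-- If `S → B` is a presentation by a polynomial algebra and `S'` is another algebra over `B`
whose kernel is syzygetic, with maps in both directions over `B`, then the kernel of `S → B`
is syzygetic. -/
theorem Ideal.IsSyzygetic.of_retract {A : Type*} [CommRing A] {σ : Type*} {R' B : Type*}
    [CommRing R'] [Algebra A R'] [CommRing B] [Algebra A B]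
    {π : MvPolynomial σ A →ₐ[A] B} {π' : R' →ₐ[A] B}
    (hS : (RingHom.ker π').IsSyzygetic) (φ : MvPolynomial σ A →ₐ[A] R')
    (hφ : ∀ x, π' (φ x) = π x)
    (ψ : R' →ₐ[A] MvPolynomial σ A) (hψ : ∀ x, π (ψ x) = π' x) :
    (RingHom.ker π).IsSyzygetic := by
  refine hS.of_comp φ ψ _ rfl (fun x hx => ?_) (fun x hx => ?_) (fun i => ?_)
  · exact (hφ x).trans hx
  · exact (hψ x).trans hx
  · rw [RingHom.mem_ker, map_sub, sub_eq_zero, AlgHom.comp_apply, hψ, hφ]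

/-! ### Squares of ideals in a truncated simplicial ring -/

namespace SymSq

section Simplicial

variable {P₀ P₁ P₂ : Type*} [CommRing P₀] [CommRing P₁] [CommRing P₂]
  {I₀ : Ideal P₀} {I₁ : Ideal P₁} {I₂ : Ideal P₂}
  (d₀ d₁ : P₁ →+* P₀) (e₀ e₁ e₂ : P₂ →+* P₁) (s : P₀ →+* P₁) (t₀ t₁ : P₁ →+* P₂)

/-- The elements `e₀ v` with `v ∈ I₂²` and `e₁ v = e₂ v = 0`. -/
def boundary (I₂ : Ideal P₂) : AddSubgroup P₁ :=
  AddSubgroup.map (e₀ : P₂ →+ P₁)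
    ((I₂ ^ 2).toAddSubgroup ⊓ ((e₁ : P₂ →+ P₁).ker ⊓ (e₂ : P₂ →+ P₁).ker))

variable {e₀ e₁ e₂} in
theorem mem_boundary {w : P₁} :
    w ∈ boundary e₀ e₁ e₂ I₂ ↔ ∃ v ∈ I₂ ^ 2, e₀ v = w ∧ e₁ v = 0 ∧ e₂ v = 0 := by
  constructor
  · rintro ⟨v, ⟨hv, h1, h2⟩, rfl⟩
    exact ⟨v, hv, rfl, h1, h2⟩
  · rintro ⟨v, hv, rfl, h1, h2⟩
    exact ⟨v, ⟨hv, h1, h2⟩, rfl⟩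

variable (hI₁₂ : ∀ x ∈ I₁, t₀ x ∈ I₂) (hI₁₂' : ∀ x ∈ I₁, t₁ x ∈ I₂)
  (hI₁₀ : ∀ x ∈ I₁, d₀ x ∈ I₀) (hI₁₀' : ∀ x ∈ I₁, d₁ x ∈ I₀) (hI₀₁ : ∀ x ∈ I₀, s x ∈ I₁)
  (hl₀ : ∀ x ∈ I₀, ∃ n ∈ I₁, d₀ n = x ∧ d₁ n = 0)
  (hl₁ : ∀ w ∈ I₁, d₀ w = 0 → d₁ w = 0 → ∃ m ∈ I₂, e₀ m = w ∧ e₁ m = 0 ∧ e₂ m = 0)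
  (hds₀ : ∀ x, d₀ (s x) = x) (hds₁ : ∀ x, d₁ (s x) = x)
  (h₀₀ : ∀ x, e₀ (t₀ x) = x) (h₁₀ : ∀ x, e₁ (t₀ x) = x) (h₂₀ : ∀ x, e₂ (t₀ x) = s (d₁ x))
  (h₀₁ : ∀ x, e₀ (t₁ x) = s (d₀ x)) (h₁₁ : ∀ x, e₁ (t₁ x) = x) (h₂₁ : ∀ x, e₂ (t₁ x) = x)

include hI₁₂ hl₁ h₀₀ in
-- If m bounds w, then m times a degeneracy of y bounds wy, and it is a product of two elements of
-- `I₂`.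
theorem cycle_mul_mem_boundary {w y : P₁} (hw : w ∈ I₁) (h0 : d₀ w = 0) (h1 : d₁ w = 0)
    (hy : y ∈ I₁) : w * y ∈ boundary e₀ e₁ e₂ I₂ := by
  obtain ⟨m, hm, hm0, hm1, hm2⟩ := hl₁ w hw h0 h1
  refine mem_boundary.2 ⟨m * t₀ y, ?_, ?_, ?_, ?_⟩
  · rw [pow_two]; exact Ideal.mul_mem_mul hm (hI₁₂ y hy)
  · rw [map_mul, hm0, h₀₀]
  · rw [map_mul, hm1, zero_mul]
  · rw [map_mul, hm2, zero_mul]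

include hI₁₂ hI₁₂' h₀₀ h₁₀ h₂₀ h₀₁ h₁₁ in
-- The difference of the two degeneracies of b vanishes under `e₁`, and the degeneracy of a vanishes
-- under `e₂`.
theorem mul_sub_mem_boundary {a b : P₁} (ha : a ∈ I₁) (hb : b ∈ I₁) (ha1 : d₁ a = 0) :
    a * b - a * s (d₀ b) ∈ boundary e₀ e₁ e₂ I₂ := by
  refine mem_boundary.2 ⟨t₀ a * (t₀ b - t₁ b), ?_, ?_, ?_, ?_⟩
  · rw [pow_two]
    exact Ideal.mul_mem_mul (hI₁₂ a ha) (sub_mem (hI₁₂ b hb) (hI₁₂' b hb))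
  · simp [h₀₀, h₀₁, mul_sub]
  · simp [h₁₀, h₁₁]
  · simp [h₂₀, ha1]

include hI₁₂ hI₁₂' hI₁₀ hI₁₀' hI₀₁ hl₀ hl₁ hds₀ hds₁ h₀₀ h₁₀ h₂₀ h₀₁ h₁₁ in
/-- If `I₀` is syzygetic, the cycles in `I₁²` are boundaries of elements of `I₂²`. -/
theorem mem_boundary_of_isSyzygetic (hS : I₀.IsSyzygetic) {w : P₁} (hw : w ∈ I₁ ^ 2)
    (hw0 : d₀ w = 0) (hw1 : d₁ w = 0) : ∃ v ∈ I₂ ^ 2, e₀ v = w ∧ e₁ v = 0 ∧ e₂ v = 0 := by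
  have hZ {w y : P₁} (hw : w ∈ I₁) (h0 : d₀ w = 0) (h1 : d₁ w = 0) (hy : y ∈ I₁) :
      w * y ∈ boundary e₀ e₁ e₂ I₂ :=
    cycle_mul_mem_boundary d₀ d₁ e₀ e₁ e₂ t₀ hI₁₂ hl₁ h₀₀ hw h0 h1 hy
  have hY {a b : P₁} (ha : a ∈ I₁) (hb : b ∈ I₁) (ha1 : d₁ a = 0) :
      a * b - a * s (d₀ b) ∈ boundary e₀ e₁ e₂ I₂ :=
    mul_sub_mem_boundary d₀ d₁ e₀ e₁ e₂ s t₀ t₁ hI₁₂ hI₁₂' h₀₀ h₁₀ h₂₀ h₀₁ h₁₁ ha hb ha1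
  -- The plan is a map Φ from Sym²(I₀) to `P₁` modulo boundaries, x · y ↦ n(x) s(y). The lift n is
  -- not additive, but its defects are cycles, whose products with `I₁` are boundaries. Symmetry
  -- holds because n(x) s(y) and n(x) n(y) differ by a boundary.
  choose! n hn hn0 hn1 using hl₀
  rw [← mem_boundary]
  let V := boundary e₀ e₁ e₂ I₂
  have eq {a b : P₁} (h : a - b ∈ V) : (QuotientAddGroup.mk a : P₁ ⧸ V) = QuotientAddGroup.mk b :=
    (QuotientAddGroup.eq_iff_sub_mem).2 h
  let β : I₀ →+ I₀ →+ P₁ ⧸ V := AddMonoidHom.mk'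
    (fun x => AddMonoidHom.mk' (fun y : I₀ => (QuotientAddGroup.mk (n x * s y) : P₁ ⧸ V))
      (fun y y' => by simp [mul_add]))
    (fun x x' => by
      ext y
      refine eq ?_
      have : n ((x + x' : I₀) : P₀) * s y - (n x * s y + n x' * s y) =
        (n ((x + x' : I₀) : P₀) - n x - n x') * s y := by ring
      rw [this]
      exact hZ (sub_mem (sub_mem (hn _ (x + x').2) (hn _ x.2)) (hn _ x'.2))
        (by simp only [map_sub, hn0 _ (x + x').2, hn0 _ x.2, hn0 _ x'.2]; simp)
        (by simp only [map_sub, hn1 _ (x + x').2, hn1 _ x.2, hn1 _ x'.2]; simp) (hI₀₁ _ y.2))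
  have hβ (x y : I₀) : β x y = QuotientAddGroup.mk (n x * s y) := rfl
  let Φ : SymSq I₀ →+ P₁ ⧸ V := lift β
    (fun r x y => by
      rw [hβ, hβ]
      refine eq ?_
      have : n ((r • x : I₀) : P₀) * s y - n x * s ((r • y : I₀) : P₀) =
        (n ((r • x : I₀) : P₀) - s r * n x) * s y := by simp; ring
      rw [this]
      exact hZ (sub_mem (hn _ (r • x).2) (Ideal.mul_mem_left _ _ (hn _ x.2)))
        (by simp only [map_sub, map_mul, hn0 _ (r • x).2, hn0 _ x.2, hds₀]; simp)
        (by simp only [map_sub, map_mul, hn1 _ (r • x).2, hn1 _ x.2]; simp) (hI₀₁ _ y.2))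
    (fun x y => by
      rw [hβ, hβ]
      have h1 := hY (hn _ x.2) (hn _ y.2) (hn1 _ x.2)
      have h2 := hY (hn _ y.2) (hn _ x.2) (hn1 _ y.2)
      rw [hn0 _ y.2] at h1
      rw [hn0 _ x.2] at h2
      rw [← eq h1, ← eq h2, mul_comm])
  have hΦ (x y : I₀) : Φ (sq x y) = QuotientAddGroup.mk (n x * s y) := lift_sq _ _ _ x y
  have hΦ' {a : P₁} (ha : a ∈ I₁) (ha1 : d₁ a = 0) (y : I₀) :
      (QuotientAddGroup.mk (a * s y) : P₁ ⧸ V) = Φ (sq ⟨d₀ a, hI₁₀ a ha⟩ y) := by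
    rw [hΦ]
    refine eq ?_
    rw [← sub_mul]
    exact hZ (sub_mem ha (hn _ (hI₁₀ a ha))) (by simp [hn0 _ (hI₁₀ a ha)])
      (by simp [ha1, hn1 _ (hI₁₀ a ha)]) (hI₀₁ _ y.2)
  -- Modulo boundaries every w in I₁² is Φ(t) plus a degenerate term, where t multiplies to d₀w -
  -- d₁w. For a cycle the degenerate term is zero and t is a relation, so t = 0.
  have hW : ∃ t : SymSq I₀, (QuotientAddGroup.mk w : P₁ ⧸ V) =
      Φ t + QuotientAddGroup.mk (s (d₁ w)) ∧ mul t = d₀ w - d₁ w := by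
    clear hw0 hw1
    rw [pow_two] at hw
    induction hw using Submodule.mul_induction_on' with
    | mem_mul_mem x hx y hy =>
      -- Subtracting the degenerate part makes `d₁` vanish; xy is then expanded in the normalized
      -- parts and the degenerate ones.
      have ha : x - s (d₁ x) ∈ I₁ := sub_mem hx (hI₀₁ _ (hI₁₀' x hx))
      have hb : y - s (d₁ y) ∈ I₁ := sub_mem hy (hI₀₁ _ (hI₁₀' y hy))
      have ha1 : d₁ (x - s (d₁ x)) = 0 := by simp [hds₁]
      have hb1 : d₁ (y - s (d₁ y)) = 0 := by simp [hds₁]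
      refine ⟨sq ⟨_, hI₁₀ _ ha⟩ ⟨_, hI₁₀ _ hb⟩ + sq ⟨_, hI₁₀ _ ha⟩ ⟨_, hI₁₀' y hy⟩ +
        sq ⟨_, hI₁₀ _ hb⟩ ⟨_, hI₁₀' x hx⟩, ?_, ?_⟩
      · rw [map_add, map_add, ← hΦ' ha ha1, ← hΦ' ha ha1, ← hΦ' hb hb1, ← eq (hY ha hb ha1)]
        rw [← QuotientAddGroup.mk_add, ← QuotientAddGroup.mk_add, ← QuotientAddGroup.mk_add]
        congr 1
        rw [map_mul, map_mul]
        ring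
      · simp only [map_add, mul_sq, map_sub, map_mul, hds₀]
        ring
    | add x _ y _ hx hy =>
      obtain ⟨a, ha, ha'⟩ := hx
      obtain ⟨b, hb, hb'⟩ := hy
      refine ⟨a + b, ?_, ?_⟩
      · simp only [map_add, QuotientAddGroup.mk_add, ha, hb]
        abel
      · simp only [map_add, ha', hb']
        abel
  obtain ⟨t, ht, ht'⟩ := hW
  rw [hw0, hw1, sub_zero] at ht'
  rw [hS t ht', hw1] at ht
  simpa [QuotientAddGroup.eq_zero_iff] using ht

end Simplicial

section Simplicial

variable {A : Type*} [CommRing A] {σ : Type*} {P₀ P₂ P₃ : Type*} [CommRing P₀] [Algebra A P₀]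
  [CommRing P₂] [CommRing P₃]
  {I₀ : Ideal P₀} {I₁ : Ideal (MvPolynomial σ A)} {I₂ : Ideal P₂}
  (d₀ d₁ : MvPolynomial σ A →ₐ[A] P₀) (e₀ e₁ e₂ : P₂ →+* MvPolynomial σ A)
  (f₀ f₁ f₂ f₃ : P₃ →+* P₂)

/-- This shows that the class of a relation is detected by H₁ of I². By homotopy invariance, D₀τ -
D₁τ depends only on the product of τ, an element of I₁². The simplicial identities on lifts of the
faces of `v` to Sym²(I₂) then force this value to vanish on a boundary. -/
theorem map_eq_map_of_boundary
    (hd₀ : I₁ ≤ I₀.comap (d₀ : MvPolynomial σ A →+* P₀))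
    (hd₁ : I₁ ≤ I₀.comap (d₁ : MvPolynomial σ A →+* P₀))
    (hd : ∀ i, d₀ (MvPolynomial.X i) - d₁ (MvPolynomial.X i) ∈ I₀)
    (he₀ : I₂ ≤ I₁.comap e₀) (he₁ : I₂ ≤ I₁.comap e₁) (he₂ : I₂ ≤ I₁.comap e₂)
    (h₀₁ : ∀ x, d₀ (e₁ x) = d₀ (e₀ x)) (h₀₂ : ∀ x, d₀ (e₂ x) = d₁ (e₀ x))
    (h₁₂ : ∀ x, d₁ (e₂ x) = d₁ (e₁ x))
    (k₀₁ : ∀ x, e₀ (f₁ x) = e₀ (f₀ x)) (k₀₂ : ∀ x, e₀ (f₂ x) = e₁ (f₀ x))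
    (k₀₃ : ∀ x, e₀ (f₃ x) = e₂ (f₀ x))
    (k₁₂ : ∀ x, e₁ (f₂ x) = e₁ (f₁ x)) (k₁₃ : ∀ x, e₁ (f₃ x) = e₂ (f₁ x))
    (k₂₃ : ∀ x, e₂ (f₃ x) = e₂ (f₂ x))
    (t : SymSq I₁) (z : P₂) (hz₀ : e₀ z = mul t) (hz₁ : e₁ z = 0) (hz₂ : e₂ z = 0)
    (v : P₃) (hv₀ : f₀ v - z ∈ I₂ ^ 2) (hv₁ : f₁ v ∈ I₂ ^ 2) (hv₂ : f₂ v ∈ I₂ ^ 2)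
    (hv₃ : f₃ v ∈ I₂ ^ 2) :
    map (d₀ : MvPolynomial σ A →+* P₀) hd₀ t = map (d₁ : MvPolynomial σ A →+* P₀) hd₁ t := by
  obtain ⟨κ₀, hκ₀⟩ := exists_mul_eq hv₀
  obtain ⟨κ₁, hκ₁⟩ := exists_mul_eq hv₁
  obtain ⟨κ₂, hκ₂⟩ := exists_mul_eq hv₂
  obtain ⟨κ₃, hκ₃⟩ := exists_mul_eq hv₃
  let D₀ := map (d₀ : MvPolynomial σ A →+* P₀) hd₀
  let D₁ := map (d₁ : MvPolynomial σ A →+* P₀) hd₁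
  let E₀ := map e₀ he₀
  let E₁ := map e₁ he₁
  let E₂ := map e₂ he₂
  have mE₀ (κ : SymSq I₂) : mul (E₀ κ) = e₀ (mul κ) := mul_map _ _ _
  have mE₁ (κ : SymSq I₂) : mul (E₁ κ) = e₁ (mul κ) := mul_map _ _ _
  have mE₂ (κ : SymSq I₂) : mul (E₂ κ) = e₂ (mul κ) := mul_map _ _ _
  have wd (τ τ' : SymSq I₁) (h : mul τ = mul τ') : D₀ τ - D₁ τ = D₀ τ' - D₁ τ' := by
    have := map_eq_map d₀ d₁ hd₀ hd₁ hd (τ - τ') (by rw [map_sub, h, sub_self])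
    change D₀ (τ - τ') = D₁ (τ - τ') at this
    rw [map_sub, map_sub, sub_eq_sub_iff_add_eq_add] at this
    rw [sub_eq_sub_iff_add_eq_add, this, add_comm]
  have comm₁ (κ : SymSq I₂) : D₀ (E₁ κ) = D₀ (E₀ κ) := by
    have : D₀.comp E₁ = D₀.comp E₀ := hom_ext fun x y => by
      simp [D₀, E₁, E₀, h₀₁]
    exact DFunLike.congr_fun this κ
  have comm₂ (κ : SymSq I₂) : D₀ (E₂ κ) = D₁ (E₀ κ) := by
    have : D₀.comp E₂ = D₁.comp E₀ := hom_ext fun x y => by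
      simp [D₀, D₁, E₂, E₀, h₀₂]
    exact DFunLike.congr_fun this κ
  have comm₃ (κ : SymSq I₂) : D₁ (E₂ κ) = D₁ (E₁ κ) := by
    have : D₁.comp E₂ = D₁.comp E₁ := hom_ext fun x y => by
      simp [D₁, E₂, E₁, h₁₂]
    exact DFunLike.congr_fun this κ
  -- Each identity compares two elements of Sym²(I₁) with the same product. The six relations form a
  -- linear system whose combination gives D₀t - D₁t = 0.
  have r₁ := wd t (E₀ κ₁ - E₀ κ₀) (by
    rw [map_sub, mE₀, mE₀, hκ₁, hκ₀, ← hz₀, map_sub, k₀₁]; ring)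
  have r₂ := wd (E₀ κ₂) (E₁ κ₀) (by
    rw [mE₀, mE₁, hκ₂, hκ₀, map_sub, hz₁, k₀₂, sub_zero])
  have r₃ := wd (E₀ κ₃) (E₂ κ₀) (by
    rw [mE₀, mE₂, hκ₃, hκ₀, map_sub, hz₂, k₀₃, sub_zero])
  have r₄ := wd (E₁ κ₂) (E₁ κ₁) (by rw [mE₁, mE₁, hκ₂, hκ₁, k₁₂])
  have r₅ := wd (E₁ κ₃) (E₂ κ₁) (by rw [mE₁, mE₂, hκ₃, hκ₁, k₁₃])
  have r₆ := wd (E₂ κ₃) (E₂ κ₂) (by rw [mE₂, mE₂, hκ₃, hκ₂, k₂₃])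
  change D₀ t = D₁ t
  rw [← sub_eq_zero, r₁]
  simp only [map_sub, comm₁, comm₂, comm₃] at *
  grind

/-- A product xy lifts to n · s(y), where n lifts x along `d₀` and is killed by `d₁`. -/
theorem exists_map_eq {P₀ P₁ : Type*} [CommRing P₀] [CommRing P₁] {I₀ : Ideal P₀} {I₁ : Ideal P₁}
    (d₀ d₁ : P₁ →+* P₀) (s : P₀ →+* P₁) (hd₀ : I₁ ≤ I₀.comap d₀) (hd₁ : I₁ ≤ I₀.comap d₁)
    (hI₀₁ : ∀ x ∈ I₀, s x ∈ I₁) (hl₀ : ∀ x ∈ I₀, ∃ n ∈ I₁, d₀ n = x ∧ d₁ n = 0)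
    (hds₀ : ∀ x, d₀ (s x) = x) (θ : SymSq I₀) :
    ∃ t : SymSq I₁, map d₀ hd₀ t = θ ∧ map d₁ hd₁ t = 0 := by
  induction θ using induction_on with
  | h0 => exact ⟨0, by simp, by simp⟩
  | hadd a b ha hb =>
    obtain ⟨t, ht, ht'⟩ := ha
    obtain ⟨t', h, h'⟩ := hb
    exact ⟨t + t', by rw [map_add, ht, h], by rw [map_add, ht', h', add_zero]⟩
  | hsq x y =>
    obtain ⟨n, hn, hn0, hn1⟩ := hl₀ x x.2
    refine ⟨sq ⟨n, hn⟩ ⟨s y, hI₀₁ _ y.2⟩, ?_, ?_⟩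
    · simp [hn0, hds₀]
    · rw [map_sq]
      convert zero_sq _
      exact Subtype.ext hn1

end Simplicial

end SymSq

/-! ### The cotangent modules of polynomial algebras over `B` -/

namespace AndreQuillen

section Kaehler

open TensorProduct KaehlerDifferential

variable {A : Type u} [CommRing A] {B : Type u} [CommRing B] [Algebra A B]
  {P : Type u} [CommRing P] [Algebra A P] (f : P →ₐ[A] B)
  {P' : Type u} [CommRing P'] [Algebra A P'] (f' : P' →ₐ[A] B)

theorem KaehlerTensor.d_add (x y : P) :
    KaehlerTensor.d f (x + y) = KaehlerTensor.d f x + KaehlerTensor.d f y := by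
  let := f.toRingHom.toAlgebra
  change (1 : B) ⊗ₜ[P] KaehlerDifferential.D A P (x + y) = 1 ⊗ₜ[P] KaehlerDifferential.D A P x +
    1 ⊗ₜ[P] KaehlerDifferential.D A P y
  rw [map_add, TensorProduct.tmul_add]
  rfl

theorem KaehlerTensor.d_mul (x y : P) :
    KaehlerTensor.d f (x * y) = f x • KaehlerTensor.d f y + f y • KaehlerTensor.d f x := by
  let := f.toRingHom.toAlgebra
  have h (p : P) (w : Ω[P⁄A]) : f p • ((1 : B) ⊗ₜ[P] w) = (1 : B) ⊗ₜ[P] (p • w) := by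
    rw [TensorProduct.tmul_smul, TensorProduct.smul_tmul', TensorProduct.smul_tmul',
      Algebra.smul_def p (1 : B)]
    rfl
  change (1 : B) ⊗ₜ[P] KaehlerDifferential.D A P (x * y) =
    f x • ((1 : B) ⊗ₜ[P] KaehlerDifferential.D A P y) +
    f y • ((1 : B) ⊗ₜ[P] KaehlerDifferential.D A P x)
  rw [h, h, ← TensorProduct.tmul_add, Derivation.leibniz]

/-- `d` as an additive map. -/
noncomputable def KaehlerTensor.dHom : P →+ KaehlerTensor f :=
  AddMonoidHom.mk' (KaehlerTensor.d f) (KaehlerTensor.d_add f)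

theorem KaehlerTensor.d_zero : KaehlerTensor.d f 0 = 0 := (KaehlerTensor.dHom f).map_zero

theorem KaehlerTensor.d_sub (x y : P) :
    KaehlerTensor.d f (x - y) = KaehlerTensor.d f x - KaehlerTensor.d f y :=
  (KaehlerTensor.dHom f).map_sub x y

theorem KaehlerTensor.d_eq_zero_of_mem {x : P} (hx : x ∈ RingHom.ker f ^ 2) :
    KaehlerTensor.d f x = 0 := by
  rw [pow_two] at hx
  induction hx using Submodule.mul_induction_on' with
  | mem_mul_mem x hx y hy =>
    rw [RingHom.mem_ker] at hx hy
    rw [KaehlerTensor.d_mul, hx, hy, zero_smul, zero_smul, add_zero]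
  | add x _ y _ hx hy => rw [KaehlerTensor.d_add, hx, hy, add_zero]

/-- The map `B ⊗[P] Ω[P⁄A] → Ω[B⁄A]`. -/
noncomputable def KaehlerTensor.toKaehler : KaehlerTensor f →ₗ[B] Ω[B⁄A] :=
  letI := f.toRingHom.toAlgebra
  haveI : IsScalarTower A P B := IsScalarTower.of_algebraMap_eq fun a => (f.commutes a).symm
  (KaehlerDifferential.mapBaseChange A P B : (B ⊗[P] Ω[P⁄A]) →ₗ[B] Ω[B⁄A])

theorem KaehlerTensor.toKaehler_d (p : P) :
    KaehlerTensor.toKaehler f (KaehlerTensor.d f p) = KaehlerDifferential.D A B (f p) := by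
  let := f.toRingHom.toAlgebra
  have : IsScalarTower A P B := IsScalarTower.of_algebraMap_eq fun a => (f.commutes a).symm
  change KaehlerDifferential.mapBaseChange A P B ((1 : B) ⊗ₜ[P] KaehlerDifferential.D A P p) = _
  rw [KaehlerDifferential.mapBaseChange_tmul, one_smul, KaehlerDifferential.map_D]
  rfl

/-- Exactness of the conormal sequence I/I² → B ⊗ Ω_P → Ω_B in the middle. -/
theorem KaehlerTensor.exists_d_eq_of_toKaehler (hf : Function.Surjective f) {x : KaehlerTensor f}
    (hx : KaehlerTensor.toKaehler f x = 0) : ∃ z ∈ RingHom.ker f, KaehlerTensor.d f z = x := by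
  let := f.toRingHom.toAlgebra
  have : IsScalarTower A P B := IsScalarTower.of_algebraMap_eq fun a => (f.commutes a).symm
  obtain ⟨y, hy⟩ := (KaehlerDifferential.exact_kerCotangentToTensor_mapBaseChange A P B hf x).1 hx
  obtain ⟨z, rfl⟩ := Ideal.toCotangent_surjective _ y
  exact ⟨z, z.2, hy⟩

variable {f f'}

theorem KaehlerTensor.exists_d_eq (hf : Function.Surjective f) (g : P →ₐ[A] P')
    (hg : f'.comp g = f) {x : KaehlerTensor f} (hx : KaehlerTensor.map f f' g hg x = 0) :
    ∃ z ∈ RingHom.ker f, KaehlerTensor.d f z = x := by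
  refine KaehlerTensor.exists_d_eq_of_toKaehler f hf ?_
  have : (KaehlerTensor.toKaehler f').comp (KaehlerTensor.map f f' g hg) =
      KaehlerTensor.toKaehler f := KaehlerTensor.hom_ext f fun p => by
    rw [LinearMap.comp_apply, KaehlerTensor.map_d, KaehlerTensor.toKaehler_d,
      KaehlerTensor.toKaehler_d, ← hg]
    rfl
  rw [← this, LinearMap.comp_apply, hx, map_zero]

/-- The difference of two algebra maps over B is, modulo the square of the target kernel, a
derivation, so it factors through B ⊗ Ω. This makes the kernel of I/I² → B ⊗ Ω independent of the
presentation and lets it be ignored after normalization. -/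
theorem KaehlerTensor.sub_mem_of_d_eq_zero (hf : Function.Surjective f)
    (hf' : Function.Surjective f') (g h : P →ₐ[A] P')
    (hg : ∀ x, f' (g x) = f x) (hh : ∀ x, f' (h x) = f x) {z : P}
    (hz : KaehlerTensor.d f z = 0) : g z - h z ∈ RingHom.ker f' ^ 2 := by
  let E := Algebra.Extension.ofSurjective f hf
  let E' := Algebra.Extension.ofSurjective f' hf'
  let G : E.Hom E' := ⟨g.toRingHom, fun x => g.commutes x, fun x => hg x⟩
  let H : E.Hom E' := ⟨h.toRingHom, fun x => h.commutes x, fun x => hh x⟩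
  have key := Algebra.Extension.Hom.sub_one_tmul G H z
  have hz' : ((1 : B) ⊗ₜ[E.Ring] KaehlerDifferential.D A E.Ring z : E.CotangentSpace) = 0 := hz
  rw [hz', map_zero] at key
  exact (Algebra.Extension.Cotangent.mk_eq_zero_iff _).1 key.symm

end Kaehler

variable (A : Type u) [CommRing A] (B : Type u) [CommRing B] [Algebra A B]

/-! ### Degeneracies of the standard resolution -/

/-- The extra degeneracy, a map of sets. -/
noncomputable def gen (n : ℕ) (x : iterPoly A B n) : iterPoly A B (n + 1) :=
  (MvPolynomial.X x : MvPolynomial (iterPoly A B n) A)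

theorem face_zero_gen (n : ℕ) (x : iterPoly A B n) : face A B n 0 (gen A B n x) = x := by
  cases n with
  | zero => exact MvPolynomial.aeval_X (R := A) (id : iterPoly A B 0 → _) x
  | succ n => exact MvPolynomial.aeval_X (R := A) (id : iterPoly A B (n + 1) → _) x

theorem face_succ_gen (n : ℕ) (i : Fin (n + 1)) (x : iterPoly A B (n + 1)) :
    face A B (n + 1) i.succ (gen A B (n + 1) x) = gen A B n (face A B n i x) :=
  MvPolynomial.rename_X (face A B n i) x

/-- The degeneracy maps. -/
noncomputable def degen : (n : ℕ) → Fin (n + 1) →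
    (iterPoly A B (n + 1) →ₐ[A] iterPoly A B (n + 2))
  | 0, _ => (MvPolynomial.rename (gen A B 0) :
      MvPolynomial (iterPoly A B 0) A →ₐ[A] MvPolynomial (iterPoly A B 1) A)
  | n + 1, i => Fin.cases
      (MvPolynomial.rename (gen A B (n + 1)) :
        MvPolynomial (iterPoly A B (n + 1)) A →ₐ[A] MvPolynomial (iterPoly A B (n + 2)) A)
      (fun j => (MvPolynomial.rename (degen n j) :
        MvPolynomial (iterPoly A B (n + 1)) A →ₐ[A] MvPolynomial (iterPoly A B (n + 2)) A)) i

theorem iterPoly_algHom_ext {n : ℕ} {C : Type*} [CommRing C] [Algebra A C]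
    {φ ψ : iterPoly A B (n + 1) →ₐ[A] C} (h : ∀ x, φ (gen A B n x) = ψ (gen A B n x)) : φ = ψ :=
  MvPolynomial.algHom_ext (f := (φ : MvPolynomial (iterPoly A B n) A →ₐ[A] C)) (g := ψ) h

theorem degen_zero_gen (n : ℕ) (x : iterPoly A B n) :
    degen A B n 0 (gen A B n x) = gen A B (n + 1) (gen A B n x) := by
  cases n with
  | zero => exact MvPolynomial.rename_X (gen A B 0) x
  | succ n => exact MvPolynomial.rename_X (gen A B (n + 1)) x

theorem degen_succ_gen (n : ℕ) (i : Fin (n + 1)) (x : iterPoly A B (n + 1)) :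
    degen A B (n + 1) i.succ (gen A B (n + 1) x) = gen A B (n + 2) (degen A B n i x) :=
  MvPolynomial.rename_X (degen A B n i) x

theorem face_castSucc_degen (n : ℕ) (i : Fin (n + 1)) (x : iterPoly A B (n + 1)) :
    face A B (n + 1) i.castSucc (degen A B n i x) = x := by
  suffices (face A B (n + 1) i.castSucc).comp (degen A B n i) = AlgHom.id A _ from
    DFunLike.congr_fun this x
  clear x
  induction n with
  | zero =>
    obtain rfl : i = 0 := Fin.fin_one_eq_zero _
    refine iterPoly_algHom_ext A B fun x => ?_
    rw [AlgHom.comp_apply, degen_zero_gen]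
    exact face_zero_gen A B 1 _
  | succ n ih =>
    refine iterPoly_algHom_ext A B fun x => ?_
    rw [AlgHom.comp_apply]
    induction i using Fin.cases with
    | zero =>
      rw [degen_zero_gen]
      exact face_zero_gen A B _ _
    | succ i =>
      rw [degen_succ_gen, ← Fin.succ_castSucc, face_succ_gen]
      exact congrArg _ (DFunLike.congr_fun (ih i) x)

theorem face_succ_degen (n : ℕ) (i : Fin (n + 1)) (x : iterPoly A B (n + 1)) :
    face A B (n + 1) i.succ (degen A B n i x) = x := by
  suffices (face A B (n + 1) i.succ).comp (degen A B n i) = AlgHom.id A _ from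
    DFunLike.congr_fun this x
  clear x
  induction n with
  | zero =>
    obtain rfl : i = 0 := Fin.fin_one_eq_zero _
    refine iterPoly_algHom_ext A B fun x => ?_
    rw [AlgHom.comp_apply, degen_zero_gen, face_succ_gen, face_zero_gen]
    rfl
  | succ n ih =>
    refine iterPoly_algHom_ext A B fun x => ?_
    rw [AlgHom.comp_apply]
    induction i using Fin.cases with
    | zero =>
      rw [degen_zero_gen, face_succ_gen, face_zero_gen]
      rfl
    | succ i =>
      rw [degen_succ_gen, face_succ_gen]
      exact congrArg _ (DFunLike.congr_fun (ih i) x)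

theorem face_degen_of_le (n : ℕ) (i : Fin (n + 2)) (j : Fin (n + 1)) (hij : i ≤ j.castSucc)
    (x : iterPoly A B (n + 2)) :
    face A B (n + 2) i.castSucc (degen A B (n + 1) j.succ x) =
      degen A B n j (face A B (n + 1) i x) := by
  suffices (face A B (n + 2) i.castSucc).comp (degen A B (n + 1) j.succ) =
    (degen A B n j).comp (face A B (n + 1) i) from DFunLike.congr_fun this x
  clear x
  induction n with
  | zero =>
    obtain rfl : j = 0 := Fin.fin_one_eq_zero _
    obtain rfl : i = 0 := by simpa using hij
    refine iterPoly_algHom_ext A B fun x => ?_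
    rw [AlgHom.comp_apply, AlgHom.comp_apply, degen_succ_gen, face_zero_gen]
    exact face_zero_gen A B _ _
  | succ n ih =>
    refine iterPoly_algHom_ext A B fun x => ?_
    rw [AlgHom.comp_apply, AlgHom.comp_apply, degen_succ_gen]
    induction i using Fin.cases with
    | zero =>
      rw [face_zero_gen]
      exact face_zero_gen A B _ _
    | succ i =>
      induction j using Fin.cases with
      | zero => exact absurd hij (by simp)
      | succ j =>
        rw [← Fin.succ_castSucc, face_succ_gen, face_succ_gen, degen_succ_gen]
        exact congrArg _ (DFunLike.congr_fun (ih i j (by simpa [← Fin.succ_castSucc] using hij)) x)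

theorem face_degen_of_lt (n : ℕ) (i : Fin (n + 2)) (j : Fin (n + 1)) (hij : j.castSucc < i)
    (x : iterPoly A B (n + 2)) :
    face A B (n + 2) i.succ (degen A B (n + 1) j.castSucc x) =
      degen A B n j (face A B (n + 1) i x) := by
  suffices (face A B (n + 2) i.succ).comp (degen A B (n + 1) j.castSucc) =
    (degen A B n j).comp (face A B (n + 1) i) from DFunLike.congr_fun this x
  clear x
  induction n with
  | zero =>
    obtain rfl : j = 0 := Fin.fin_one_eq_zero _
    refine iterPoly_algHom_ext A B fun x => ?_
    induction i using Fin.cases with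
    | zero => exact absurd hij (by simp)
    | succ i =>
      rw [AlgHom.comp_apply, AlgHom.comp_apply, face_succ_gen, degen_zero_gen]
      refine (congrArg _ (degen_zero_gen A B 1 x)).trans ?_
      rw [face_succ_gen, face_succ_gen]
  | succ n ih =>
    refine iterPoly_algHom_ext A B fun x => ?_
    rw [AlgHom.comp_apply, AlgHom.comp_apply]
    induction i using Fin.cases with
    | zero => exact absurd hij (by simp)
    | succ i =>
      rw [face_succ_gen]
      induction j using Fin.cases with
      | zero =>
        rw [degen_zero_gen]
        refine (congrArg _ (degen_zero_gen A B _ x)).trans ?_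
        rw [face_succ_gen, face_succ_gen]
      | succ j =>
        rw [← Fin.succ_castSucc, degen_succ_gen, degen_succ_gen, face_succ_gen]
        exact congrArg _ (DFunLike.congr_fun (ih i j (by simpa [← Fin.succ_castSucc] using hij)) x)

theorem face_face (n : ℕ) (i j : Fin (n + 1)) (hij : i ≤ j) (x : iterPoly A B (n + 2)) :
    face A B n i (face A B (n + 1) j.succ x) = face A B n j (face A B (n + 1) i.castSucc x) :=
  DFunLike.congr_fun (face_comp_face A B n i j hij) x

theorem aug_face (n : ℕ) (i : Fin (n + 1)) (x : iterPoly A B (n + 1)) :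
    aug A B n (face A B n i x) = aug A B (n + 1) x :=
  DFunLike.congr_fun (aug_comp_face A B n i) x

theorem aug_degen (n : ℕ) (i : Fin (n + 1)) (x : iterPoly A B (n + 1)) :
    aug A B (n + 2) (degen A B n i x) = aug A B (n + 1) x := by
  rw [← aug_face A B (n + 1) i.succ, face_succ_degen]

theorem aug_surjective (n : ℕ) : Function.Surjective (aug A B n) := by
  induction n with
  | zero => exact fun x => ⟨x, rfl⟩
  | succ n ih =>
    intro b
    obtain ⟨x, rfl⟩ := ih b
    exact ⟨gen A B n x, by rw [← aug_face A B n 0, face_zero_gen]⟩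

/-- Elements of the kernel of the augmentation all of whose faces vanish are faces of elements
whose other faces vanish. -/
theorem exists_face_eq (n : ℕ) {w : iterPoly A B (n + 1)} (hw : ∀ i, face A B n i w = 0) :
    ∃ m, aug A B (n + 2) m = 0 ∧ face A B (n + 1) 0 m = w ∧
      ∀ i : Fin (n + 1), face A B (n + 1) i.succ m = 0 := by
  have h (i : Fin (n + 1)) :
      face A B (n + 1) i.succ (gen A B (n + 1) w - gen A B (n + 1) 0) = 0 := by
    rw [map_sub, face_succ_gen, face_succ_gen, hw i, map_zero, sub_self]
  -- The extra degeneracy is only a map of sets and does not send 0 to 0; its value at 0 is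
  -- subtracted as a correction.
  refine ⟨gen A B (n + 1) w - gen A B (n + 1) 0, ?_, ?_, h⟩
  · rw [← aug_face A B (n + 1) (Fin.succ 0), h, map_zero]
  · rw [map_sub, face_zero_gen, face_zero_gen, sub_zero]

end AndreQuillen

namespace AndreQuillen

/-! ### Normalization in degree two -/

section Normalize

variable {R : Type*} [CommRing R] {M₀ M₁ M₂ M₃ : Type*} [AddCommGroup M₀] [AddCommGroup M₁]
  [AddCommGroup M₂] [AddCommGroup M₃] [Module R M₀] [Module R M₁] [Module R M₂] [Module R M₃]
  {a₀ a₁ : M₁ →ₗ[R] M₀} {b₀ b₁ b₂ : M₂ →ₗ[R] M₁} {c₀ c₁ c₂ c₃ : M₃ →ₗ[R] M₂}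
  {s : M₀ →ₗ[R] M₁} {t₀ t₁ : M₁ →ₗ[R] M₂} {r₀ r₁ r₂ : M₂ →ₗ[R] M₃}

/-- In a truncated simplicial module, exactness of the unnormalized and of the normalized complex
in degree two are equivalent. -/
theorem exact_iff_normalized_exact
    (ab₁₂ : ∀ x, a₁ (b₂ x) = a₁ (b₁ x)) (ab₀₂ : ∀ x, a₀ (b₂ x) = a₁ (b₀ x))
    (bc₀₂ : ∀ x, b₀ (c₂ x) = b₁ (c₀ x)) (bc₀₃ : ∀ x, b₀ (c₃ x) = b₂ (c₀ x))
    (bc₁₂ : ∀ x, b₁ (c₂ x) = b₁ (c₁ x))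
    (bc₁₃ : ∀ x, b₁ (c₃ x) = b₂ (c₁ x)) (bc₂₃ : ∀ x, b₂ (c₃ x) = b₂ (c₂ x))
    (bt₀₀ : ∀ x, b₀ (t₀ x) = x) (bt₁₀ : ∀ x, b₁ (t₀ x) = x) (bt₂₀ : ∀ x, b₂ (t₀ x) = s (a₁ x))
    (bt₀₁ : ∀ x, b₀ (t₁ x) = s (a₀ x)) (bt₁₁ : ∀ x, b₁ (t₁ x) = x) (bt₂₁ : ∀ x, b₂ (t₁ x) = x)
    (cr₀₀ : ∀ x, c₀ (r₀ x) = x) (cr₁₀ : ∀ x, c₁ (r₀ x) = x)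
    (cr₂₀ : ∀ x, c₂ (r₀ x) = t₀ (b₁ x)) (cr₃₀ : ∀ x, c₃ (r₀ x) = t₀ (b₂ x))
    (cr₀₁ : ∀ x, c₀ (r₁ x) = t₀ (b₀ x)) (cr₁₁ : ∀ x, c₁ (r₁ x) = x)
    (cr₂₁ : ∀ x, c₂ (r₁ x) = x) (cr₃₁ : ∀ x, c₃ (r₁ x) = t₁ (b₂ x))
    (cr₀₂ : ∀ x, c₀ (r₂ x) = t₁ (b₀ x)) (cr₁₂ : ∀ x, c₁ (r₂ x) = t₁ (b₁ x))
    (cr₂₂ : ∀ x, c₂ (r₂ x) = x) (cr₃₂ : ∀ x, c₃ (r₂ x) = x) :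
    (∀ x, b₀ x - b₁ x + b₂ x = 0 → ∃ y, c₀ y - c₁ y + c₂ y - c₃ y = x) ↔
      ∀ x, b₀ x = 0 → b₁ x = 0 → b₂ x = 0 →
        ∃ y, c₀ y = x ∧ c₁ y = 0 ∧ c₂ y = 0 ∧ c₃ y = 0 := by
  constructor
  · intro H x hx₀ hx₁ hx₂
    obtain ⟨y, hy⟩ := H x (by simp [hx₀, hx₁, hx₂])
    have hy₀ := congrArg b₀ hy
    have hy₁ := congrArg b₁ hy
    have hy₂ := congrArg b₂ hy
    simp only [map_sub, map_add, hx₀, hx₁, hx₂] at hy₀ hy₁ hy₂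
    -- kill the last face
    have e₁ : b₀ (c₃ y) = b₁ (c₃ y) := by
      rw [bc₀₃, bc₁₃]
      rw [bc₂₃, add_sub_cancel_right, sub_eq_zero] at hy₂
      exact hy₂
    let y₁ := y - r₂ (c₃ y)
    have y₁₃ : c₃ y₁ = 0 := by simp [y₁, cr₃₂]
    have dy₁ : c₀ y₁ - c₁ y₁ + c₂ y₁ = x := by
      simp only [y₁, map_sub, cr₀₂, cr₁₂, cr₂₂, e₁]
      rw [← hy]; abel
    -- kill the second face
    have z₂ : b₂ (c₂ y₁) = 0 := by rw [← bc₂₃, y₁₃, map_zero]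
    have z₀ : a₁ (b₀ (c₂ y₁)) = 0 := by
      have h1 : c₀ y₁ = x + c₁ y₁ - c₂ y₁ := by rw [← dy₁]; abel
      rw [bc₀₂, h1, map_sub, map_add, hx₁, bc₁₂, zero_add, sub_self, map_zero]
    have z₀' : b₀ (c₂ y₁) = 0 := by
      have h1 : c₀ y₁ = x + c₁ y₁ - c₂ y₁ := by rw [← dy₁]; abel
      rw [bc₀₂, h1, map_sub, map_add, hx₁, bc₁₂, zero_add, sub_self]
    let y₂ := y₁ - r₁ (c₂ y₁)
    have y₂₃ : c₃ y₂ = 0 := by simp [y₂, cr₃₁, y₁₃, z₂]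
    have y₂₂ : c₂ y₂ = 0 := by simp [y₂, cr₂₁]
    have dy₂ : c₀ y₂ - c₁ y₂ = x := by
      simp only [y₂, map_sub, cr₀₁, cr₁₁, z₀', map_zero]
      rw [← dy₁]; abel
    -- kill the first face
    have w₁ : b₁ (c₁ y₂) = 0 := by rw [← bc₁₂, y₂₂, map_zero]
    have w₂ : b₂ (c₁ y₂) = 0 := by rw [← bc₁₃, y₂₃, map_zero]
    refine ⟨y₂ - r₀ (c₁ y₂), ?_, ?_, ?_, ?_⟩
    · rw [map_sub, cr₀₀, dy₂]
    · rw [map_sub, cr₁₀, sub_self]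
    · rw [map_sub, cr₂₀, w₁, y₂₂, map_zero, sub_zero]
    · rw [map_sub, cr₃₀, w₂, y₂₃, map_zero, sub_zero]
  · intro H x hx
    -- Removing degenerate parts from the last face downwards turns the cycle x into the normalized
    -- cycle x₂. The removed terms are boundaries, of r₁ x₁ and -r₂ x.
    let x₁ := x - t₁ (b₂ x)
    let x₂ := x₁ - t₀ (b₁ x₁)
    have h₂₁ : b₂ x₁ = 0 := by simp [x₁, bt₂₁]
    have h₁₂ : b₁ x₂ = 0 := by simp [x₂, bt₁₀]
    have h₂₂ : b₂ x₂ = 0 := by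
      simp only [x₂, map_sub, bt₂₀, h₂₁, ← ab₁₂, map_zero, sub_zero]
    have h0 : a₁ (b₀ x) = 0 := by
      have : b₀ x = b₁ x - b₂ x := by rw [← sub_eq_zero, ← hx]; abel
      rw [this, map_sub, ab₁₂, sub_self]
    have h₀₂ : b₀ x₂ = 0 := by
      simp only [x₂, x₁, map_sub, bt₀₁, bt₀₀, bt₁₁, ab₀₂, h0, map_zero]
      refine Eq.trans ?_ hx
      abel
    obtain ⟨y, hy₀, hy₁, hy₂, hy₃⟩ := H x₂ h₀₂ h₁₂ h₂₂
    have h₀₁ : t₀ (b₀ x₁) = t₀ (b₁ x₁) := by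
      have : b₀ x₂ = b₀ x₁ - b₁ x₁ := by simp only [x₂, map_sub, bt₀₀]
      rw [h₀₂, eq_comm, sub_eq_zero] at this
      rw [this]
    refine ⟨y + r₁ x₁ - r₂ x, ?_⟩
    have h3 : t₁ (b₀ x) - t₁ (b₁ x) = - t₁ (b₂ x) := by
      rw [← map_sub, ← map_neg]
      congr 1
      rw [← sub_eq_zero, ← hx]; abel
    simp only [map_add, map_sub, hy₀, hy₁, hy₂, hy₃, cr₀₁, cr₁₁, cr₂₁, cr₃₁, cr₀₂, cr₁₂, cr₂₂, cr₃₂,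
      h₂₁, h₀₁, map_zero]
    have : x₂ + t₀ (b₁ x₁) = x - t₁ (b₂ x) := by simp [x₂, x₁]
    have e : x₂ + t₀ (b₁ x₁) - (t₁ (b₀ x) - t₁ (b₁ x)) = x := by rw [this, h3]; abel
    refine Eq.trans ?_ e
    abel

end Normalize

variable (A : Type u) [CommRing A] (B : Type u) [CommRing B] [Algebra A B]

/-- The degeneracies of the cotangent modules. -/
noncomputable def cotangentDegen (n : ℕ) (i : Fin (n + 1)) :
    cotangentModule A B n →ₗ[B] cotangentModule A B (n + 1) :=
  KaehlerTensor.map _ _ (degen A B n i) (AlgHom.ext (aug_degen A B n i))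

theorem cotangentFace_d (n : ℕ) (i : Fin (n + 2)) (x : iterPoly A B (n + 2)) :
    cotangentFace A B n i (KaehlerTensor.d (aug A B (n + 2)) x) =
      KaehlerTensor.d (aug A B (n + 1)) (face A B (n + 1) i x) :=
  KaehlerTensor.map_d _ _ _ _ x

theorem cotangentDegen_d (n : ℕ) (i : Fin (n + 1)) (x : iterPoly A B (n + 1)) :
    cotangentDegen A B n i (KaehlerTensor.d (aug A B (n + 1)) x) =
      KaehlerTensor.d (aug A B (n + 2)) (degen A B n i x) :=
  KaehlerTensor.map_d _ _ _ _ x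

theorem cotangentFace_comp_apply (n : ℕ) (i j : Fin (n + 2)) (hij : i ≤ j)
    (x : cotangentModule A B (n + 2)) :
    cotangentFace A B n i (cotangentFace A B (n + 1) j.succ x) =
      cotangentFace A B n j (cotangentFace A B (n + 1) i.castSucc x) :=
  LinearMap.congr_fun (cotangentFace_comp A B n i j hij) x

theorem cotangentFace_castSucc_degen (n : ℕ) (i : Fin (n + 1)) (x : cotangentModule A B n) :
    cotangentFace A B n i.castSucc (cotangentDegen A B n i x) = x := by
  suffices (cotangentFace A B n i.castSucc).comp (cotangentDegen A B n i) = LinearMap.id from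
    LinearMap.congr_fun this x
  refine KaehlerTensor.hom_ext _ fun p => ?_
  rw [LinearMap.comp_apply, cotangentDegen_d, cotangentFace_d, face_castSucc_degen]
  rfl

theorem cotangentFace_succ_degen (n : ℕ) (i : Fin (n + 1)) (x : cotangentModule A B n) :
    cotangentFace A B n i.succ (cotangentDegen A B n i x) = x := by
  suffices (cotangentFace A B n i.succ).comp (cotangentDegen A B n i) = LinearMap.id from
    LinearMap.congr_fun this x
  refine KaehlerTensor.hom_ext _ fun p => ?_
  rw [LinearMap.comp_apply, cotangentDegen_d, cotangentFace_d, face_succ_degen]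
  rfl

theorem cotangentFace_degen_of_le (n : ℕ) (i : Fin (n + 2)) (j : Fin (n + 1))
    (hij : i ≤ j.castSucc) (x : cotangentModule A B (n + 1)) :
    cotangentFace A B (n + 1) i.castSucc (cotangentDegen A B (n + 1) j.succ x) =
      cotangentDegen A B n j (cotangentFace A B n i x) := by
  suffices (cotangentFace A B (n + 1) i.castSucc).comp (cotangentDegen A B (n + 1) j.succ) =
    (cotangentDegen A B n j).comp (cotangentFace A B n i) from LinearMap.congr_fun this x
  refine KaehlerTensor.hom_ext _ fun p => ?_
  rw [LinearMap.comp_apply, cotangentDegen_d, cotangentFace_d, face_degen_of_le A B n i j hij,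
    LinearMap.comp_apply, cotangentFace_d, cotangentDegen_d]

theorem cotangentFace_degen_of_lt (n : ℕ) (i : Fin (n + 2)) (j : Fin (n + 1))
    (hij : j.castSucc < i) (x : cotangentModule A B (n + 1)) :
    cotangentFace A B (n + 1) i.succ (cotangentDegen A B (n + 1) j.castSucc x) =
      cotangentDegen A B n j (cotangentFace A B n i x) := by
  suffices (cotangentFace A B (n + 1) i.succ).comp (cotangentDegen A B (n + 1) j.castSucc) =
    (cotangentDegen A B n j).comp (cotangentFace A B n i) from LinearMap.congr_fun this x
  refine KaehlerTensor.hom_ext _ fun p => ?_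
  rw [LinearMap.comp_apply, cotangentDegen_d, cotangentFace_d, face_degen_of_lt A B n i j hij,
    LinearMap.comp_apply, cotangentFace_d, cotangentDegen_d]

theorem exact_cotangentD_iff :
    (∀ x, cotangentD A B 1 x = 0 → ∃ y, cotangentD A B 2 y = x) ↔
      ∀ x : cotangentModule A B 2, (∀ i, cotangentFace A B 1 i x = 0) →
        ∃ y, cotangentFace A B 2 0 y = x ∧ ∀ i : Fin 3, cotangentFace A B 2 i.succ y = 0 := by
  have h1 (x : cotangentModule A B 2) : cotangentD A B 1 x = cotangentFace A B 1 0 x -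
      cotangentFace A B 1 1 x + cotangentFace A B 1 2 x := by
    simp [cotangentD, Fin.sum_univ_succ]
    abel
  have h2 (x : cotangentModule A B 3) : cotangentD A B 2 x = cotangentFace A B 2 0 x -
      cotangentFace A B 2 1 x + cotangentFace A B 2 2 x - cotangentFace A B 2 3 x := by
    simp [cotangentD, Fin.sum_univ_succ]
    abel
  simp only [h1, h2]
  refine (exact_iff_normalized_exact
    (a₀ := cotangentFace A B 0 0) (a₁ := cotangentFace A B 0 1)
    (s := cotangentDegen A B 0 0) (t₀ := cotangentDegen A B 1 0) (t₁ := cotangentDegen A B 1 1)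
    (r₀ := cotangentDegen A B 2 0) (r₁ := cotangentDegen A B 2 1) (r₂ := cotangentDegen A B 2 2)
    (cotangentFace_comp_apply A B 0 1 1 (by decide))
    (cotangentFace_comp_apply A B 0 0 1 (by decide))
    (cotangentFace_comp_apply A B 1 0 1 (by decide))
    (cotangentFace_comp_apply A B 1 0 2 (by decide))
    (cotangentFace_comp_apply A B 1 1 1 (by decide))
    (cotangentFace_comp_apply A B 1 1 2 (by decide))
    (cotangentFace_comp_apply A B 1 2 2 (by decide))
    (cotangentFace_castSucc_degen A B 1 0) (cotangentFace_succ_degen A B 1 0)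
    (cotangentFace_degen_of_lt A B 0 1 0 (by decide))
    (cotangentFace_degen_of_le A B 0 0 0 (by decide))
    (cotangentFace_castSucc_degen A B 1 1) (cotangentFace_succ_degen A B 1 1)
    (cotangentFace_castSucc_degen A B 2 0) (cotangentFace_succ_degen A B 2 0)
    (cotangentFace_degen_of_lt A B 1 1 0 (by decide))
    (cotangentFace_degen_of_lt A B 1 2 0 (by decide))
    (cotangentFace_degen_of_le A B 1 0 0 (by decide))
    (cotangentFace_castSucc_degen A B 2 1) (cotangentFace_succ_degen A B 2 1)
    (cotangentFace_degen_of_lt A B 1 2 1 (by decide))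
    (cotangentFace_degen_of_le A B 1 0 1 (by decide))
    (cotangentFace_degen_of_le A B 1 1 1 (by decide))
    (cotangentFace_castSucc_degen A B 2 2) (cotangentFace_succ_degen A B 2 2)).trans ?_
  constructor
  · intro H x hx
    obtain ⟨y, h0, h1, h2, h3⟩ := H x (hx 0) (hx 1) (hx 2)
    exact ⟨y, h0, by simpa [Fin.forall_fin_succ] using ⟨h1, h2, h3⟩⟩
  · intro H x hx0 hx1 hx2
    obtain ⟨y, h0, h1⟩ := H x (by simpa [Fin.forall_fin_succ] using ⟨hx0, hx1, hx2⟩)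
    exact ⟨y, h0, h1 0, h1 1, h1 2⟩

end AndreQuillen

/-! ### Vanishing of the second André–Quillen homology and syzygetic kernels. -/

namespace AndreQuillen

variable (A : Type u) [CommRing A] (B : Type u) [CommRing B] [Algebra A B]

/-- The kernel of the augmentation `iterPoly A B n → B`. -/
noncomputable abbrev augKer (n : ℕ) : Ideal (iterPoly A B n) := RingHom.ker (aug A B n)

theorem mem_sq_of_comm {P P' : Type*} [CommRing P] [CommRing P'] {I : Ideal P} {I' : Ideal P'}
    (g : P →+* P') (hg : I ≤ I'.comap g) {x : P} (hx : x ∈ I ^ 2) : g x ∈ I' ^ 2 :=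
  Ideal.pow_right_mono (Ideal.map_le_iff_le_comap.2 hg) 2
    (by rw [← Ideal.map_pow]; exact Ideal.mem_map_of_mem g hx)

variable {A B}

theorem face_mem {n : ℕ} (i : Fin (n + 1)) {x : iterPoly A B (n + 1)}
    (hx : x ∈ augKer A B (n + 1)) : face A B n i x ∈ augKer A B n :=
  (aug_face A B n i x).trans hx

theorem degen_mem {n : ℕ} (i : Fin (n + 1)) {x : iterPoly A B (n + 1)}
    (hx : x ∈ augKer A B (n + 1)) : degen A B n i x ∈ augKer A B (n + 2) :=
  (aug_degen A B n i x).trans hx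

theorem face_mem_sq {n : ℕ} (i : Fin (n + 1)) {x : iterPoly A B (n + 1)}
    (hx : x ∈ augKer A B (n + 1) ^ 2) : face A B n i x ∈ augKer A B n ^ 2 :=
  mem_sq_of_comm (I' := augKer A B n) (face A B n i : iterPoly A B (n + 1) →+* iterPoly A B n)
    (fun _ h => face_mem i h) hx

theorem degen_mem_sq {n : ℕ} (i : Fin (n + 1)) {x : iterPoly A B (n + 1)}
    (hx : x ∈ augKer A B (n + 1) ^ 2) : degen A B n i x ∈ augKer A B (n + 2) ^ 2 :=
  mem_sq_of_comm (I' := augKer A B (n + 2))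
    (degen A B n i : iterPoly A B (n + 1) →+* iterPoly A B (n + 2))
    (fun _ h => degen_mem i h) hx

/-- An element of the kernel of the augmentation with `1 ⊗ dy = 0` is in the square of the kernel
if one of its faces is. -/
theorem mem_sq_of_face_mem_sq {n : ℕ} (i : Fin (n + 2)) {y : iterPoly A B (n + 2)}
    (hy : KaehlerTensor.d (aug A B (n + 2)) y = 0)
    (h : face A B (n + 1) i y ∈ augKer A B (n + 1) ^ 2) : y ∈ augKer A B (n + 2) ^ 2 := by
  have key := KaehlerTensor.sub_mem_of_d_eq_zero (aug_surjective A B (n + 2))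
    (aug_surjective A B (n + 2)) ((degen A B n 0).comp (face A B (n + 1) i)) (AlgHom.id A _)
    (fun x => by rw [AlgHom.comp_apply, aug_degen, aug_face]) (fun x => rfl) hy
  have h2 := degen_mem_sq 0 h
  have := sub_mem h2 key
  rwa [AlgHom.comp_apply, AlgHom.id_apply, sub_sub_cancel] at this

theorem sub_mem_sq_of_face_eq {n : ℕ} (i : Fin (n + 2)) {y y' : iterPoly A B (n + 2)}
    (hy : KaehlerTensor.d (aug A B (n + 2)) y = 0)
    (hy' : KaehlerTensor.d (aug A B (n + 2)) y' = 0)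
    (h : face A B (n + 1) i y = face A B (n + 1) i y') : y - y' ∈ augKer A B (n + 2) ^ 2 :=
  mem_sq_of_face_mem_sq i (by rw [KaehlerTensor.d_sub, hy, hy', sub_zero])
    (by rw [map_sub, sub_eq_zero.2 h]; exact zero_mem _)

theorem face_degen_sub_mem_sq {n : ℕ} (i : Fin (n + 2)) (j : Fin (n + 1))
    {y : iterPoly A B (n + 1)} (hy : KaehlerTensor.d (aug A B (n + 1)) y = 0) :
    face A B (n + 1) i (degen A B n j y) - y ∈ augKer A B (n + 1) ^ 2 :=
  KaehlerTensor.sub_mem_of_d_eq_zero (aug_surjective A B (n + 1))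
    (aug_surjective A B (n + 1)) ((face A B (n + 1) i).comp (degen A B n j)) (AlgHom.id A _)
    (fun x => by rw [AlgHom.comp_apply, aug_face, aug_degen]) (fun x => rfl) hy

theorem exists_lift_face_zero {x : iterPoly A B 1} (hx : x ∈ augKer A B 1) :
    ∃ n ∈ augKer A B 2, face A B 1 0 n = x ∧ face A B 1 1 n = 0 := by
  obtain ⟨m, hm, h0, h1⟩ := exists_face_eq A B 0 (w := x) (fun i => (aug_face A B 0 i x).trans hx)
  exact ⟨m, hm, h0, h1 0⟩

theorem exists_lift_face_one {w : iterPoly A B 2} (h0 : face A B 1 0 w = 0)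
    (h1 : face A B 1 1 w = 0) :
    ∃ m ∈ augKer A B 3, face A B 2 0 m = w ∧ face A B 2 1 m = 0 ∧ face A B 2 2 m = 0 := by
  obtain ⟨m, hm, h0, h1⟩ := exists_face_eq A B 1 (w := w)
    (fun i => by fin_cases i; exacts [h0, h1])
  exact ⟨m, hm, h0, h1 0, h1 1⟩

/-- With `iterPoly A B (n + 1)` sitting in simplicial degree n, this is the vanishing of H₁ of the
squares of the augmentation kernels. -/
theorem exists_sq_lift (hS : (augKer A B 1).IsSyzygetic) {w : iterPoly A B 2}
    (hw : w ∈ augKer A B 2 ^ 2) (h0 : face A B 1 0 w = 0) (h1 : face A B 1 1 w = 0) :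
    ∃ v ∈ augKer A B 3 ^ 2, face A B 2 0 v = w ∧ face A B 2 1 v = 0 ∧ face A B 2 2 v = 0 :=
  SymSq.mem_boundary_of_isSyzygetic
    (face A B 1 0 : iterPoly A B 2 →+* iterPoly A B 1)
    (face A B 1 1 : iterPoly A B 2 →+* iterPoly A B 1)
    (face A B 2 0 : iterPoly A B 3 →+* iterPoly A B 2)
    (face A B 2 1 : iterPoly A B 3 →+* iterPoly A B 2)
    (face A B 2 2 : iterPoly A B 3 →+* iterPoly A B 2)
    (degen A B 0 0 : iterPoly A B 1 →+* iterPoly A B 2)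
    (degen A B 1 0 : iterPoly A B 2 →+* iterPoly A B 3)
    (degen A B 1 1 : iterPoly A B 2 →+* iterPoly A B 3)
    (fun _ => degen_mem 0) (fun _ => degen_mem 1) (fun _ => face_mem 0) (fun _ => face_mem 1)
    (fun _ => degen_mem 0) (fun _ => exists_lift_face_zero)
    (fun _ _ => exists_lift_face_one)
    (face_castSucc_degen A B 0 0) (face_succ_degen A B 0 0)
    (face_castSucc_degen A B 1 0) (face_succ_degen A B 1 0)
    (face_degen_of_lt A B 0 1 0 (by decide))
    (face_degen_of_le A B 0 0 0 (by decide))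
    (face_castSucc_degen A B 1 1) hS hw h0 h1

/-- A normalized 2-cycle is dz with z in the augmentation kernel. Degenerate corrections, invisible
to d, bring z to a form whose only nonzero face is a 1-cycle in the square of the kernel. That cycle
bounds inside the square, so z can be changed without changing dz until all its faces vanish. -/
theorem exists_cotangent_lift (hS : (augKer A B 1).IsSyzygetic) (x : cotangentModule A B 2)
    (hx : ∀ i, cotangentFace A B 1 i x = 0) :
    ∃ y, cotangentFace A B 2 0 y = x ∧ ∀ i : Fin 3, cotangentFace A B 2 i.succ y = 0 := by
  obtain ⟨z, hz, rfl⟩ := KaehlerTensor.exists_d_eq (aug_surjective A B 3) _ _ (hx 0)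
  have hd (i : Fin 3) : KaehlerTensor.d (aug A B 2) (face A B 2 i z) = 0 := by
    rw [← cotangentFace_d]; exact hx i
  have q₁ : face A B 2 1 z - face A B 2 0 z ∈ augKer A B 2 ^ 2 :=
    sub_mem_sq_of_face_eq 0 (hd 1) (hd 0) (face_face A B 1 0 0 le_rfl z)
  have q₂ : face A B 2 2 z - face A B 2 1 z ∈ augKer A B 2 ^ 2 :=
    sub_mem_sq_of_face_eq 1 (hd 2) (hd 1) (face_face A B 1 1 1 le_rfl z)
  -- make all faces lie in the square of the kernel
  obtain ⟨z₁, hz₁, hz₁'⟩ : ∃ z₁, KaehlerTensor.d (aug A B 3) z₁ = KaehlerTensor.d (aug A B 3) z ∧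
      ∀ i, face A B 2 i z₁ ∈ augKer A B 2 ^ 2 := by
    refine ⟨z - degen A B 1 0 (face A B 2 0 z), ?_, fun i => ?_⟩
    · rw [KaehlerTensor.d_sub, ← cotangentDegen_d, hd, map_zero, sub_zero]
    · have h1 := face_degen_sub_mem_sq i 0 (hd 0)
      have h2 : face A B 2 i z - face A B 2 0 z ∈ augKer A B 2 ^ 2 := by
        fin_cases i
        · simp
        · exact q₁
        · have := add_mem q₂ q₁
          rwa [sub_add_sub_cancel] at this
      have := sub_mem h2 h1
      rwa [sub_sub_sub_cancel_right, ← map_sub] at this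
  -- make the last two faces vanish
  obtain ⟨z₂, hz₂, hz₂₀, hz₂₁, hz₂₂⟩ : ∃ z₂,
      KaehlerTensor.d (aug A B 3) z₂ = KaehlerTensor.d (aug A B 3) z ∧
      face A B 2 0 z₂ ∈ augKer A B 2 ^ 2 ∧ face A B 2 1 z₂ ∈ augKer A B 2 ^ 2 ∧
      face A B 2 2 z₂ = 0 := by
    refine ⟨z₁ - degen A B 1 1 (face A B 2 2 z₁), ?_, ?_, ?_, ?_⟩
    · rw [KaehlerTensor.d_sub, hz₁, KaehlerTensor.d_eq_zero_of_mem _ (degen_mem_sq 1 (hz₁' 2)),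
        sub_zero]
    · rw [map_sub]
      exact sub_mem (hz₁' 0) (face_mem_sq 0 (degen_mem_sq 1 (hz₁' 2)))
    · rw [map_sub]
      exact sub_mem (hz₁' 1) (face_mem_sq 1 (degen_mem_sq 1 (hz₁' 2)))
    · rw [map_sub, sub_eq_zero]
      exact (face_succ_degen A B 1 1 _).symm
  obtain ⟨z₃, hz₃, hz₃₀, hz₃₁, hz₃₂⟩ : ∃ z₃,
      KaehlerTensor.d (aug A B 3) z₃ = KaehlerTensor.d (aug A B 3) z ∧
      face A B 2 0 z₃ ∈ augKer A B 2 ^ 2 ∧ face A B 2 1 z₃ = 0 ∧ face A B 2 2 z₃ = 0 := by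
    refine ⟨z₂ - degen A B 1 0 (face A B 2 1 z₂), ?_, ?_, ?_, ?_⟩
    · rw [KaehlerTensor.d_sub, hz₂, KaehlerTensor.d_eq_zero_of_mem _ (degen_mem_sq 0 hz₂₁),
        sub_zero]
    · rw [map_sub]
      exact sub_mem hz₂₀ (face_mem_sq 0 (degen_mem_sq 0 hz₂₁))
    · rw [map_sub, sub_eq_zero]
      exact (face_succ_degen A B 1 0 _).symm
    -- The last face stays zero: the last face of the correction is a degeneracy of the last face of
    -- `face A B 2 1 z₂`, which by a simplicial identity is a face of `face A B 2 2 z₂ = 0`.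
    · rw [map_sub, hz₂₂, zero_sub, neg_eq_zero]
      refine (face_degen_of_lt A B 0 1 0 (by decide) _).trans ?_
      have := face_face A B 1 1 1 le_rfl z₂
      change degen A B 0 0 (face A B 1 1 (face A B 2 1 z₂)) = 0
      rw [← map_zero (degen A B 0 0)]
      refine congrArg _ (this.symm.trans ?_)
      exact (congrArg _ hz₂₂).trans (map_zero _)
  obtain ⟨v, hv, hv₀, hv₁, hv₂⟩ := exists_sq_lift hS hz₃₀
    (((face_face A B 1 0 0 le_rfl z₃).symm.trans (congrArg _ hz₃₁)).trans (map_zero _))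
    (((face_face A B 1 0 1 (by decide) z₃).symm.trans (congrArg _ hz₃₂)).trans (map_zero _))
  -- Now `z₃ - v` has only zero faces, so the extra degeneracy bounds it; `v` lies in the square of
  -- the kernel and has dv = 0.
  obtain ⟨m, -, hm₀, hm⟩ := exists_face_eq A B 2 (w := z₃ - v) (fun i => by
    fin_cases i
    · exact (map_sub _ _ _).trans (sub_eq_zero.2 hv₀.symm)
    · exact (map_sub _ _ _).trans (sub_eq_zero.2 (hz₃₁.trans hv₁.symm))
    · exact (map_sub _ _ _).trans (sub_eq_zero.2 (hz₃₂.trans hv₂.symm)))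
  refine ⟨KaehlerTensor.d _ m, ?_, fun i => ?_⟩
  · rw [cotangentFace_d, hm₀, KaehlerTensor.d_sub, hz₃, KaehlerTensor.d_eq_zero_of_mem _ hv,
      sub_zero]
  · rw [cotangentFace_d, hm, KaehlerTensor.d_zero]

/-- A relation θ is lifted to t in Sym² one degree higher with faces θ and 0. The product of t is a
1-cycle, bounded by some z, and dz is a normalized 2-cycle. A bounding element of dz supplies the
data of `SymSq.map_eq_map_of_boundary`, which identifies the two faces θ and 0 of t. -/
theorem isSyzygetic_of_cotangent_lift
    (H : ∀ x : cotangentModule A B 2, (∀ i, cotangentFace A B 1 i x = 0) →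
      ∃ y, cotangentFace A B 2 0 y = x ∧ ∀ i : Fin 3, cotangentFace A B 2 i.succ y = 0) :
    (augKer A B 1).IsSyzygetic := by
  intro θ hθ
  have hI₀ : augKer A B 2 ≤ (augKer A B 1).comap (face A B 1 0 : iterPoly A B 2 →+* iterPoly A B 1) :=
    fun _ => face_mem 0
  have hI₁ : augKer A B 2 ≤ (augKer A B 1).comap (face A B 1 1 : iterPoly A B 2 →+* iterPoly A B 1) :=
    fun _ => face_mem 1
  obtain ⟨t, ht₀, ht₁⟩ := SymSq.exists_map_eq
    (face A B 1 0 : iterPoly A B 2 →+* iterPoly A B 1)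
    (face A B 1 1 : iterPoly A B 2 →+* iterPoly A B 1)
    (degen A B 0 0 : iterPoly A B 1 →+* iterPoly A B 2) hI₀ hI₁
    (fun _ => degen_mem 0) (fun _ => exists_lift_face_zero) (face_castSucc_degen A B 0 0) θ
  have hw₀ : face A B 1 0 (SymSq.mul t) = 0 := by
    have := SymSq.mul_map (face A B 1 0 : iterPoly A B 2 →+* iterPoly A B 1) hI₀ t
    rw [ht₀, hθ] at this
    exact this.symm
  have hw₁ : face A B 1 1 (SymSq.mul t) = 0 := by
    have := SymSq.mul_map (face A B 1 1 : iterPoly A B 2 →+* iterPoly A B 1) hI₁ t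
    rw [ht₁, map_zero] at this
    exact this.symm
  obtain ⟨z, hz, hz₀, hz₁, hz₂⟩ := exists_lift_face_one hw₀ hw₁
  obtain ⟨y, hy₀, hy⟩ := H (KaehlerTensor.d _ z) (fun i => by
    rw [cotangentFace_d]
    fin_cases i
    · exact (congrArg _ hz₀).trans (KaehlerTensor.d_eq_zero_of_mem _ (SymSq.mul_mem t))
    · exact (congrArg _ hz₁).trans (KaehlerTensor.d_zero _)
    · exact (congrArg _ hz₂).trans (KaehlerTensor.d_zero _))
  obtain ⟨v, hv, rfl⟩ := KaehlerTensor.exists_d_eq (aug_surjective A B 4) _ _ (hy 0)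
  have hd (i : Fin 3) : KaehlerTensor.d (aug A B 3) (face A B 3 i.succ v) = 0 := by
    rw [← cotangentFace_d]; exact hy i
  rw [cotangentFace_d] at hy₀
  -- Both summands have zero differential, so membership in the square can be tested on a single
  -- face, where the difference is minus the product of `t`.
  have q₀ : face A B 3 0 v - z - face A B 3 1 v ∈ augKer A B 3 ^ 2 := by
    refine mem_sq_of_face_mem_sq 0 ?_ ?_
    · rw [KaehlerTensor.d_sub, KaehlerTensor.d_sub, hy₀, sub_self, zero_sub, neg_eq_zero]
      exact hd 0
    · have := face_face A B 2 0 0 le_rfl v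
      have e : face A B 2 0 (face A B 3 1 v) = face A B 2 0 (face A B 3 0 v) := this
      rw [map_sub, map_sub, e, sub_sub_cancel_left, hz₀]
      exact neg_mem (SymSq.mul_mem t)
  have q₂ : face A B 3 2 v - face A B 3 1 v ∈ augKer A B 3 ^ 2 :=
    sub_mem_sq_of_face_eq 1 (hd 1) (hd 0) (face_face A B 2 1 1 le_rfl v)
  have q₃ : face A B 3 3 v - face A B 3 2 v ∈ augKer A B 3 ^ 2 :=
    sub_mem_sq_of_face_eq 2 (hd 2) (hd 1) (face_face A B 2 2 2 le_rfl v)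
  -- All faces of `v`, after removing `z` from the zeroth, agree modulo the square. Subtracting one
  -- degeneracy of this common value from `v` moves them all into the square.
  have hk (i : Fin 4) (u : iterPoly A B 3) (hu : u - face A B 3 1 v ∈ augKer A B 3 ^ 2) :
      u - face A B 3 i (degen A B 2 0 (face A B 3 1 v)) ∈ augKer A B 3 ^ 2 := by
    have := sub_mem hu (face_degen_sub_mem_sq i 0 (hd 0))
    rwa [← Fin.succ_zero_eq_one, sub_sub_sub_cancel_right] at this
  have key := SymSq.map_eq_map_of_boundary (A := A) (σ := iterPoly A B 1)
    (I₁ := augKer A B 2) (I₀ := augKer A B 1) (I₂ := augKer A B 3)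
    (face A B 1 0) (face A B 1 1)
    (face A B 2 0 : iterPoly A B 3 →+* iterPoly A B 2)
    (face A B 2 1 : iterPoly A B 3 →+* iterPoly A B 2)
    (face A B 2 2 : iterPoly A B 3 →+* iterPoly A B 2)
    (face A B 3 0 : iterPoly A B 4 →+* iterPoly A B 3)
    (face A B 3 1 : iterPoly A B 4 →+* iterPoly A B 3)
    (face A B 3 2 : iterPoly A B 4 →+* iterPoly A B 3)
    (face A B 3 3 : iterPoly A B 4 →+* iterPoly A B 3) hI₀ hI₁
    (fun i => (map_sub (aug A B 1) _ _).trans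
      (sub_eq_zero.2 ((aug_face A B 1 0 _).trans (aug_face A B 1 1 _).symm)))
    (fun _ => face_mem 0) (fun _ => face_mem 1) (fun _ => face_mem 2)
    (face_face A B 1 0 0 le_rfl) (face_face A B 1 0 1 (by decide)) (face_face A B 1 1 1 le_rfl)
    (face_face A B 2 0 0 le_rfl) (face_face A B 2 0 1 (by decide))
    (face_face A B 2 0 2 (by decide)) (face_face A B 2 1 1 le_rfl)
    (face_face A B 2 1 2 (by decide)) (face_face A B 2 2 2 le_rfl) t z hz₀ hz₁ hz₂
    (v - degen A B 2 0 (face A B 3 1 v))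
    (by
      have := hk 0 _ q₀
      change face A B 3 0 (v - degen A B 2 0 (face A B 3 1 v)) - z ∈ _
      rwa [map_sub, sub_right_comm])
    (by
      have := hk 1 (face A B 3 1 v) (by rw [sub_self]; exact zero_mem _)
      change face A B 3 1 (v - degen A B 2 0 (face A B 3 1 v)) ∈ _
      rwa [map_sub])
    (by
      have := hk 2 _ q₂
      change face A B 3 2 (v - degen A B 2 0 (face A B 3 1 v)) ∈ _
      rwa [map_sub])
    (by
      have := hk 3 (face A B 3 3 v) (by
        have := add_mem q₃ q₂
        rwa [sub_add_sub_cancel] at this)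
      change face A B 3 3 (v - degen A B 2 0 (face A B 3 1 v)) ∈ _
      rwa [map_sub])
  exact ht₀.symm.trans (key.trans ht₁)

variable (A B)

theorem exact_cotangentD_iff_isSyzygetic :
    (∀ x, cotangentD A B 1 x = 0 → ∃ y, cotangentD A B 2 y = x) ↔ (augKer A B 1).IsSyzygetic := by
  rw [exact_cotangentD_iff]
  exact ⟨isSyzygetic_of_cotangent_lift, fun hS x hx => exists_cotangent_lift hS x hx⟩

theorem isZero_homology_two_iff :
    Limits.IsZero (homology A B 2 B) ↔
      (∀ x, cotangentD A B 1 x = 0 → ∃ y, cotangentD A B 2 y = x) := by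
  let e : ((MonoidalCategory.tensorRight (ModuleCat.of B B)).mapHomologicalComplex
      (ComplexShape.down ℕ)).obj (cotangentComplex A B) ≅ cotangentComplex A B :=
    (NatIso.mapHomologicalComplex (MonoidalCategory.rightUnitorNatIso (ModuleCat.{u} B))
      (ComplexShape.down ℕ)).app (cotangentComplex A B) ≪≫
      (Functor.mapHomologicalComplexIdIso (ModuleCat.{u} B) _).app _
  have h1 : Limits.IsZero (homology A B 2 B) ↔ (cotangentComplex A B).ExactAt 2 := by
    rw [HomologicalComplex.exactAt_iff_isZero_homology]
    exact ((HomologicalComplex.homologyFunctor _ _ 2).mapIso e).isZero_iff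
  rw [h1, HomologicalComplex.exactAt_iff' _ 3 2 1 (by simp) (by simp),
    ShortComplex.moduleCat_exact_iff]
  have h32 : (cotangentComplex A B).d 3 2 = ModuleCat.ofHom (cotangentD A B 2) :=
    ChainComplex.of_d (X := fun n => ModuleCat.of B (cotangentModule A B n))
      (d := fun n => ModuleCat.ofHom (cotangentD A B n)) 2
  have h21 : (cotangentComplex A B).d 2 1 = ModuleCat.ofHom (cotangentD A B 1) :=
    ChainComplex.of_d (X := fun n => ModuleCat.of B (cotangentModule A B n))
      (d := fun n => ModuleCat.ofHom (cotangentD A B n)) 1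
  simp only [HomologicalComplex.shortComplexFunctor'_obj_f,
    HomologicalComplex.shortComplexFunctor'_obj_g, h32, h21]
  exact Iff.rfl

variable {A B}

/-- The standard resolution gives the criterion for A[B] → B. Any other polynomial presentation has
maps to and from A[B] over B, so the syzygetic property transfers both ways. -/
theorem isZero_homology_two_iff_isSyzygetic {σ : Type*} (π : MvPolynomial σ A →ₐ[A] B)
    (hπ : Function.Surjective π) :
    Limits.IsZero (homology A B 2 B) ↔ (RingHom.ker π).IsSyzygetic := by
  rw [isZero_homology_two_iff, exact_cotangentD_iff_isSyzygetic]
  choose g hg using hπ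
  have h1 : ∀ x : MvPolynomial B A,
      π ((MvPolynomial.aeval g : MvPolynomial B A →ₐ[A] MvPolynomial σ A) x) = aug A B 1 x := by
    intro x
    have : π.comp (MvPolynomial.aeval g : MvPolynomial B A →ₐ[A] MvPolynomial σ A) =
        MvPolynomial.aeval id := by
      ext b; simp [hg]
    exact DFunLike.congr_fun this x
  have h2 : ∀ x : MvPolynomial σ A,
      aug A B 1 ((MvPolynomial.aeval (fun i => MvPolynomial.X (π (MvPolynomial.X i))) :
        MvPolynomial σ A →ₐ[A] MvPolynomial B A) x) = π x := by
    intro x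
    have : (MvPolynomial.aeval id : MvPolynomial B A →ₐ[A] B).comp
        (MvPolynomial.aeval (fun i => MvPolynomial.X (π (MvPolynomial.X i))) :
        MvPolynomial σ A →ₐ[A] MvPolynomial B A) = π := by
      ext b; simp
    exact DFunLike.congr_fun this x
  exact ⟨fun h => Ideal.IsSyzygetic.of_retract h _ h2 _ h1,
    fun h => Ideal.IsSyzygetic.of_retract h _ h1 _ h2⟩

end AndreQuillen

/-! ### The syzygetic property and Koszul homology -/

namespace Koszul

section Boundaries

variable {S : Type*} [CommRing S] {s : ℕ} (f : Fin s → S)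

theorem d₁_apply (z : Fin s → S) : d₁ f z = ∑ i, z i * f i := by
  simp [d₁, Fintype.linearCombination_apply]

theorem single_sub_single_mem_boundaries (i j : Fin s) :
    (Pi.single j (f i) - Pi.single i (f j) : Fin s → S) ∈ boundaries f :=
  Submodule.subset_span ⟨(i, j), rfl⟩

theorem d₁_eq_zero_of_mem_boundaries {z : Fin s → S} (hz : z ∈ boundaries f) : d₁ f z = 0 := by
  have : boundaries f ≤ LinearMap.ker (d₁ f) := by
    refine Submodule.span_le.2 ?_
    rintro _ ⟨⟨i, j⟩, rfl⟩
    rw [SetLike.mem_coe, LinearMap.mem_ker, d₁_apply]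
    simp only [Pi.sub_apply, sub_mul, Finset.sum_sub_distrib]
    simp [Pi.single_apply, mul_comm]
  exact this hz

/-- The element is the Koszul differential of e ∧ c. -/
theorem smul_sub_smul_mem_boundaries (c e : Fin s → S) :
    d₁ f e • c - d₁ f c • e ∈ boundaries f := by
  have : d₁ f e • c - d₁ f c • e =
      ∑ i, ∑ j, (c i * e j) • (Pi.single i (f j) - Pi.single j (f i) : Fin s → S) := by
    funext k
    simp only [d₁_apply, Pi.sub_apply, Pi.smul_apply, smul_eq_mul, Finset.sum_apply, smul_sub,
      Finset.sum_sub_distrib, Pi.single_apply, mul_ite, mul_zero, Finset.sum_ite_eq,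
      Finset.mem_univ, if_true]
    congr 1
    · rw [Finset.sum_comm]
      simp only [Finset.sum_ite_eq, Finset.mem_univ, if_true, Finset.sum_mul]
      exact Finset.sum_congr rfl fun _ _ => by ring
    · rw [Finset.sum_mul]
      exact Finset.sum_congr rfl fun _ _ => by ring
  rw [this]
  exact Submodule.sum_mem _ fun i _ => Submodule.sum_mem _ fun j _ =>
    Submodule.smul_mem _ _ (single_sub_single_mem_boundaries f j i)

theorem smul_mem_boundaries {y : S} (hy : y ∈ Ideal.span (Set.range f)) {z : Fin s → S}
    (hz : d₁ f z = 0) : y • z ∈ boundaries f := by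
  obtain ⟨e, rfl⟩ := (Ideal.mem_span_range_iff_exists_fun).1 hy
  have := smul_sub_smul_mem_boundaries f z e
  rwa [hz, zero_smul, sub_zero, d₁_apply] at this

theorem apply_mem_of_mem_boundaries {z : Fin s → S} (hz : z ∈ boundaries f) (i : Fin s) :
    z i ∈ Ideal.span (Set.range f) := by
  induction hz using Submodule.span_induction with
  | zero => exact zero_mem _
  | add a b _ _ ha hb => exact add_mem ha hb
  | smul r a _ ha => exact Ideal.mul_mem_left _ r ha
  | mem w hw =>
    obtain ⟨⟨k, j⟩, rfl⟩ := hw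
    simp only [Pi.sub_apply, Pi.single_apply]
    refine sub_mem ?_ ?_ <;> split_ifs <;>
      first | exact zero_mem _ | exact Ideal.subset_span ⟨_, rfl⟩

variable {I : Ideal S} (hI : Ideal.span (Set.range f) = I)

theorem exists_d₁_eq (hI : Ideal.span (Set.range f) = I) (x : I) :
    ∃ c : Fin s → S, d₁ f c = x := by
  obtain ⟨c, hc⟩ := Ideal.mem_span_range_iff_exists_fun.1 (hI.symm ▸ x.2 :
    (x : S) ∈ Ideal.span (Set.range f))
  exact ⟨c, by rw [d₁_apply, hc]⟩

/-- The class of `y • c` modulo the boundaries, where `x = ∑ cᵢ fᵢ`. -/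
noncomputable def coeffClass (hI : Ideal.span (Set.range f) = I) (y x : I) :
    (Fin s → S) ⧸ boundaries f :=
  Submodule.Quotient.mk ((y : S) • (exists_d₁_eq f hI x).choose)

theorem coeffClass_eq (y x : I) {c : Fin s → S} (hc : d₁ f c = x) :
    coeffClass f hI y x = Submodule.Quotient.mk ((y : S) • c) := by
  refine (Submodule.Quotient.eq _).2 ?_
  rw [← smul_sub]
  exact smul_mem_boundaries f (hI ▸ y.2) (by
    rw [map_sub, (exists_d₁_eq f hI x).choose_spec, hc, sub_self])

/-- The map from the symmetric square of `I = (f₁, …, fₛ)` to `Sˢ` modulo the boundaries that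
sends `y · ∑ cᵢ fᵢ` to `y • c`. -/
noncomputable def ofSymSq : SymSq I →+ (Fin s → S) ⧸ boundaries f :=
  SymSq.lift
    (AddMonoidHom.mk' (fun y => AddMonoidHom.mk' (fun x => coeffClass f hI y x)
      (fun x x' => by
        obtain ⟨c, hc⟩ := exists_d₁_eq f hI x
        obtain ⟨c', hc'⟩ := exists_d₁_eq f hI x'
        rw [coeffClass_eq f hI y x hc, coeffClass_eq f hI y x' hc',
          coeffClass_eq f hI y (x + x') (c := c + c') (by rw [map_add, hc, hc']; rfl), smul_add]
        rfl))
      (fun y y' => AddMonoidHom.ext fun x => by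
        obtain ⟨c, hc⟩ := exists_d₁_eq f hI x
        change coeffClass f hI (y + y') x = coeffClass f hI y x + coeffClass f hI y' x
        rw [coeffClass_eq f hI y x hc, coeffClass_eq f hI y' x hc,
          coeffClass_eq f hI (y + y') x hc, ← Submodule.Quotient.mk_add, ← add_smul]
        rfl))
    (fun r y x => by
      obtain ⟨c, hc⟩ := exists_d₁_eq f hI x
      change coeffClass f hI (r • y) x = coeffClass f hI y (r • x)
      rw [coeffClass_eq f hI _ x hc,
        coeffClass_eq f hI y (r • x) (c := r • c) (by rw [map_smul, hc]; rfl), smul_smul]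
      congr 2
      exact mul_comm _ _)
    (fun y x => by
      obtain ⟨c, hc⟩ := exists_d₁_eq f hI x
      obtain ⟨e, he⟩ := exists_d₁_eq f hI y
      change coeffClass f hI y x = coeffClass f hI x y
      rw [coeffClass_eq f hI y x hc, coeffClass_eq f hI x y he]
      refine (Submodule.Quotient.eq _).2 ?_
      rw [← hc, ← he]
      exact smul_sub_smul_mem_boundaries f c e)

theorem ofSymSq_sq (y x : I) {c : Fin s → S} (hc : d₁ f c = x) :
    ofSymSq f hI (SymSq.sq y x) = Submodule.Quotient.mk ((y : S) • c) :=
  (SymSq.lift_sq _ _ _ _ _).trans (coeffClass_eq f hI y x hc)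

/-- The element `∑ zᵢ · fᵢ` of the symmetric square. -/
noncomputable def toSymSq (z : Fin s → I) : SymSq I :=
  ∑ i, SymSq.sq (z i) ⟨f i, hI ▸ Ideal.subset_span ⟨i, rfl⟩⟩

theorem mul_toSymSq (z : Fin s → I) :
    SymSq.mul (toSymSq f hI z) = d₁ f (fun i => (z i : S)) := by
  simp [toSymSq, d₁_apply]

theorem ofSymSq_toSymSq (z : Fin s → I) :
    ofSymSq f hI (toSymSq f hI z) = Submodule.Quotient.mk (fun i => (z i : S)) := by
  rw [toSymSq, map_sum]
  have h : ∀ i, ofSymSq f hI (SymSq.sq (z i) ⟨f i, hI ▸ Ideal.subset_span ⟨i, rfl⟩⟩) =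
      (boundaries f).mkQ ((z i : S) • Pi.single i 1) := fun i =>
    ofSymSq_sq f hI _ _ (by simp [d₁_apply, Pi.single_apply])
  rw [Finset.sum_congr rfl fun i _ => h i, ← map_sum]
  change (boundaries f).mkQ _ = (boundaries f).mkQ _
  congr 1
  funext k
  simp [Pi.single_apply]

theorem exists_toSymSq_eq (t : SymSq I) : ∃ z, toSymSq f hI z = t := by
  induction t using SymSq.induction_on with
  | h0 => exact ⟨0, by simp [toSymSq]⟩
  | hadd a b ha hb =>
    obtain ⟨z, rfl⟩ := ha
    obtain ⟨w, rfl⟩ := hb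
    exact ⟨z + w, by simp [toSymSq, SymSq.add_sq, Finset.sum_add_distrib]⟩
  | hsq x y =>
    obtain ⟨c, hc⟩ := exists_d₁_eq f hI y
    refine ⟨fun i => c i • x, ?_⟩
    have : y = ∑ i, c i • (⟨f i, hI ▸ Ideal.subset_span ⟨i, rfl⟩⟩ : I) := by
      refine Subtype.ext ?_
      rw [← hc, d₁_apply]
      simp
    conv_rhs => rw [this, SymSq.sq_sum]
    exact Finset.sum_congr rfl fun i _ => SymSq.smul_sq _ _ _

/-- A Koszul generator becomes fᵢ · fⱼ - fⱼ · fᵢ in the symmetric square, which vanishes by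
symmetry. The proof goes through one chosen lift to `I`, since entries of boundaries lie in `I`
anyway. -/
theorem toSymSq_eq_zero (z : Fin s → I) (hz : (fun i => (z i : S)) ∈ boundaries f) :
    toSymSq f hI z = 0 := by
  have key : ∀ w ∈ boundaries f, ∃ z : Fin s → I, (∀ i, (z i : S) = w i) ∧
      toSymSq f hI z = 0 := by
    intro w hw
    induction hw using Submodule.span_induction with
    | zero => exact ⟨0, fun _ => rfl, by simp [toSymSq]⟩
    | add a b _ _ ha hb =>
      obtain ⟨z, hz, hz'⟩ := ha
      obtain ⟨w, hw, hw'⟩ := hb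
      refine ⟨z + w, fun i => by simp [hz, hw], ?_⟩
      have : toSymSq f hI (z + w) = toSymSq f hI z + toSymSq f hI w := by
        simp [toSymSq, SymSq.add_sq, Finset.sum_add_distrib]
      rw [this, hz', hw', add_zero]
    | smul r a _ ha =>
      obtain ⟨z, hz, hz'⟩ := ha
      refine ⟨r • z, fun i => by simp [hz], ?_⟩
      obtain ⟨w, hw⟩ : ∃ w : I →+ I, ∀ x, w x = r • x :=
        ⟨(LinearMap.lsmul S I r).toAddMonoidHom, fun _ => rfl⟩
      have : toSymSq f hI (r • z) =
          -- The symmetric square carries only an additive structure here, so multiplication by r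
          -- enters as the additive endomorphism that scales the first factor.
          SymSq.lift ((SymSq.sqHom).comp w)
            (fun a x y => by
              simp only [AddMonoidHom.comp_apply, hw, SymSq.sqHom_apply]
              rw [smul_comm, SymSq.smul_sq])
            (fun x y => by
              simp only [AddMonoidHom.comp_apply, hw, SymSq.sqHom_apply]
              rw [SymSq.smul_sq, SymSq.sq_comm]) (toSymSq f hI z) := by
        rw [toSymSq, toSymSq, map_sum]
        refine Finset.sum_congr rfl fun i _ => ?_
        rw [SymSq.lift_sq]
        simp [hw]
      rw [this, hz', map_zero]
    | mem w hw =>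
      obtain ⟨⟨i, j⟩, rfl⟩ := hw
      let g : Fin s → I := fun i => ⟨f i, hI ▸ Ideal.subset_span ⟨i, rfl⟩⟩
      refine ⟨Pi.single j (g i) - Pi.single i (g j), fun k => ?_, ?_⟩
      · simp only [Pi.sub_apply, Pi.single_apply, AddSubgroupClass.coe_sub]
        split_ifs <;> rfl
      · have : ∀ a b : Fin s, ∑ k, SymSq.sq ((Pi.single a (g b) : Fin s → I) k) (g k) =
            SymSq.sq (g b) (g a) := by
          intro a b
          rw [Finset.sum_eq_single a]
          · simp
          · intro k _ hk
            simp [hk]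
          · simp
        change ∑ k, SymSq.sq ((Pi.single j (g i) : Fin s → I) k -
          (Pi.single i (g j) : Fin s → I) k) (g k) = 0
        simp only [SymSq.sub_sq, Finset.sum_sub_distrib, this]
        rw [SymSq.sq_comm, sub_self]
  obtain ⟨z', hz', h0⟩ := key _ hz
  rwa [funext fun i => Subtype.ext (hz' i)] at h0

/-- An ideal is syzygetic if and only if the first Koszul homology injects into `(S/I)ˢ`. -/
theorem isSyzygetic_iff (hI : Ideal.span (Set.range f) = I) : I.IsSyzygetic ↔
    ∀ z : Fin s → S, d₁ f z = 0 → (∀ i, z i ∈ I) → z ∈ boundaries f := by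
  constructor
  · intro h z hz hzI
    have h0 := h (toSymSq f hI fun i => ⟨z i, hzI i⟩) (by rw [mul_toSymSq]; exact hz)
    have := ofSymSq_toSymSq f hI fun i => ⟨z i, hzI i⟩
    rw [h0, map_zero] at this
    exact (Submodule.Quotient.mk_eq_zero _).1 this.symm
  · intro h t ht
    obtain ⟨z, rfl⟩ := exists_toSymSq_eq f hI t
    rw [mul_toSymSq] at ht
    exact toSymSq_eq_zero f hI z (h _ ht fun i => (z i).2)

end Boundaries

/-! ### Boundaries after inverting one element. -/

section Localization

variable {S : Type*} [CommRing S] {s : ℕ} (f : Fin s → S)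

theorem exists_pow_smul_mem_boundaries {S' : Type*} [CommRing S'] [Algebra S S'] (v : S)
    [IsLocalization.Away v S'] {z : Fin s → S}
    (hz : (fun i => algebraMap S S' (z i)) ∈ boundaries (fun i => algebraMap S S' (f i))) :
    ∃ N : ℕ, v ^ N • z ∈ boundaries f := by
  have key : ∀ w ∈ boundaries (fun i => algebraMap S S' (f i)), ∃ (N : ℕ) (z : Fin s → S),
      z ∈ boundaries f ∧ ∀ i, algebraMap S S' v ^ N * w i = algebraMap S S' (z i) := by
    intro w hw
    induction hw using Submodule.span_induction with
    | zero => exact ⟨0, 0, zero_mem _, fun i => by simp⟩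
    | add a b _ _ ha hb =>
      obtain ⟨N, z, hz, hz'⟩ := ha
      obtain ⟨M, w, hw, hw'⟩ := hb
      refine ⟨N + M, v ^ M • z + v ^ N • w, add_mem (Submodule.smul_mem _ _ hz)
        (Submodule.smul_mem _ _ hw), fun i => ?_⟩
      simp only [Pi.add_apply, Pi.smul_apply, smul_eq_mul, map_add, map_mul, map_pow, ← hz', ← hw']
      ring
    | smul r a _ ha =>
      obtain ⟨N, z, hz, hz'⟩ := ha
      obtain ⟨M, r', hr⟩ := IsLocalization.Away.surj v r
      refine ⟨N + M, r' • z, Submodule.smul_mem _ _ hz, fun i => ?_⟩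
      simp only [Pi.smul_apply, smul_eq_mul, map_mul, ← hz', ← hr]
      ring
    | mem w hw =>
      obtain ⟨⟨i, j⟩, rfl⟩ := hw
      refine ⟨0, _, single_sub_single_mem_boundaries f i j, fun k => ?_⟩
      simp only [Pi.sub_apply, Pi.single_apply, map_sub]
      split_ifs <;> simp
  obtain ⟨N, w, hw, hw'⟩ := key _ hz
  have h2 : ∀ i, ∃ m : ℕ, v ^ m * (v ^ N * z i - w i) = 0 := fun i => by
    obtain ⟨⟨_, m, rfl⟩, hm⟩ := (IsLocalization.map_eq_zero_iff (Submonoid.powers v) S'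
      (v ^ N * z i - w i)).1 (by rw [map_sub, map_mul, map_pow, hw', sub_self])
    exact ⟨m, hm⟩
  choose m hm using h2
  -- The sum of the exponents serves all coordinates at once.
  refine ⟨(∑ i, m i) + N, ?_⟩
  have : v ^ ((∑ i, m i) + N) • z = v ^ (∑ i, m i) • w := by
    funext i
    obtain ⟨k, hk⟩ : ∃ k, ∑ i, m i = k + m i := by
      obtain ⟨k, hk⟩ := Nat.exists_eq_add_of_le
        (Finset.single_le_sum (f := m) (fun _ _ => Nat.zero_le _) (Finset.mem_univ i))
      exact ⟨k, by omega⟩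
    have := hm i
    simp only [Pi.smul_apply, smul_eq_mul, hk]
    rw [← sub_eq_zero]
    calc _ = v ^ k * (v ^ m i * (v ^ N * z i - w i)) := by ring
      _ = 0 := by rw [this, mul_zero]
  rw [this]
  exact Submodule.smul_mem _ _ hw

/-- If a polynomial ring localized at `v` has an endomorphism over the algebra `B` that kills
the kernel `I` of its map to `B`, then the syzygies of the generators of `I` with entries in `I`
are boundaries after multiplication by a power of `v`. -/
theorem exists_pow_smul_mem_boundaries_of_retract {A : Type*} [CommRing A] {σ : Type*}
    {I : Ideal (MvPolynomial σ A)} {f : Fin s → MvPolynomial σ A}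
    (hI : Ideal.span (Set.range f) = I) (v : MvPolynomial σ A)
    {S' : Type*} [CommRing S'] [Algebra (MvPolynomial σ A) S'] [Algebra A S']
    [IsScalarTower A (MvPolynomial σ A) S'] [IsLocalization.Away v S']
    (ψ : MvPolynomial σ A →ₐ[A] S') (hψ : ∀ x ∈ I, ψ x = 0)
    (h : ∀ i, algebraMap (MvPolynomial σ A) S' (MvPolynomial.X i) - ψ (MvPolynomial.X i) ∈
      I.map (algebraMap (MvPolynomial σ A) S'))
    {z : Fin s → MvPolynomial σ A} (hz : d₁ f z = 0) (hzI : ∀ i, z i ∈ I) :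
    ∃ N : ℕ, v ^ N • z ∈ boundaries f := by
  have hI' : Ideal.span (Set.range fun i => algebraMap (MvPolynomial σ A) S' (f i)) =
      I.map (algebraMap (MvPolynomial σ A) S') := by
    rw [← hI, Ideal.map_span, ← Set.range_comp]; rfl
  have hφ : I ≤ (I.map (algebraMap (MvPolynomial σ A) S')).comap
      (IsScalarTower.toAlgHom A (MvPolynomial σ A) S' : MvPolynomial σ A →+* S') :=
    Ideal.le_comap_map
  have hψ' : I ≤ (I.map (algebraMap (MvPolynomial σ A) S')).comap (ψ : MvPolynomial σ A →+* S') :=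
    fun x hx => by
      change ψ x ∈ I.map (algebraMap (MvPolynomial σ A) S')
      rw [hψ x hx]; exact zero_mem _
  -- The localization map and `ψ` agree modulo the extended ideal, so they act equally on the
  -- relation given by z. But `ψ` kills `I`, so the relation, and with it z modulo boundaries,
  -- vanishes after localization.
  have key := SymSq.map_eq_map (IsScalarTower.toAlgHom A (MvPolynomial σ A) S') ψ hφ hψ' h
    (toSymSq f hI fun i => ⟨z i, hzI i⟩) (by rw [mul_toSymSq]; exact hz)
  have h0 : SymSq.map (ψ : MvPolynomial σ A →+* S') hψ' (toSymSq f hI fun i => ⟨z i, hzI i⟩) = 0 := by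
    rw [toSymSq, map_sum]
    refine Finset.sum_eq_zero fun i _ => ?_
    rw [SymSq.map_sq]
    convert SymSq.zero_sq _ using 2
    exact Subtype.ext (hψ _ (hzI i))
  have h1 : SymSq.map (IsScalarTower.toAlgHom A (MvPolynomial σ A) S' : MvPolynomial σ A →+* S') hφ
      (toSymSq f hI fun i => ⟨z i, hzI i⟩) =
      toSymSq (fun i => algebraMap (MvPolynomial σ A) S' (f i)) hI'
        (fun i => ⟨algebraMap _ _ (z i), Ideal.mem_map_of_mem _ (hzI i)⟩) := by
    rw [toSymSq, map_sum]
    exact Finset.sum_congr rfl fun i _ => SymSq.map_sq _ _ _ _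
  have h2 := ofSymSq_toSymSq (fun i => algebraMap (MvPolynomial σ A) S' (f i)) hI'
        (fun i => ⟨algebraMap _ _ (z i), Ideal.mem_map_of_mem _ (hzI i)⟩)
  rw [← h1, key, h0, map_zero] at h2
  exact exists_pow_smul_mem_boundaries (S' := S') f v ((Submodule.Quotient.mk_eq_zero _).1 h2.symm)

end Localization

end Koszul

/-! ### Regular sequences modulo an ideal, and associated primes -/

namespace Ideal

variable {R : Type*} [CommRing R]

/-- The element `x` is a nonzerodivisor modulo the ideal `𝔞`. -/
def IsRegularMod (𝔞 : Ideal R) (x : R) : Prop := ∀ m, x * m ∈ 𝔞 → m ∈ 𝔞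

/-- The prime ideal `Q` is the annihilator of an element of `R/𝔞`. -/
def IsAss (Q 𝔞 : Ideal R) : Prop := Q.IsPrime ∧ ∃ z, ∀ a, a ∈ Q ↔ a * z ∈ 𝔞

/-- `RegChain Q 𝔞 n 𝔟` means that `𝔟 = 𝔞 + (x₁, …, xₙ)` for a sequence of elements of `Q`, each
of which is a nonzerodivisor modulo `𝔞` and its predecessors. -/
inductive RegChain (Q 𝔞 : Ideal R) : ℕ → Ideal R → Prop
  | zero : RegChain Q 𝔞 0 𝔞
  | succ {n : ℕ} {𝔟 : Ideal R} {x : R} (h : RegChain Q 𝔞 n 𝔟) (hx : x ∈ Q)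
      (hreg : 𝔟.IsRegularMod x) : RegChain Q 𝔞 (n + 1) (𝔟 ⊔ span {x})

theorem mem_sup_span_singleton {𝔞 : Ideal R} {x m : R} :
    m ∈ 𝔞 ⊔ span {x} ↔ ∃ b, m - x * b ∈ 𝔞 := by
  rw [Submodule.mem_sup]
  constructor
  · rintro ⟨y, hy, z, hz, rfl⟩
    obtain ⟨b, rfl⟩ := mem_span_singleton'.1 hz
    exact ⟨b, by rwa [mul_comm b, add_sub_cancel_right]⟩
  · rintro ⟨b, hb⟩
    exact ⟨_, hb, x * b, mul_mem_right _ _ (mem_span_singleton_self x), sub_add_cancel _ _⟩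

theorem IsAss.le {Q 𝔞 : Ideal R} (h : IsAss Q 𝔞) : 𝔞 ≤ Q := by
  obtain ⟨-, z, hz⟩ := h
  exact fun x hx => (hz x).2 (mul_mem_right _ _ hx)

theorem IsAss.not_isRegularMod {Q 𝔞 : Ideal R} (h : IsAss Q 𝔞) {x : R} (hx : x ∈ Q) :
    ¬ 𝔞.IsRegularMod x := by
  obtain ⟨hQ, z, hz⟩ := h
  intro hr
  refine hQ.ne_top ((eq_top_iff_one _).2 ((hz 1).2 ?_))
  rw [one_mul]
  exact hr z ((hz x).1 hx)

theorem isAss_iff [IsNoetherianRing R] {Q 𝔞 : Ideal R} :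
    IsAss Q 𝔞 ↔ Q ∈ associatedPrimes R (R ⧸ 𝔞) := by
  rw [AssociatedPrimes.mem_iff, isAssociatedPrime_iff, IsAss]
  refine and_congr_right fun _ => ⟨fun ⟨z, hz⟩ => ⟨Ideal.Quotient.mk 𝔞 z, ?_⟩, fun ⟨z, hz⟩ => ?_⟩
  · ext a
    rw [hz, Submodule.mem_colon_singleton, Submodule.mem_bot, Algebra.smul_def,
      Ideal.Quotient.algebraMap_eq, ← map_mul, Ideal.Quotient.eq_zero_iff_mem]
  · obtain ⟨z, rfl⟩ := Ideal.Quotient.mk_surjective z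
    refine ⟨z, fun a => ?_⟩
    rw [hz, Submodule.mem_colon_singleton, Submodule.mem_bot, Algebra.smul_def,
      Ideal.Quotient.algebraMap_eq, ← map_mul, Ideal.Quotient.eq_zero_iff_mem]

theorem finite_setOf_isAss [IsNoetherianRing R] (𝔞 : Ideal R) : {Q | IsAss Q 𝔞}.Finite := by
  simp only [isAss_iff]
  exact associatedPrimes.finite R (R ⧸ 𝔞)

theorem exists_isAss_le [IsNoetherianRing R] {𝔞 : Ideal R} {z : R} (hz : z ∉ 𝔞) :
    ∃ Q, IsAss Q 𝔞 ∧ ∀ a, a * z ∈ 𝔞 → a ∈ Q := by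
  obtain ⟨Q, hQ, hle⟩ := exists_le_isAssociatedPrime_of_isNoetherianRing R
    (Ideal.Quotient.mk 𝔞 z) (by rwa [Ne, Ideal.Quotient.eq_zero_iff_mem])
  refine ⟨Q, isAss_iff.2 hQ, fun a ha => hle ?_⟩
  rwa [Submodule.mem_colon_singleton, Submodule.mem_bot, Algebra.smul_def,
    Ideal.Quotient.algebraMap_eq, ← map_mul, Ideal.Quotient.eq_zero_iff_mem]

theorem isRegularMod_iff [IsNoetherianRing R] {𝔞 : Ideal R} {x : R} :
    𝔞.IsRegularMod x ↔ ∀ Q, IsAss Q 𝔞 → x ∉ Q := by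
  refine ⟨fun h Q hQ hx => hQ.not_isRegularMod hx h, fun h m hm => ?_⟩
  by_contra hm'
  obtain ⟨Q, hQ, hle⟩ := exists_isAss_le hm'
  exact h Q hQ (hle x hm)

/-- Prime avoidance for cosets. -/
theorem exists_add_notMem (s : Finset (Ideal R)) (hs : ∀ Q ∈ s, Q.IsPrime) (x : R)
    (𝔠 : Ideal R) (h : ∀ Q ∈ s, x ∈ Q → ¬ 𝔠 ≤ Q) : ∃ c ∈ 𝔠, ∀ Q ∈ s, x + c ∉ Q := by
  classical
  induction hn : s.card generalizing s with
  | zero =>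
    rw [Finset.card_eq_zero] at hn
    subst hn
    exact ⟨0, zero_mem _, by simp⟩
  | succ n ih =>
    -- Minimality ensures that no other prime of the set is contained in `Q₀`, so an element of all
    -- the others outside `Q₀` exists.
    obtain ⟨Q₀, hQ₀, hmin⟩ := s.exists_minimal (Finset.card_pos.1 (by omega))
    obtain ⟨c, hc, hc'⟩ := ih (s.erase Q₀) (fun Q hQ => hs Q (Finset.mem_of_mem_erase hQ))
      (fun Q hQ => h Q (Finset.mem_of_mem_erase hQ)) (by rw [Finset.card_erase_of_mem hQ₀]; omega)
    by_cases hxc : x + c ∈ Q₀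
    swap
    · refine ⟨c, hc, fun Q hQ => ?_⟩
      by_cases e : Q = Q₀
      · rwa [e]
      · exact hc' Q (Finset.mem_erase.2 ⟨e, hQ⟩)
    have hP := hs Q₀ hQ₀
    have hcQ : ¬ 𝔠 ≤ Q₀ := fun hle => h Q₀ hQ₀ (by
      have := sub_mem hxc (hle hc)
      rwa [add_sub_cancel_right] at this) hle
    obtain ⟨e, he, he'⟩ := SetLike.not_le_iff_exists.1 hcQ
    have hp : ∀ Q ∈ s.erase Q₀, ∃ p ∈ Q, p ∉ Q₀ := fun Q hQ => by
      refine SetLike.not_le_iff_exists.1 fun hle => (Finset.mem_erase.1 hQ).1 ?_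
      exact le_antisymm hle (hmin (Finset.mem_of_mem_erase hQ) hle)
    choose! p hpQ hpQ₀ using hp
    have hprod : ∏ Q ∈ s.erase Q₀, p Q ∉ Q₀ := by
      intro hmem
      obtain ⟨Q, hQ, hQ'⟩ := hP.prod_mem_iff.1 hmem
      exact hpQ₀ Q hQ hQ'
    refine ⟨c + e * ∏ Q ∈ s.erase Q₀, p Q, add_mem hc (mul_mem_right _ _ he), fun Q hQ => ?_⟩
    rw [← add_assoc]
    by_cases eq : Q = Q₀
    · subst eq
      intro hmem
      have := sub_mem hmem hxc
      rw [add_sub_cancel_left] at this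
      exact (hP.mem_or_mem this).elim he' hprod
    · intro hmem
      have hQ' : Q ∈ s.erase Q₀ := Finset.mem_erase.2 ⟨eq, hQ⟩
      refine hc' Q hQ' ?_
      have : e * ∏ Q ∈ s.erase Q₀, p Q ∈ Q :=
        mul_mem_left _ _ (mem_of_dvd _ (Finset.dvd_prod_of_mem p hQ') (hpQ Q hQ'))
      have := sub_mem hmem this
      rwa [add_sub_cancel_right] at this

/-- Coset prime avoidance applied to the finitely many associated primes of `𝔞`. -/
theorem exists_add_isRegularMod [IsNoetherianRing R] (𝔞 : Ideal R) (x : R) (𝔠 : Ideal R)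
    (h : ∀ Q, IsAss Q 𝔞 → x ∈ Q → ¬ 𝔠 ≤ Q) : ∃ c ∈ 𝔠, 𝔞.IsRegularMod (x + c) := by
  have hmem : ∀ Q, Q ∈ (finite_setOf_isAss 𝔞).toFinset ↔ IsAss Q 𝔞 := by simp
  obtain ⟨c, hc, hc'⟩ := exists_add_notMem (finite_setOf_isAss 𝔞).toFinset
    (fun Q hQ => ((hmem Q).1 hQ).1) x 𝔠 (fun Q hQ => h Q ((hmem Q).1 hQ))
  exact ⟨c, hc, isRegularMod_iff.2 fun Q hQ => hc' Q ((hmem Q).2 hQ)⟩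

/-- If an ideal `𝔠` contains nonzerodivisors modulo each of finitely many ideals, then it
contains a common one. -/
theorem exists_isRegularMod [IsNoetherianRing R] (𝔠 : Ideal R) (F : Set (Ideal R)) (hF : F.Finite)
    (h : ∀ 𝔞 ∈ F, ∃ x ∈ 𝔠, 𝔞.IsRegularMod x) : ∃ x ∈ 𝔠, ∀ 𝔞 ∈ F, 𝔞.IsRegularMod x := by
  have hfin : (⋃ 𝔞 ∈ F, {Q | IsAss Q 𝔞}).Finite := hF.biUnion fun 𝔞 _ => finite_setOf_isAss 𝔞
  have hmem : ∀ Q, Q ∈ hfin.toFinset ↔ ∃ 𝔞 ∈ F, IsAss Q 𝔞 := by simp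
  obtain ⟨c, hc, hc'⟩ := exists_add_notMem hfin.toFinset
    (fun Q hQ => by obtain ⟨𝔞, -, h⟩ := (hmem Q).1 hQ; exact h.1) 0 𝔠
    (fun Q hQ _ hle => by
      obtain ⟨𝔞, ha, hQa⟩ := (hmem Q).1 hQ
      obtain ⟨x, hx, hreg⟩ := h 𝔞 ha
      exact hQa.not_isRegularMod (hle hx) hreg)
  refine ⟨c, hc, fun 𝔞 ha => isRegularMod_iff.2 fun Q hQ => ?_⟩
  have := hc' Q ((hmem Q).2 ⟨𝔞, ha, hQ⟩)
  rwa [zero_add] at this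

/-- A version of the exchange of regular elements. -/
theorem IsAss.exchange {Q 𝔞 : Ideal R} {x y : R} (h : IsAss Q (𝔞 ⊔ span {x})) (hy : y ∈ Q)
    (hx : 𝔞.IsRegularMod x) (hy' : 𝔞.IsRegularMod y) : IsAss Q (𝔞 ⊔ span {y}) := by
  obtain ⟨hQ, z, hz⟩ := h
  obtain ⟨w, hw⟩ := mem_sup_span_singleton.1 ((hz y).1 hy)
  refine ⟨hQ, w, fun a => ?_⟩
  rw [hz, mem_sup_span_singleton, mem_sup_span_singleton]
  constructor
  · rintro ⟨b, hb⟩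
    refine ⟨b, hx _ ?_⟩
    have := sub_mem (mul_mem_left _ y hb) (mul_mem_left _ a hw)
    have e : x * (a * w - y * b) = y * (a * z - x * b) - a * (y * z - x * w) := by ring
    rwa [e]
  · rintro ⟨b, hb⟩
    refine ⟨b, hy' _ ?_⟩
    have := add_mem (mul_mem_left _ x hb) (mul_mem_left _ a hw)
    have e : y * (a * z - x * b) = x * (a * w - y * b) + a * (y * z - x * w) := by ring
    rwa [e]

/-- In xm = zb modulo `𝔞`, regularity of z modulo x gives b = xc; then x cancels and m = zc modulo
`𝔞`. -/
theorem IsRegularMod.permute {𝔞 : Ideal R} {x z : R} (hx : 𝔞.IsRegularMod x)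
    (hz : (𝔞 ⊔ span {x}).IsRegularMod z) :
    (𝔞 ⊔ span {z}).IsRegularMod x := by
  intro m hm
  obtain ⟨b, hb⟩ := mem_sup_span_singleton.1 hm
  obtain ⟨c, hc⟩ := mem_sup_span_singleton.1 (hz b (mem_sup_span_singleton.2 ⟨m, by
    have := neg_mem hb
    rwa [neg_sub] at this⟩))
  refine mem_sup_span_singleton.2 ⟨c, hx _ ?_⟩
  have e : x * (m - z * c) = (x * m - z * b) + z * (b - x * c) := by ring
  rw [e]
  exact add_mem hb (mul_mem_left _ _ hc)

namespace RegChain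

theorem mono {Q Q' 𝔞 𝔟 : Ideal R} {n : ℕ} (h : RegChain Q 𝔞 n 𝔟) (hb : 𝔟 ≤ Q') :
    RegChain Q' 𝔞 n 𝔟 := by
  induction h with
  | zero => exact zero
  | succ h hx hreg ih =>
    exact (ih (le_sup_left.trans hb)).succ (hb (mem_sup_right
      (mem_span_singleton_self _))) hreg

theorem truncate {Q 𝔞 𝔟 : Ideal R} {n : ℕ} (h : RegChain Q 𝔞 n 𝔟) {k : ℕ} (hk : k < n) :
    ∃ 𝔠, RegChain Q 𝔞 k 𝔠 ∧ ∃ x ∈ Q, 𝔠.IsRegularMod x := by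
  induction h with
  | zero => omega
  | succ h hx hreg ih =>
    rcases Nat.lt_succ_iff_lt_or_eq.1 hk with h' | rfl
    · exact ih h'
    · exact ⟨_, h, _, hx, hreg⟩

/-- An element that is regular modulo suitable ideals can be moved to the front of a regular
sequence. -/
theorem shift {Q 𝔞 𝔟 : Ideal R} {n : ℕ} (h : RegChain Q 𝔞 n 𝔟) (hx : ∃ x ∈ Q, 𝔟.IsRegularMod x) :
    ∃ F : Set (Ideal R), F.Finite ∧ (∀ 𝔠 ∈ F, ∃ x ∈ Q, 𝔠.IsRegularMod x) ∧
      ∀ z ∈ Q, (∀ 𝔠 ∈ F, 𝔠.IsRegularMod z) →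
        RegChain Q (𝔞 ⊔ span {z}) n (𝔟 ⊔ span {z}) ∧ 𝔞.IsRegularMod z ∧ 𝔟.IsRegularMod z := by
  induction h with
  | zero =>
    exact ⟨{𝔞}, Set.finite_singleton _, by simpa using hx, fun z _ h => ⟨zero, h _ rfl, h _ rfl⟩⟩
  | @succ n 𝔟 x h hxQ hreg ih =>
    obtain ⟨F, hF, hF', H⟩ := ih ⟨x, hxQ, hreg⟩
    refine ⟨insert (𝔟 ⊔ span {x}) F, hF.insert _, ?_, fun z hz hzF => ?_⟩
    · rintro 𝔠 (rfl | hc)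
      exacts [hx, hF' 𝔠 hc]
    · obtain ⟨h1, h2, h3⟩ := H z hz fun 𝔠 hc => hzF 𝔠 (Set.mem_insert_of_mem _ hc)
      have h4 := hzF _ (Set.mem_insert _ _)
      refine ⟨?_, h2, h4⟩
      rw [sup_right_comm]
      exact h1.succ hxQ (hreg.permute h4)

/-- This is the independence of depth from the chosen regular sequence. An element z regular for all
the intermediate ideals is exchanged for the last member of each sequence; over `𝔞 ⊔ span {z}` both
sequences are one step shorter. -/
theorem isAss_of_isAss [IsNoetherianRing R] {Q : Ideal R} {n : ℕ} : ∀ {𝔞 𝔟 𝔟' : Ideal R},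
    RegChain Q 𝔞 n 𝔟 → RegChain Q 𝔞 n 𝔟' → IsAss Q 𝔟 → IsAss Q 𝔟' := by
  induction n with
  | zero =>
    rintro 𝔞 𝔟 𝔟' ⟨⟩ ⟨⟩ h
    exact h
  | succ n ih =>
    rintro 𝔞 _ _ (_ | ⟨h, hx, hreg⟩) (_ | ⟨h', hx', hreg'⟩) hQ
    obtain ⟨F, hF, hF', H⟩ := h.shift ⟨_, hx, hreg⟩
    obtain ⟨G, hG, hG', K⟩ := h'.shift ⟨_, hx', hreg'⟩
    obtain ⟨z, hz, hzFG⟩ := exists_isRegularMod Q (F ∪ G) (hF.union hG) (by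
      rintro 𝔠 (hc | hc)
      exacts [hF' 𝔠 hc, hG' 𝔠 hc])
    obtain ⟨h1, -, h3⟩ := H z hz fun 𝔠 hc => hzFG 𝔠 (Or.inl hc)
    obtain ⟨k1, -, k3⟩ := K z hz fun 𝔠 hc => hzFG 𝔠 (Or.inr hc)
    exact (ih h1 k1 (hQ.exchange hz hreg h3)).exchange hx' k3 hreg'

theorem map {R' : Type*} [CommRing R'] (f : R →+* R') {Q : Ideal R} {Q' : Ideal R'}
    (hQ : Q ≤ Q'.comap f)
    (hf : ∀ (𝔞 : Ideal R) x, 𝔞.IsRegularMod x → (𝔞.map f).IsRegularMod (f x))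
    {𝔞 𝔟 : Ideal R} {n : ℕ} (h : RegChain Q 𝔞 n 𝔟) : RegChain Q' (𝔞.map f) n (𝔟.map f) := by
  induction h with
  | zero => exact zero
  | succ h hx hreg ih =>
    rw [map_sup, map_span, Set.image_singleton]
    exact ih.succ (hQ hx) (hf _ _ hreg)

end RegChain

end Ideal

/-! ### Cohen–Macaulay rings -/

/-- Every prime ideal contains regular sequences of length up to its height. -/
def HasRegularSequences (R : Type*) [CommRing R] : Prop :=
  ∀ (p : Ideal R) [p.IsPrime] (n : ℕ), (n : ℕ∞) ≤ p.height → ∃ 𝔟, Ideal.RegChain p ⊥ n 𝔟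

/-- Associated primes of ideals generated by regular sequences of length `n` have height at
most `n`. -/
def IsUnmixedRing (R : Type*) [CommRing R] : Prop :=
  ∀ (n : ℕ) (J 𝔟 Q : Ideal R), Ideal.RegChain J ⊥ n 𝔟 → Q.IsAss 𝔟 → Q.height ≤ n

section CohenMacaulay

open Ideal

variable {R : Type*} [CommRing R] [IsNoetherianRing R]

/-- A prime of height above n lies in no associated prime of an ideal generated by n regular
elements, so prime avoidance extends the sequence. -/
theorem IsUnmixedRing.hasRegularSequences (h : IsUnmixedRing R) : HasRegularSequences R := by
  intro p hp n
  induction n with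
  | zero => exact fun _ => ⟨⊥, .zero⟩
  | succ n ih =>
    intro hn
    obtain ⟨𝔟, hb⟩ := ih (le_trans (by exact_mod_cast n.le_succ) hn)
    obtain ⟨x, hx, hreg⟩ := exists_add_isRegularMod 𝔟 0 p fun Q hQ _ hpQ =>
      absurd ((hn.trans (height_mono hpQ)).trans (h n p 𝔟 Q hb hQ)) (by norm_cast; omega)
    rw [zero_add] at hreg
    exact ⟨_, hb.succ hx hreg⟩

/-- If Q had larger height, it would contain a regular sequence of length n + 1. Then Q could not be
associated to the first n members, although this does not depend on the sequence. -/
theorem HasRegularSequences.isUnmixedRing (h : HasRegularSequences R) : IsUnmixedRing R := by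
  intro n J 𝔟 Q hb hQ
  have := hQ.1
  by_contra! hlt
  obtain ⟨𝔠, hc⟩ := h Q (n + 1) (by exact_mod_cast Order.add_one_le_of_lt hlt)
  obtain ⟨𝔠, hc, x, hx, hreg⟩ := hc.truncate n.lt_succ_self
  exact ((hb.mono hQ.le).isAss_of_isAss hc hQ).not_isRegularMod hx hreg

end CohenMacaulay

/-! ### Associated primes of subrings of a Laurent polynomial ring. -/

section Laurent

open LaurentPolynomial Polynomial

/-- The ring homomorphism between Laurent polynomial rings induced by one of the coefficients. -/
noncomputable def LaurentPolynomial.mapRingHom {A B : Type*} [CommRing A] [CommRing B]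
    (φ : A →+* B) : A[T;T⁻¹] →+* B[T;T⁻¹] :=
  eval₂ (LaurentPolynomial.C.comp φ) (isUnit_T 1).unit

variable {A B : Type*} [CommRing A] [CommRing B]

theorem LaurentPolynomial.mapRingHom_C (φ : A →+* B) (c : A) :
    mapRingHom φ (LaurentPolynomial.C c) = LaurentPolynomial.C (φ c) := by
  rw [mapRingHom, eval₂_C]; rfl

theorem LaurentPolynomial.mapRingHom_T (φ : A →+* B) (n : ℤ) :
    mapRingHom φ (T n) = T n := by
  rw [mapRingHom, eval₂_T]
  have : (isUnit_T (R := B) 1).unit = ⟨T 1, T (-1), by rw [← T_add]; rfl, by rw [← T_add]; rfl⟩ :=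
    Units.ext rfl
  rw [this]
  induction n using Int.induction_on with
  | zero => simp
  | succ n ih => rw [zpow_add_one, Units.val_mul, ih, ← T_add]
  | pred n ih =>
    rw [zpow_sub_one, Units.val_mul, ih, sub_eq_add_neg]
    exact (T_add _ _).symm

theorem LaurentPolynomial.mapRingHom_toLaurent (φ : A →+* B) (f : A[X]) :
    mapRingHom φ (toLaurent f) = toLaurent (f.map φ) := by
  have : (mapRingHom φ).comp toLaurent = (toLaurent : B[X] →+* _).comp (Polynomial.mapRingHom φ) := by
    ext x
    · simp [mapRingHom_C]
    · simp [mapRingHom_T]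
  exact DFunLike.congr_fun this f

instance {D : Type*} [CommRing D] [IsDomain D] : IsDomain D[T;T⁻¹] :=
  IsLocalization.isDomain_of_le_nonZeroDivisors (R := D[X]) (M := Submonoid.powers (X : D[X])) _
    (powers_le_nonZeroDivisors_of_noZeroDivisors X_ne_zero)

/-- If the nonzero coefficients of `g` all have annihilator `q`, then a polynomial annihilates `g`
if and only if its coefficients are in `q`. -/
theorem Polynomial.mul_eq_zero_iff_of_annihilator {g : A[X]} {q : Ideal A} (h0 : g ≠ 0)
    (hg : ∀ n ∈ g.support, ∀ c, c ∈ q ↔ c * g.coeff n = 0) (f : A[X]) :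
    f * g = 0 ↔ f.map (Ideal.Quotient.mk q) = 0 := by
  have hC : ∀ c ∈ q, Polynomial.C c * g = 0 := fun c hc => by
    ext n
    rw [coeff_C_mul, coeff_zero]
    by_cases hn : n ∈ g.support
    · exact (hg n hn c).1 hc
    · rw [notMem_support_iff.1 hn, mul_zero]
  constructor
  · induction hn : f.support.card generalizing f with
    | zero =>
      intro _
      rw [card_support_eq_zero] at hn
      simp [hn]
    | succ n ih =>
      intro hfg
      -- The product of the leading coefficients vanishes, so the leading term of f already
      -- annihilates g and can be removed.
      have hlc : f.leadingCoeff ∈ q := by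
        rw [hg g.natDegree (natDegree_mem_support_of_nonzero h0)]
        have := congrArg (fun p => p.coeff (f.natDegree + g.natDegree)) hfg
        simpa [coeff_mul_degree_add_degree] using this
      have he : f.eraseLead * g = 0 := by
        have := f.eraseLead_add_C_mul_X_pow
        rw [← this, add_mul, mul_right_comm, hC _ hlc, zero_mul, add_zero] at hfg
        exact hfg
      have hf := ih f.eraseLead (by rw [card_support_eraseLead, hn]; rfl) he
      rw [← f.eraseLead_add_C_mul_X_pow, Polynomial.map_add, hf]
      simp [Ideal.Quotient.eq_zero_iff_mem.2 hlc]
  · intro hf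
    rw [f.as_sum_support, Finset.sum_mul]
    refine Finset.sum_eq_zero fun n _ => ?_
    have : f.coeff n ∈ q := by
      rw [← Ideal.Quotient.eq_zero_iff_mem, ← coeff_map, hf, coeff_zero]
    rw [← C_mul_X_pow_eq_monomial, mul_right_comm, hC _ this, zero_mul]

/-- If a prime ideal is the annihilator of an element of a subring of `A[T;T⁻¹]` that contains
`A`, then it consists of the elements whose coefficients are in some associated prime of `A`. -/
theorem LaurentPolynomial.exists_isAss {S : Type*} [CommRing S] (ι : S →+* A[T;T⁻¹])
    (hC : ∀ c : A, ∃ s, ι s = LaurentPolynomial.C c) {Q : Ideal S} [hQ : Q.IsPrime]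
    (hg : ∃ g : S, ∀ a, a ∈ Q ↔ ι a * ι g = 0) :
    ∃ q : Ideal A, q.IsAss ⊥ ∧
      ∀ a, a ∈ Q ↔ mapRingHom (Ideal.Quotient.mk q) (ι a) = 0 := by
  classical
  -- Among the elements with annihilator Q, one with the fewest terms is chosen. If a constant
  -- outside Q killed one of its coefficients, multiplying by it would keep the annihilator and
  -- shorten the element. Hence all nonzero coefficients have the same annihilator q.
  let p : ℕ → Prop := fun k => ∃ (g : S) (g' : A[X]) (N : ℤ), (∀ a, a ∈ Q ↔ ι a * ι g = 0) ∧
    toLaurent g' = ι g * T N ∧ g'.support.card = k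
  have hp : ∃ k, p k := by
    obtain ⟨g, hg⟩ := hg
    obtain ⟨N, g', h⟩ := exists_T_pow (ι g)
    exact ⟨_, g, g', N, hg, h, rfl⟩
  obtain ⟨g, g', N, hg, hg', hk⟩ := Nat.find_spec hp
  have hmin : ∀ c : A, ∀ n ∈ g'.support, c * g'.coeff n = 0 → Polynomial.C c * g' = 0 := by
    intro c n hn hcn
    obtain ⟨s, hs⟩ := hC c
    have e : toLaurent (Polynomial.C c * g') = ι s * ι g * T N := by
      rw [map_mul, toLaurent_C, hg', hs, mul_assoc]
    by_cases hsQ : s ∈ Q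
    · rw [← toLaurent_eq_zero, e, (hg s).1 hsQ, zero_mul]
    · exfalso
      have hlt : (Polynomial.C c * g').support.card < Nat.find hp := by
        rw [← hk]
        refine Finset.card_lt_card (Finset.ssubset_iff_subset_ne.2 ⟨fun m hm => ?_, fun heq => ?_⟩)
        · rw [mem_support_iff, coeff_C_mul] at hm
          exact mem_support_iff.2 (right_ne_zero_of_mul hm)
        · rw [← heq, mem_support_iff, coeff_C_mul] at hn
          exact hn hcn
      refine Nat.find_min hp hlt ⟨s * g, _, N, fun a => ?_, by rw [e, map_mul], rfl⟩
      rw [map_mul, ← mul_assoc, ← map_mul, ← hg (a * s)]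
      exact ⟨fun h => Q.mul_mem_right _ h, fun h => (hQ.mem_or_mem h).resolve_right hsQ⟩
  have hg0 : g' ≠ 0 := by
    rintro rfl
    have : ι g = 0 := by
      rw [map_zero] at hg'
      exact ((isUnit_T N).mul_left_eq_zero).1 hg'.symm
    refine hQ.ne_top ((Ideal.eq_top_iff_one _).2 ((hg 1).2 (by rw [this, mul_zero])))
  let q : Ideal A := Ideal.comap (Polynomial.C : A →+* A[X]) (LinearMap.ker
    (LinearMap.toSpanSingleton A[X] A[X] g'))
  have hq : ∀ c, c ∈ q ↔ Polynomial.C c * g' = 0 := fun c => Iff.rfl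
  have hqn : ∀ n ∈ g'.support, ∀ c, c ∈ q ↔ c * g'.coeff n = 0 := fun n hn c => by
    rw [hq]
    refine ⟨fun h => ?_, hmin c n hn⟩
    rw [← coeff_C_mul, h, coeff_zero]
  have hQq : ∀ c s, ι s = LaurentPolynomial.C c → (c ∈ q ↔ s ∈ Q) := fun c s hs => by
    rw [hg, hq, ← toLaurent_eq_zero, map_mul, toLaurent_C, hg', hs, ← mul_assoc,
      (isUnit_T N).mul_left_eq_zero]
  refine ⟨q, ⟨⟨fun h => ?_, fun {a b} hab => ?_⟩, g'.leadingCoeff, fun a => ?_⟩, fun a => ?_⟩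
  · have := (Ideal.eq_top_iff_one _).1 h
    rw [hQq 1 1 (by simp)] at this
    exact hQ.ne_top ((Ideal.eq_top_iff_one _).2 this)
  · obtain ⟨s, hs⟩ := hC a
    obtain ⟨t, ht⟩ := hC b
    rw [hQq _ (s * t) (by simp [hs, ht])] at hab
    rw [hQq _ _ hs, hQq _ _ ht]
    exact hQ.mem_or_mem hab
  · rw [hqn _ (natDegree_mem_support_of_nonzero hg0), Ideal.mem_bot]; rfl
  · obtain ⟨M, f, hf⟩ := exists_T_pow (ι a)
    have h1 : a ∈ Q ↔ f * g' = 0 := by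
      rw [hg, ← toLaurent_eq_zero, map_mul, hf, hg', mul_mul_mul_comm, ← T_add,
        (isUnit_T _).mul_left_eq_zero]
    rw [h1, mul_eq_zero_iff_of_annihilator hg0 hqn, ← toLaurent_eq_zero, ← mapRingHom_toLaurent,
      hf, map_mul, mapRingHom_T, (isUnit_T _).mul_left_eq_zero]

end Laurent

/-! ### Cohen–Macaulay local rings: unmixedness and dimensions of components. -/

section Local

open Ideal IsLocalRing

variable {A : Type*} [CommRing A]

theorem regChain_of_isSMulRegular (Q 𝔞 : Ideal A) (rs : List A) (hQ : ∀ r ∈ rs, r ∈ Q)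
    (h : ∀ i (hi : i < rs.length), (𝔞 ⊔ ofList (rs.take i)).IsRegularMod rs[i]) :
    RegChain Q 𝔞 rs.length (𝔞 ⊔ ofList rs) := by
  induction rs using List.reverseRecOn with
  | nil => simpa using RegChain.zero
  | append_singleton l x ih =>
    have h1 := ih (fun r hr => hQ r (by simp [hr])) (fun i hi => by
      have := h i (by simp; omega)
      rwa [List.take_append_of_le_length hi.le, List.getElem_append_left hi] at this)
    have h2 := h l.length (by simp)
    rw [List.take_left, List.getElem_concat_length] at h2
    · rw [ofList_append, ofList_singleton, ← sup_assoc, List.length_append, List.length_singleton]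
      exact h1.succ (hQ x (by simp)) h2
    · rfl

theorem IsCohenMacaulayLocal.exists_regChain [IsLocalRing A] [IsNoetherianRing A]
    (hA : IsCohenMacaulayLocal A) :
    ∃ (d : ℕ) (𝔟 : Ideal A), ringKrullDim A = d ∧ RegChain (maximalIdeal A) ⊥ d 𝔟 := by
  obtain ⟨rs, hrs, hreg, hd⟩ := hA
  refine ⟨rs.length, _, hd.symm, regChain_of_isSMulRegular _ ⊥ rs hrs fun i hi m hm => ?_⟩
  have h := hreg.toIsWeaklyRegular.regular_mod_prev i hi
  rw [bot_sup_eq] at hm ⊢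
  have e : (ofList (rs.take i) • ⊤ : Submodule A A) = ofList (rs.take i) := by
    rw [smul_eq_mul, mul_top]
  rw [← e, ← Submodule.Quotient.mk_eq_zero] at hm ⊢
  refine h (hm.trans ?_)
  exact (smul_zero _).symm

/-- Adding a regular element enlarges some associated prime. -/
theorem Ideal.IsAss.exists_lt [IsLocalRing A] [IsNoetherianRing A] {Q 𝔞 : Ideal A}
    (h : IsAss Q 𝔞) {x : A} (hx : x ∈ maximalIdeal A) (hreg : 𝔞.IsRegularMod x) :
    ∃ Q', Q < Q' ∧ IsAss Q' (𝔞 ⊔ span {x}) := by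
  have hxQ : x ∉ Q := fun hxQ => h.not_isRegularMod hxQ hreg
  obtain ⟨hQ, z, hz⟩ := h
  -- The elements that Q multiplies into `𝔞`. By Nakayama `N` is not contained in `𝔞 ⊔ span {x}`:
  -- otherwise regularity of x would give N ≤ 𝔞 + xN. An element of `N` outside yields an associated
  -- prime containing both Q and x.
  let N : Ideal A :=
    { carrier := {n | ∀ q ∈ Q, q * n ∈ 𝔞}
      zero_mem' := fun q _ => by simp
      add_mem' := fun ha hb q hq => by rw [mul_add]; exact add_mem (ha q hq) (hb q hq)
      smul_mem' := fun c n hn q hq => by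
        rw [smul_eq_mul, mul_left_comm]; exact mul_mem_left _ _ (hn q hq) }
  have hN : ¬ N ≤ 𝔞 := fun hle => hQ.ne_top ((eq_top_iff_one _).2 ((hz 1).2 (by
    rw [one_mul]; exact hle fun q hq => (hz q).1 hq)))
  have hN' : ¬ N ≤ 𝔞 ⊔ span {x} := by
    intro hle
    refine hN ?_
    refine Submodule.le_of_le_smul_of_le_jacobson_bot (I := maximalIdeal A)
      (IsNoetherian.noetherian N) (maximalIdeal_le_jacobson _) fun n hn => ?_
    obtain ⟨b, hb⟩ := mem_sup_span_singleton.1 (hle hn)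
    have hbN : b ∈ N := fun q hq => hreg _ (by
      have := sub_mem (hn q hq) (mul_mem_left _ q hb)
      have e : x * (q * b) = q * n - q * (n - x * b) := by ring
      rwa [e])
    have : n = (n - x * b) + x • b := by rw [smul_eq_mul]; ring
    rw [this]
    exact add_mem (Submodule.mem_sup_left hb)
      (Submodule.mem_sup_right (Submodule.smul_mem_smul hx hbN))
  obtain ⟨n, hn, hn'⟩ := SetLike.not_le_iff_exists.1 hN'
  obtain ⟨Q', hQ', hle⟩ := exists_isAss_le hn'
  refine ⟨Q', lt_of_le_of_ne (fun q hq => hle q (mem_sup_left (hn q hq))) ?_, hQ'⟩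
  rintro rfl
  exact hxQ (hQ'.le (mem_sup_right (mem_span_singleton_self x)))

variable [IsLocalRing A] [IsNoetherianRing A]

/-- As long as n < d, the maximal ideal is not associated to `𝔟`, since a sequence of length n cut
from the given one extends. So `𝔟` extends too, and each new regular element yields a strictly
larger associated prime; the resulting chain of k steps above Q bounds both quantities. -/
theorem Ideal.RegChain.height_add_coheight {d : ℕ} {𝔡 : Ideal A}
    (hd : RegChain (maximalIdeal A) ⊥ d 𝔡) (k : ℕ) :
    ∀ {n : ℕ} {𝔟 Q : Ideal A}, n + k = d → RegChain (maximalIdeal A) ⊥ n 𝔟 → IsAss Q 𝔟 →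
      Q.height + k ≤ (maximalIdeal A).height ∧ (k : WithBot ℕ∞) ≤ ringKrullDim (A ⧸ Q) := by
  induction k with
  | zero =>
    intro n 𝔟 Q hnk hb hQ
    have := hQ.1
    refine ⟨?_, ?_⟩
    · simpa using height_mono (le_maximalIdeal hQ.1.ne_top)
    · simpa using ringKrullDim_nonneg_of_nontrivial
  | succ k ih =>
    intro n 𝔟 Q hnk hb hQ
    have hQP := hQ.1
    obtain ⟨x, hx, hreg⟩ : ∃ x ∈ maximalIdeal A, 𝔟.IsRegularMod x := by
      obtain ⟨c, hc, hreg⟩ := exists_add_isRegularMod 𝔟 0 (maximalIdeal A) fun P hP _ hle => by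
        obtain ⟨𝔠, hc, x, hx, hreg⟩ := hd.truncate (show n < d by omega)
        have : P = maximalIdeal A := le_antisymm (le_maximalIdeal hP.1.ne_top) hle
        subst this
        exact (hb.isAss_of_isAss hc hP).not_isRegularMod hx hreg
      exact ⟨_, by simpa using hc, hreg⟩
    obtain ⟨Q', hlt, hQ'⟩ := hQ.exists_lt hx hreg
    have hQP' := hQ'.1
    obtain ⟨h1, h2⟩ := ih (show n + 1 + k = d by omega) (hb.succ hx hreg) hQ'
    constructor
    · refine le_trans ?_ h1
      have := height_add_one_le_of_lt_of_isPrime hlt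
      calc Q.height + ((k + 1 : ℕ) : ℕ∞) = Q.height + 1 + k := by push_cast; ring
        _ ≤ _ := by gcongr
    · obtain ⟨y, hy, hy'⟩ := SetLike.exists_of_lt hlt
      have := ringKrullDim_succ_le_of_surjective (Ideal.Quotient.factor hlt.le)
        (Ideal.Quotient.factor_surjective hlt.le) (r := Ideal.Quotient.mk Q y)
        (mem_nonZeroDivisors_of_ne_zero (by rwa [Ne, Ideal.Quotient.eq_zero_iff_mem]))
        (by rw [Ideal.Quotient.factor_mk, Ideal.Quotient.eq_zero_iff_mem]; exact hy)
      refine le_trans ?_ this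
      push_cast
      gcongr

theorem IsCohenMacaulayLocal.isUnmixedRing (hA : IsCohenMacaulayLocal A) : IsUnmixedRing A := by
  obtain ⟨d, 𝔡, hdim, hd⟩ := hA.exists_regChain
  have hht : (maximalIdeal A).height = d := by
    have := maximalIdeal_height_eq_ringKrullDim (R := A)
    rw [hdim] at this
    exact_mod_cast this
  intro n J 𝔟 Q hb hQ
  rcases le_or_gt n d with hn | hn
  · have := (hd.height_add_coheight (d - n) (by omega)
      (hb.mono (hQ.le.trans (le_maximalIdeal hQ.1.ne_top))) hQ).1
    rw [hht] at this
    have h2 : Q.height ≠ ⊤ := ne_top_of_le_ne_top (by simp) (le_self_add.trans this)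
    lift Q.height to ℕ using h2 with h
    norm_cast at this ⊢
    omega
  · refine (height_mono (le_maximalIdeal hQ.1.ne_top)).trans ?_
    rw [hht]
    exact_mod_cast hn.le

/-- The chain bound applied to the empty regular sequence, with k = d. -/
theorem IsCohenMacaulayLocal.ringKrullDim_quotient (hA : IsCohenMacaulayLocal A) {p : Ideal A}
    (hp : IsAss p ⊥) : ringKrullDim (A ⧸ p) = ringKrullDim A := by
  obtain ⟨d, 𝔡, hdim, hd⟩ := hA.exists_regChain
  refine le_antisymm (ringKrullDim_quotient_le p) ?_
  rw [hdim]
  exact (hd.height_add_coheight d (zero_add d) .zero hp).2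

end Local

/-! ### Polynomial rings over Cohen–Macaulay rings. -/

section Polynomial

open Ideal Polynomial

variable {R : Type*} [CommRing R]

theorem Ideal.IsRegularMod.map_C {𝔞 : Ideal R} {x : R} (h : 𝔞.IsRegularMod x) :
    (𝔞.map (C : R →+* R[X])).IsRegularMod (C x) := by
  intro m hm
  rw [mem_map_C_iff] at hm ⊢
  intro n
  have := hm n
  rw [coeff_C_mul] at this
  exact h _ this

/-- The associated primes of an extended ideal of a polynomial ring are extended. -/
theorem Ideal.IsAss.exists_eq_map_C [IsNoetherianRing R] {𝔞 : Ideal R} {Q : Ideal R[X]}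
    (h : IsAss Q (𝔞.map C)) : ∃ q, IsAss q 𝔞 ∧ Q = q.map C := by
  obtain ⟨hQ, z, hz⟩ := h
  -- Reduction of coefficients modulo `𝔞` turns Q into the annihilator of a Laurent polynomial.
  let ι : R[X] →+* LaurentPolynomial (R ⧸ 𝔞) :=
    toLaurent.comp (Polynomial.mapRingHom (Ideal.Quotient.mk 𝔞))
  have hι : ∀ {S : Type _} [CommRing S] (φ : R →+* S) (x : R[X]),
      x.map φ = 0 ↔ x ∈ (RingHom.ker φ).map C := fun φ x => by
    rw [← Polynomial.ker_mapRingHom, RingHom.mem_ker, coe_mapRingHom]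
  obtain ⟨q, ⟨hq, w, hw⟩, hqQ⟩ := LaurentPolynomial.exists_isAss ι (fun c => by
    obtain ⟨c, rfl⟩ := Ideal.Quotient.mk_surjective c
    exact ⟨C c, by simp [ι]⟩) (Q := Q) ⟨z, fun a => by
      rw [hz, ← map_mul]
      change _ ↔ toLaurent ((a * z).map _) = 0
      rw [toLaurent_eq_zero, hι, mk_ker]⟩
  obtain ⟨w, rfl⟩ := Ideal.Quotient.mk_surjective w
  refine ⟨q.comap (Ideal.Quotient.mk 𝔞), ⟨inferInstance, w, fun a => ?_⟩, ?_⟩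
  · rw [mem_comap, hw, ← map_mul, mem_bot, Ideal.Quotient.eq_zero_iff_mem]
  · ext x
    rw [hqQ]
    change LaurentPolynomial.mapRingHom _ (toLaurent (x.map _)) = 0 ↔ _
    rw [LaurentPolynomial.mapRingHom_toLaurent, toLaurent_eq_zero, Polynomial.map_map, hι,
      ← RingHom.comap_ker, mk_ker]

theorem HasRegularSequences.of_ringEquiv {R' : Type*} [CommRing R'] (e : R ≃+* R')
    (h : HasRegularSequences R) : HasRegularSequences R' := by
  intro p hp n hn
  obtain ⟨𝔟, hb⟩ := h (p.comap e) n (by rwa [e.height_comap])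
  refine ⟨𝔟.map (e : R →+* R'), ?_⟩
  have := hb.map (e : R →+* R') (Q' := p) le_rfl (fun 𝔞 x hx m hm => by
    have hc : ∀ y, y ∈ 𝔞.map (e : R →+* R') ↔ e.symm y ∈ 𝔞 := fun y => by
      rw [show 𝔞.map (e : R →+* R') = 𝔞.comap e.symm from (Ideal.comap_symm e).symm]
      rfl
    rw [hc] at hm ⊢
    rw [map_mul] at hm
    exact hx _ (by simpa using hm))
  rwa [Ideal.map_bot] at this

variable [IsNoetherianRing R]

/-- The extended prime is the zero ideal of its fibre, so the fibre contributes nothing to the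
height. -/
theorem Ideal.height_map_C_le (q : Ideal R) [q.IsPrime] : (q.map (C : R →+* R[X])).height ≤ q.height := by
  have : (q.map (algebraMap R R[X])).IsPrime := isPrime_map_C_of_isPrime
  have : (q.map (algebraMap R R[X])).LiesOver q := ⟨by
    ext x
    change _ ↔ C x ∈ q.map C
    rw [mem_map_C_iff]
    refine ⟨fun h n => ?_, fun h => by simpa using h 0⟩
    rw [coeff_C]
    split_ifs
    exacts [h, zero_mem _]⟩
  have := height_le_height_add_of_liesOver q (q.map (algebraMap R R[X]))
  rw [map_quotient_self, height_bot, add_zero] at this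
  exact this

attribute [local instance] Polynomial.algebra Polynomial.isLocalization in
-- After localizing at the contraction p, the prime lies in a maximal ideal over the maximal ideal
-- of the base, whose height exceeds that of p by exactly one.
theorem Ideal.height_le_height_comap_C_add_one (Q : Ideal R[X]) [Q.IsPrime] :
    Q.height ≤ (Q.comap C).height + 1 := by
  set p := Q.comap C with hp
  have : Q.LiesOver p := ⟨rfl⟩
  let Rₚ := Localization.AtPrime p
  set p' : Ideal Rₚ := p.map (algebraMap R Rₚ) with p'_def
  have hp' : p'.IsMaximal := by
    rw [p'_def, Localization.AtPrime.map_eq_maximalIdeal]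
    exact IsLocalRing.maximalIdeal.isMaximal Rₚ
  let Q' : Ideal Rₚ[X] := Q.map (algebraMap R[X] Rₚ[X])
  have disj : Disjoint (p.primeCompl.map C : Set R[X]) Q := by
    refine Set.disjoint_left.mpr fun a ⟨b, hb⟩ ha ↦ hb.1 ?_
    rwa [SetLike.mem_coe, hp, mem_comap, hb.2]
  have : Q'.LiesOver p' := IsLocalization.liesOver_of_isPrime_of_disjoint p.primeCompl _ _ disj
  have hQ' : Q'.IsPrime :=
    IsLocalization.isPrime_of_isPrime_disjoint (Submonoid.map C p.primeCompl) _ Q ‹_› disj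
  obtain ⟨M, hM, hle⟩ := exists_le_maximal Q' hQ'.ne_top
  have : M.LiesOver p' := ⟨hp'.eq_of_le (comap_isPrime _ M).ne_top (by
    rw [Ideal.LiesOver.over (P := Q') (p := p')]
    exact comap_mono hle)⟩
  have eq1 : p.height = p'.height := by
    rw [IsLocalization.height_map_of_disjoint p.primeCompl]
    exact Disjoint.symm <| Set.disjoint_left.mpr fun _ a b ↦ b a
  have eq2 : Q.height = Q'.height := by
    rw [IsLocalization.height_map_of_disjoint (Submonoid.map C <| p.primeCompl) _ disj]
  rw [eq1, eq2, ← Polynomial.height_eq_height_add_one p' M]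
  exact height_mono hle

/-- Constants give a sequence as long as the height m of the contraction. At most one more element
is required. It exists because the associated primes of the extended ideal are extended from primes
of height at most m, and none of them can contain Q, of height m + 1. -/
theorem HasRegularSequences.polynomial (h : HasRegularSequences R) :
    HasRegularSequences R[X] := by
  intro Q hQ n hn
  have hU := h.isUnmixedRing
  have key : ∀ n : ℕ, (n : ℕ∞) ≤ (Q.comap C).height → ∃ 𝔟 : Ideal R,
      RegChain (Q.comap C) ⊥ n 𝔟 ∧ RegChain Q ⊥ n (𝔟.map C) := fun n hn => by
    obtain ⟨𝔟, hb⟩ := h (Q.comap C) n hn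
    have := hb.map (C : R →+* R[X]) le_rfl (fun _ _ => IsRegularMod.map_C)
    rw [Ideal.map_bot] at this
    exact ⟨𝔟, hb, this⟩
  by_cases hn' : (n : ℕ∞) ≤ (Q.comap C).height
  · obtain ⟨𝔟, -, hb⟩ := key n hn'
    exact ⟨_, hb⟩
  obtain ⟨m, hm⟩ : ∃ m : ℕ, (Q.comap C).height = m :=
    ENat.ne_top_iff_exists.1 (fun h => hn' (by simp [h])) |>.imp fun _ h => h.symm
  have hnm : n = m + 1 := by
    have := hn.trans (height_le_height_comap_C_add_one Q)
    rw [hm] at this hn'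
    norm_cast at this hn'
    omega
  subst hnm
  obtain ⟨𝔟, hb, hb'⟩ := key m hm.ge
  obtain ⟨x, hx, hreg⟩ := exists_add_isRegularMod (𝔟.map C) 0 Q fun P hP _ hle => by
    obtain ⟨q, hq, rfl⟩ := hP.exists_eq_map_C
    have hqP := hq.1
    have hle' : Q.comap C ≤ q := fun a ha => by
      have := mem_map_C_iff.1 (hle ha) 0
      rwa [coeff_C_zero] at this
    have h1 := (hn.trans (height_mono hle)).trans (height_map_C_le q)
    have h2 := hU m _ 𝔟 q hb hq
    exact absurd (h1.trans h2) (by norm_cast; omega)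
  rw [zero_add] at hreg
  exact ⟨_, hb'.succ hx hreg⟩

theorem HasRegularSequences.mvPolynomial (h : HasRegularSequences R) (σ : Type*) [Finite σ] :
    HasRegularSequences (MvPolynomial σ R) := by
  induction σ using Finite.induction_empty_option with
  | @of_equiv α β e ih => exact ih.of_ringEquiv (MvPolynomial.renameEquiv R e).toRingEquiv
  | h_empty => exact h.of_ringEquiv (MvPolynomial.isEmptyAlgEquiv R PEmpty).symm.toRingEquiv
  | @h_option α _ ih => exact ih.polynomial.of_ringEquiv (MvPolynomial.optionEquivLeft R _).symm.toRingEquiv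

end Polynomial

/-! ### Vanishing of Koszul homology -/

namespace Koszul

open Ideal

variable {S : Type u} [CommRing S]

theorem d₁_cons {m : ℕ} (f₀ : S) (f : Fin m → S) (z₀ : S) (z : Fin m → S) :
    d₁ (Fin.cons f₀ f : Fin (m + 1) → S) (Fin.cons z₀ z : Fin (m + 1) → S) =
      z₀ * f₀ + d₁ f z := by
  rw [d₁_apply, d₁_apply, Fin.sum_univ_succ]
  rfl

theorem cons_zero_mem_boundaries {m : ℕ} (f₀ : S) (f : Fin m → S) {w : Fin m → S}
    (hw : w ∈ boundaries f) :
    (Fin.cons 0 w : Fin (m + 1) → S) ∈ boundaries (Fin.cons f₀ f : Fin (m + 1) → S) := by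
  let L : (Fin m → S) →ₗ[S] (Fin (m + 1) → S) :=
    { toFun := fun w => Fin.cons 0 w
      map_add' := fun x y => by
        funext i
        induction i using Fin.cases <;> simp
      map_smul' := fun c x => by
        funext i
        induction i using Fin.cases <;> simp }
  have hL : ∀ (i : Fin m) (c : S), L (Pi.single i c) = Pi.single i.succ c := fun i c => by
    funext k
    induction k using Fin.cases with
    | zero => simp [L]
    | succ k => simp [L, Pi.single_apply]
  have : boundaries f ≤ (boundaries (Fin.cons f₀ f : Fin (m + 1) → S)).comap L := by
    refine Submodule.span_le.2 ?_
    rintro _ ⟨⟨i, j⟩, rfl⟩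
    rw [SetLike.mem_coe, Submodule.mem_comap, map_sub, hL, hL]
    exact single_sub_single_mem_boundaries (Fin.cons f₀ f : Fin (m + 1) → S) i.succ j.succ
  exact this hw

/-- Induction on the number of generators, modulo a regular sequence. Adding to `f₀` a combination
of the other generators gives an element regular modulo `𝔟`: an associated prime of `𝔟` has height
at most k, too small to contain all of f. This element then joins the regular sequence. -/
theorem exists_sub_mem_of_le_height [IsNoetherianRing S] (hS : IsUnmixedRing S) :
    ∀ (m : ℕ) (f : Fin m → S) (k : ℕ) (𝔟 : Ideal S), RegChain ⊤ ⊥ k 𝔟 →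
      (∀ P : Ideal S, P.IsPrime → 𝔟 ≤ P → (∀ i, f i ∈ P) → ((k + m : ℕ) : ℕ∞) ≤ P.height) →
      ∀ z, d₁ f z ∈ 𝔟 → ∃ w ∈ boundaries f, ∀ i, z i - w i ∈ 𝔟 := by
  intro m
  induction m with
  | zero => exact fun f k 𝔟 _ _ z _ => ⟨0, zero_mem _, fun i => i.elim0⟩
  | succ m ih =>
    intro f k 𝔟 hb hP z hz
    obtain ⟨f₀, f, rfl⟩ : ∃ f₀ f', f = Fin.cons f₀ f' := ⟨_, _, (Fin.cons_self_tail f).symm⟩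
    obtain ⟨z₀, z, rfl⟩ : ∃ z₀ z', z = Fin.cons z₀ z' := ⟨_, _, (Fin.cons_self_tail z).symm⟩
    obtain ⟨g, hg, hreg⟩ := exists_add_isRegularMod 𝔟 f₀ (span (Set.range f)) fun Q hQ h0 hle => by
      have := hP Q hQ.1 hQ.le (fun i => by
        induction i using Fin.cases with
        | zero => exact h0
        | succ i => exact hle (subset_span ⟨i, rfl⟩))
      have := this.trans (hS k _ 𝔟 Q hb hQ)
      norm_cast at this
      omega
    obtain ⟨c, rfl⟩ := Ideal.mem_span_range_iff_exists_fun.1 hg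
    rw [← d₁_apply] at hreg
    rw [d₁_cons] at hz
    have hd : d₁ f (z - z₀ • c) = (z₀ * f₀ + d₁ f z) - (f₀ + d₁ f c) * z₀ := by
      rw [map_sub, map_smul, smul_eq_mul]; ring
    obtain ⟨w, hw, hzw⟩ := ih f (k + 1) _ (hb.succ (x := f₀ + d₁ f c) trivial hreg)
      (fun P hPP hle hf => by
        have := hP P hPP (le_sup_left.trans hle) (fun i => by
          induction i using Fin.cases with
          | succ i => exact hf i
          | zero =>
            have h1 : f₀ + d₁ f c ∈ P := hle (mem_sup_right (mem_span_singleton_self _))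
            have h2 : d₁ f c ∈ P := by
              rw [d₁_apply]
              exact sum_mem fun i _ => P.mul_mem_left _ (hf i)
            exact (add_mem_cancel_right h2).1 h1)
        rwa [add_assoc, add_comm 1 m])
      (z - z₀ • c) (by
        rw [mem_sup_span_singleton]
        exact ⟨-z₀, by rw [hd]; convert hz using 1; ring⟩)
    simp only [mem_sup_span_singleton] at hzw
    choose e he using hzw
    -- The cycle condition, divided by the regular element f₀ + `d₁ f c`, determines z₀ modulo `𝔟`.
    have h0 : z₀ + d₁ f e ∈ 𝔟 := by
      refine hreg _ ?_
      have h1 : d₁ f (fun i => (z - z₀ • c) i - w i - (f₀ + d₁ f c) * e i) =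
          d₁ f (z - z₀ • c) - d₁ f w - (f₀ + d₁ f c) * d₁ f e := by
        rw [← smul_eq_mul (f₀ + d₁ f c), ← map_smul, ← map_sub, ← map_sub]
        rfl
      rw [d₁_eq_zero_of_mem_boundaries f hw, hd] at h1
      have h2 : d₁ f (fun i => (z - z₀ • c) i - w i - (f₀ + d₁ f c) * e i) ∈ 𝔟 := by
        rw [d₁_apply]
        exact sum_mem fun i _ => 𝔟.mul_mem_right _ (he i)
      have := sub_mem hz h2
      rw [h1] at this
      convert this using 1
      ring
    -- The Koszul boundary of (1, c) ∧ (0, e) has head -`d₁ f e`, which is z₀ modulo `𝔟`, and its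
    -- tail supplies the terms missing from w.
    have key := smul_sub_smul_mem_boundaries (Fin.cons f₀ f : Fin (m + 1) → S)
      (Fin.cons 0 e) (Fin.cons 1 c)
    rw [d₁_cons, d₁_cons, one_mul, zero_mul, zero_add] at key
    refine ⟨_, add_mem (cons_zero_mem_boundaries f₀ f hw) key, fun i => ?_⟩
    induction i using Fin.cases with
    | zero => simpa using h0
    | succ i =>
      have := add_mem (he i) (𝔟.mul_mem_right (c i) h0)
      convert this using 1
      simp
      ring

/-- If the ideal generated by `s` elements of a Cohen–Macaulay ring has height at least `s`, then
the first Koszul homology vanishes. -/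
theorem mem_boundaries_of_le_height [IsNoetherianRing S] (hS : IsUnmixedRing S) {s : ℕ}
    (f : Fin s → S) (hf : (s : ℕ∞) ≤ (span (Set.range f)).height) {z : Fin s → S}
    (hz : d₁ f z = 0) : z ∈ boundaries f := by
  obtain ⟨w, hw, h⟩ := exists_sub_mem_of_le_height hS s f 0 ⊥ .zero (fun P _ _ hP => by
    rw [zero_add]
    exact hf.trans (height_mono (span_le.2 (by rintro _ ⟨i, rfl⟩; exact hP i)))) z
    (by rw [hz]; exact zero_mem _)
  have : z = w := funext fun i => sub_eq_zero.1 (h i)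
  rwa [this]

end Koszul

/-! ### Lower bounds for heights of kernels. -/

section Height

open MvPolynomial

variable {A : Type*} [CommRing A] {σ : Type*}

/-- The map that evaluates the variables in `t` in `D` and leaves the other ones. -/
noncomputable def MvPolynomial.partialEval {D : Type*} [CommRing D] [Algebra A D]
    (ρ : MvPolynomial σ A →ₐ[A] D) (t : Set σ) [DecidablePred (· ∈ t)] :
    MvPolynomial σ A →ₐ[A] MvPolynomial σ D :=
  aeval fun j => if j ∈ t then C (ρ (X j)) else X j

variable {D : Type*} [CommRing D] [Algebra A D] (ρ : MvPolynomial σ A →ₐ[A] D)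

theorem MvPolynomial.partialEval_of_mem_adjoin (t : Set σ) [DecidablePred (· ∈ t)] {v}
    (hv : v ∈ Algebra.adjoin A (X '' t)) : partialEval ρ t v = C (ρ v) := by
  have : Algebra.adjoin A (X '' t) ≤ AlgHom.equalizer (partialEval ρ t)
      ((IsScalarTower.toAlgHom A D (MvPolynomial σ D)).comp ρ) := by
    refine Algebra.adjoin_le ?_
    rintro _ ⟨i, hi, rfl⟩
    rw [SetLike.mem_coe, AlgHom.mem_equalizer, partialEval, aeval_X, if_pos hi]
    rfl
  exact this hv

/-- Evaluating more variables factors through evaluating fewer. -/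
theorem MvPolynomial.ker_partialEval_le (t t' : Set σ) [DecidablePred (· ∈ t)]
    [DecidablePred (· ∈ t')] (h : t ⊆ t') :
    RingHom.ker (partialEval ρ t) ≤ RingHom.ker (partialEval ρ t') := by
  have : ((aeval fun j => if j ∈ t' then C (ρ (X j)) else X j :
      MvPolynomial σ D →ₐ[D] MvPolynomial σ D).restrictScalars A).comp (partialEval ρ t) =
      partialEval ρ t' := by
    ext j : 1
    simp only [AlgHom.comp_apply, partialEval, aeval_X]
    by_cases hj : j ∈ t
    · rw [if_pos hj, if_pos (h hj), AlgHom.restrictScalars_apply, aeval_C]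
      rfl
    · rw [if_neg hj, AlgHom.restrictScalars_apply, aeval_X]
  intro x hx
  rw [RingHom.mem_ker] at hx ⊢
  rw [← this, AlgHom.comp_apply, hx, map_zero]

/-- A lower bound for the height of the kernel of a map to a domain that makes all variables
rational functions of one of them. -/
theorem MvPolynomial.card_le_height_ker_add_one [IsDomain D] [Fintype σ] (i₀ : σ)
    (v : MvPolynomial σ A) (w : σ → MvPolynomial σ A) (hv : v ∈ Algebra.adjoin A {X i₀})
    (hw : ∀ j, w j ∈ Algebra.adjoin A {X i₀}) (hv0 : ρ v ≠ 0)
    (hρ : ∀ j, j ≠ i₀ → ρ (v * X j - w j) = 0) :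
    (Fintype.card σ : ℕ∞) ≤ (RingHom.ker ρ).height + 1 := by
  classical
  -- Evaluating the variables one after another, with `X i₀` evaluated from the start, gives a
  -- strictly increasing chain of prime kernels, one step for each other variable.
  have key : ∀ t : Finset σ, i₀ ∉ t →
      (t.card : ℕ∞) ≤ (RingHom.ker (partialEval ρ (insert i₀ t : Finset σ))).height := by
    intro t
    induction t using Finset.induction_on with
    | empty => simp
    | insert j t hj ih =>
      intro hi
      have hi' : i₀ ∉ t := fun h => hi (Finset.mem_insert_of_mem h)
      have hji : j ≠ i₀ := fun h => hi (h ▸ Finset.mem_insert_self _ _)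
      rw [Finset.card_insert_of_notMem hj]
      rw [Nat.cast_add, Nat.cast_one]
      have hle : RingHom.ker (partialEval ρ (insert i₀ t : Finset σ)) <
          RingHom.ker (partialEval ρ (insert i₀ (insert j t) : Finset σ)) := by
        refine lt_of_le_of_ne (ker_partialEval_le ρ _ _ (by
          intro x hx
          simp only [Finset.coe_insert, Set.mem_insert_iff] at hx ⊢
          tauto)) fun heq => ?_
        have hsub : ∀ (s : Finset σ), i₀ ∈ s → ∀ x ∈ Algebra.adjoin A {(X i₀ : MvPolynomial σ A)},
            partialEval ρ (s : Set σ) x = C (ρ x) := fun s hs x hx =>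
          partialEval_of_mem_adjoin ρ _ (Algebra.adjoin_mono (by
            rintro _ rfl; exact ⟨i₀, hs, rfl⟩) hx)
        have hmem : v * X j - w j ∈
            RingHom.ker (partialEval ρ (insert i₀ (insert j t) : Finset σ)) := by
          rw [RingHom.mem_ker, map_sub, map_mul, hsub _ (by simp) _ hv, hsub _ (by simp) _ (hw j),
            partialEval, aeval_X, if_pos (by simp), ← map_mul, ← map_sub, ← map_mul, ← map_sub,
            hρ j hji, map_zero]
        rw [← heq, RingHom.mem_ker, map_sub, map_mul, hsub _ (by simp) _ hv,
          hsub _ (by simp) _ (hw j), partialEval, aeval_X, if_neg (by simp [hji, hj])] at hmem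
        -- The relation v Xⱼ - wⱼ lies only in the larger kernel: before Xⱼ is evaluated its
        -- coefficient there is ρ(v), which is nonzero.
        have := congrArg (coeff (Finsupp.single j 1)) hmem
        rw [coeff_sub, coeff_C_mul, coeff_X, if_pos rfl, coeff_C,
          if_neg (Finsupp.single_ne_zero.2 one_ne_zero).symm, coeff_zero, sub_zero, mul_one] at this
        exact hv0 this
      have h1 := RingHom.ker_isPrime (partialEval ρ (insert i₀ t : Finset σ)).toRingHom
      have h2 := RingHom.ker_isPrime (partialEval ρ (insert i₀ (insert j t) : Finset σ)).toRingHom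
      refine le_trans ?_ (@Ideal.height_add_one_le_of_lt_of_isPrime _ _ _ _ h1 h2 hle)
      gcongr
      exact ih hi'
  have h := key (Finset.univ.erase i₀) (Finset.notMem_erase _ _)
  rw [Finset.card_erase_of_mem (Finset.mem_univ _), Finset.insert_erase (Finset.mem_univ _)] at h
  have hk : RingHom.ker (partialEval ρ ((Finset.univ : Finset σ) : Set σ)) ≤ RingHom.ker ρ := by
    intro x hx
    rw [RingHom.mem_ker, partialEval_of_mem_adjoin] at hx
    · exact C_injective _ _ (hx.trans C_0.symm)
    · rw [Finset.coe_univ, Set.image_univ, adjoin_range_X]; trivial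
  have h2 := h.trans (Ideal.height_mono hk)
  have : 0 < Fintype.card σ := Fintype.card_pos_iff.2 ⟨i₀⟩
  calc (Fintype.card σ : ℕ∞) = (((Finset.univ : Finset σ).card - 1 : ℕ) : ℕ∞) + 1 := by
        rw [Finset.card_univ]; norm_cast; omega
    _ ≤ _ := by gcongr

end Height

/-- The height of a prime and the dimension of its quotient add up to at most the dimension. -/
theorem Ideal.height_add_ringKrullDim_quotient_le {R : Type*} [CommRing R] (P : Ideal R)
    [P.IsPrime] : P.height + ringKrullDim (R ⧸ P) ≤ ringKrullDim R := by
  let p : PrimeSpectrum R := ⟨P, ‹_›⟩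
  have : Nonempty (PrimeSpectrum R) := ⟨p⟩
  have h1 : ringKrullDim (R ⧸ P) = Order.coheight p := by
    rw [ringKrullDim_quotient, Order.coheight_eq_krullDim_Ici]
    rfl
  rw [h1, ringKrullDim, Order.krullDim_eq_iSup_height_add_coheight_of_nonempty,
    show P.height = Order.height p from PrimeSpectrum.height_eq_orderHeight p]
  exact_mod_cast le_iSup (fun q : PrimeSpectrum R => Order.height q + Order.coheight q) p

namespace Koszul

/-- If an ideal generated by `s` elements can be generated by fewer than `s` elements after
inverting `v`, then every prime that does not contain `v` avoids a coefficient of a syzygy. -/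
theorem exists_syzygy_notMem {S : Type u} [CommRing S] {s : ℕ} (f : Fin s → S) {ι : Type*}
    [Fintype ι] (h : ι → S) (hs : Fintype.card ι < s) (hf : ∀ j, h j ∈ Ideal.span (Set.range f))
    (v : S) (hv : ∀ i, ∃ N : ℕ, v ^ N * f i ∈ Ideal.span (Set.range h)) (P : Ideal S) [P.IsPrime]
    (hvP : v ∉ P) : ∃ z, d₁ f z = 0 ∧ ∃ k, z k ∉ P := by
  classical
  choose N hN using hv
  have hN' : ∀ i, v ^ (∑ i, N i) * f i ∈ Ideal.span (Set.range h) := fun i => by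
    obtain ⟨k, hk⟩ := Nat.exists_eq_add_of_le
      (Finset.single_le_sum (f := N) (fun _ _ => Nat.zero_le _) (Finset.mem_univ i))
    rw [hk, add_comm, pow_add, mul_assoc]
    exact Ideal.mul_mem_left _ _ (hN i)
  generalize ∑ i, N i = M at hN'
  simp only [Ideal.mem_span_range_iff_exists_fun] at hN' hf
  choose E hE using hN'
  choose G hG using hf
  by_contra! hcon
  -- Expressing v^M fᵢ through the h's and these again through the f's gives syzygies, the rows of
  -- v^M · 1 - E G.
  let z : Fin s → Fin s → S := fun i k => (if k = i then v ^ M else 0) - ∑ j, E i j * G j k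
  have hz : ∀ i, d₁ f (z i) = 0 := fun i => by
    rw [d₁_apply]
    simp only [z, sub_mul, Finset.sum_sub_distrib, ite_mul, zero_mul, Finset.sum_ite_eq',
      Finset.mem_univ, if_true, ← hE, Finset.sum_mul]
    rw [Finset.sum_comm, sub_eq_zero]
    refine Finset.sum_congr rfl fun j _ => ?_
    rw [← hG, Finset.mul_sum]
    exact Finset.sum_congr rfl fun k _ => (mul_assoc _ _ _).symm
  let K := FractionRing (S ⧸ P)
  let φ : S →+* K := (algebraMap (S ⧸ P) K).comp (Ideal.Quotient.mk P)
  have hφ : ∀ x, φ x = 0 ↔ x ∈ P := fun x => by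
    rw [RingHom.comp_apply, FaithfulSMul.algebraMap_eq_zero_iff, Ideal.Quotient.eq_zero_iff_mem]
  have hmat : (Matrix.scalar (Fin s) (φ v ^ M) : Matrix (Fin s) (Fin s) K) =
      Matrix.of (fun i j => φ (E i j)) * Matrix.of (fun j k => φ (G j k)) := by
    ext i k
    have := (hφ _).2 (hcon (z i) (hz i) k)
    simp only [z, map_sub, sub_eq_zero, map_sum, map_mul] at this
    rw [Matrix.mul_apply, Matrix.scalar_apply, Matrix.diagonal_apply]
    simp only [Matrix.of_apply]
    rw [← this]
    by_cases hik : i = k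
    · simp [hik]
    · rw [if_neg hik, if_neg (Ne.symm hik), map_zero]
  -- If all entries were in P, then over the fraction field of S/P an invertible scalar matrix of
  -- size s would factor through fewer than s dimensions.
  have h1 : (Matrix.scalar (Fin s) (φ v ^ M) : Matrix (Fin s) (Fin s) K).rank = s := by
    rw [Matrix.rank_of_isUnit, Fintype.card_fin]
    exact (IsUnit.mk0 _ (pow_ne_zero M (mt (hφ v).1 hvP))).map (Matrix.scalar (Fin s))
  have h2 := (Matrix.rank_mul_le_left (Matrix.of fun i j => φ (E i j))
    (Matrix.of fun j k => φ (G j k))).trans (Matrix.rank_le_card_width _)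
  rw [← hmat, h1] at h2
  omega

end Koszul

/-! ### Charts. -/

open MvPolynomial LaurentPolynomial in
/-- The data of a chart for a map from a polynomial ring to `A[T;T⁻¹]`: where `v` is invertible,
the variables other than `X i₀` can be eliminated. -/
structure MvPolynomial.IsChart {A : Type*} [CommRing A] {σ : Type*}
    (ρ : MvPolynomial σ A →ₐ[A] A[T;T⁻¹]) (p : Ideal A) (i₀ : σ) (v : MvPolynomial σ A)
    (w : σ → MvPolynomial σ A) : Prop where
  mem_adjoin : v ∈ Algebra.adjoin A {(X i₀ : MvPolynomial σ A)}
  mem_adjoin' : ∀ j, w j ∈ Algebra.adjoin A {(X i₀ : MvPolynomial σ A)}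
  map_relation : ∀ j, j ≠ i₀ → ρ (v * X j - w j) = 0
  map_ne_zero : mapRingHom (Ideal.Quotient.mk p) (ρ v) ≠ 0
  map_sub_ne_zero : mapRingHom (Ideal.Quotient.mk p)
    (ρ (X i₀ - MvPolynomial.C (LaurentPolynomial.eval₂ (RingHom.id A) 1 (ρ (X i₀))))) ≠ 0
  exists_retract : ∃ ψ : MvPolynomial σ A →ₐ[A] Localization.Away v, (∀ x, ρ x = 0 → ψ x = 0) ∧
    ψ (X i₀) = algebraMap (MvPolynomial σ A) (Localization.Away v) (X i₀) ∧
    ∀ j, j ≠ i₀ → algebraMap _ (Localization.Away v) v * ψ (X j) = algebraMap (MvPolynomial σ A) _ (w j)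

namespace MvPolynomial.IsChart

open MvPolynomial LaurentPolynomial

variable {A : Type u} [CommRing A] {σ : Type*} {ρ : MvPolynomial σ A →ₐ[A] A[T;T⁻¹]} {p : Ideal A}
  {i₀ : σ} {v : MvPolynomial σ A} {w : σ → MvPolynomial σ A} (hc : IsChart ρ p i₀ v w)

/-- The ideal generated by the relations of a chart. -/
theorem algebraMap_sub_mem {ψ : MvPolynomial σ A →ₐ[A] Localization.Away v}
    (h0 : ψ (X i₀) = algebraMap (MvPolynomial σ A) (Localization.Away v) (X i₀))
    (hψ : ∀ j, j ≠ i₀ → algebraMap _ (Localization.Away v) v * ψ (X j) = algebraMap (MvPolynomial σ A) _ (w j))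
    (x : MvPolynomial σ A) :
    algebraMap _ (Localization.Away v) x - ψ x ∈
      (Ideal.span (Set.range fun j : {j // j ≠ i₀} => v * X j.1 - w j)).map
        (algebraMap _ (Localization.Away v)) := by
  set H := (Ideal.span (Set.range fun j : {j // j ≠ i₀} => v * X j.1 - w j)).map
        (algebraMap _ (Localization.Away v))
  have : (Ideal.Quotient.mkₐ A H).comp
      (IsScalarTower.toAlgHom A (MvPolynomial σ A) (Localization.Away v)) =
      (Ideal.Quotient.mkₐ A H).comp ψ := by
    ext j : 1
    refine (Ideal.Quotient.mk_eq_mk_iff_sub_mem _ _).2 ?_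
    change algebraMap _ _ (X j) - ψ (X j) ∈ H
    by_cases hj : j = i₀
    · rw [hj, h0, sub_self]
      exact zero_mem _
    · have hu : IsUnit (algebraMap (MvPolynomial σ A) (Localization.Away v) v) :=
        IsLocalization.Away.algebraMap_isUnit v
      rw [← Ideal.unit_mul_mem_iff_mem H hu, mul_sub, hψ j hj, ← map_mul, ← map_sub]
      exact Ideal.mem_map_of_mem _ (Ideal.subset_span ⟨⟨j, hj⟩, rfl⟩)
  exact (Ideal.Quotient.mk_eq_mk_iff_sub_mem _ _).1 (DFunLike.congr_fun this x)

include hc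

theorem span_le : Ideal.span (Set.range fun j : {j // j ≠ i₀} => v * X j.1 - w j) ≤
    RingHom.ker ρ := by
  refine Ideal.span_le.2 ?_
  rintro _ ⟨j, rfl⟩
  exact hc.map_relation _ j.2

/-- Modulo the chart relations the localization map equals the retraction, which kills x; clearing
denominators gives the power of v. -/
theorem exists_pow_mul_mem {x : MvPolynomial σ A} (hx : ρ x = 0) :
    ∃ N : ℕ, v ^ N * x ∈ Ideal.span (Set.range fun j : {j // j ≠ i₀} => v * X j.1 - w j) := by
  obtain ⟨ψ, hψ, h0, h⟩ := hc.exists_retract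
  have := algebraMap_sub_mem h0 h x
  rw [hψ x hx, sub_zero, IsLocalization.algebraMap_mem_map_algebraMap_iff (Submonoid.powers v)]
    at this
  obtain ⟨_, ⟨N, rfl⟩, h⟩ := this
  exact ⟨N, h⟩

theorem exists_pow_smul_mem_boundaries {s : ℕ} {f : Fin s → MvPolynomial σ A}
    (hf : Ideal.span (Set.range f) = RingHom.ker ρ) {z : Fin s → MvPolynomial σ A}
    (hz : Koszul.d₁ f z = 0) (hzI : ∀ i, ρ (z i) = 0) :
    ∃ N : ℕ, v ^ N • z ∈ Koszul.boundaries f := by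
  obtain ⟨ψ, hψ, h0, h⟩ := hc.exists_retract
  exact Koszul.exists_pow_smul_mem_boundaries_of_retract hf v (S' := Localization.Away v) ψ hψ
    (fun i => Ideal.map_mono hc.span_le (algebraMap_sub_mem h0 h (X i))) hz hzI

theorem exists_syzygy_notMem [Fintype σ] {s : ℕ} {f : Fin s → MvPolynomial σ A}
    (hf : Ideal.span (Set.range f) = RingHom.ker ρ) (hs : Fintype.card σ ≤ s)
    (P : Ideal (MvPolynomial σ A)) [P.IsPrime] (hvP : v ∉ P) :
    ∃ z, Koszul.d₁ f z = 0 ∧ ∃ k, z k ∉ P := by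
  classical
  refine Koszul.exists_syzygy_notMem f (fun j : {j // j ≠ i₀} => v * X j.1 - w j) ?_
    (fun j => ?_) v (fun i => hc.exists_pow_mul_mem ?_) P hvP
  · rw [Fintype.card_subtype_compl, Fintype.card_subtype_eq]
    have : 0 < Fintype.card σ := Fintype.card_pos_iff.2 ⟨i₀⟩
    omega
  · rw [hf]
    exact hc.map_relation _ j.2
  · have : f i ∈ RingHom.ker ρ := hf ▸ Ideal.subset_span ⟨i, rfl⟩
    exact this

end MvPolynomial.IsChart

theorem Ideal.ringKrullDim_add_one_le_quotient {R R' : Type*} [CommRing R] [CommRing R']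
    (P : Ideal R) [P.IsPrime] (φ : R →+* R') (hφ : Function.Surjective φ)
    (hP : ∀ x ∈ P, φ x = 0) (x : R) (hx : φ x = 0) (hxP : x ∉ P) :
    ringKrullDim R' + 1 ≤ ringKrullDim (R ⧸ P) :=
  ringKrullDim_succ_le_of_surjective (Ideal.Quotient.lift P φ hP)
    (Ideal.Quotient.lift_surjective_of_surjective _ _ hφ) (r := Ideal.Quotient.mk P x)
    (mem_nonZeroDivisors_of_ne_zero (by rwa [Ne, Ideal.Quotient.eq_zero_iff_mem]))
    (by rwa [Ideal.Quotient.lift_mk])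

/-! ### Associated primes and dimension of the image of ρ. -/

section AssociatedPrimes

open MvPolynomial LaurentPolynomial

variable {A : Type u} [CommRing A] {σ : Type*} (ρ : MvPolynomial σ A →ₐ[A] A[T;T⁻¹])

theorem LaurentPolynomial.algHom_mvPolynomial_C (c : A) :
    ρ (MvPolynomial.C c) = LaurentPolynomial.C c := ρ.commutes c

/-- The reduction of `ρ` modulo an ideal. -/
noncomputable def LaurentPolynomial.reduction (p : Ideal A) :
    MvPolynomial σ A →ₐ[A] (A ⧸ p)[T;T⁻¹] :=
  { (mapRingHom (Ideal.Quotient.mk p)).comp (ρ : MvPolynomial σ A →+* A[T;T⁻¹]) with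
    commutes' := fun c => by
      change mapRingHom _ (ρ (MvPolynomial.C c)) = _
      rw [algHom_mvPolynomial_C, mapRingHom_C]
      rfl }

theorem LaurentPolynomial.reduction_apply (p : Ideal A) (x : MvPolynomial σ A) :
    reduction ρ p x = mapRingHom (Ideal.Quotient.mk p) (ρ x) := rfl

theorem LaurentPolynomial.eval₂_mapRingHom (p : Ideal A) (f : A[T;T⁻¹]) :
    eval₂ (RingHom.id (A ⧸ p)) 1 (mapRingHom (Ideal.Quotient.mk p) f) =
      Ideal.Quotient.mk p (eval₂ (RingHom.id A) 1 f) := by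
  induction f using LaurentPolynomial.induction_on' with
  | add f g hf hg => simp only [map_add, hf, hg]
  | C_mul_T n a => simp [mapRingHom_C, mapRingHom_T]

/-- The associated primes of the kernel of `ρ` come from associated primes of `A`. -/
theorem LaurentPolynomial.exists_eq_ker_reduction {P : Ideal (MvPolynomial σ A)}
    (hP : P.IsAss (RingHom.ker ρ)) :
    ∃ p : Ideal A, p.IsAss ⊥ ∧ P = RingHom.ker (reduction ρ p) := by
  obtain ⟨hP, g, hg⟩ := hP
  obtain ⟨p, hp, h⟩ := LaurentPolynomial.exists_isAss (ρ : MvPolynomial σ A →+* A[T;T⁻¹])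
    (fun c => ⟨MvPolynomial.C c, algHom_mvPolynomial_C ρ c⟩) (Q := P) ⟨g, fun a => by
      rw [hg, RingHom.mem_ker, map_mul]; rfl⟩
  exact ⟨p, hp, Ideal.ext h⟩

theorem LaurentPolynomial.C_mem_ker_reduction {p : Ideal A} {c : A} :
    MvPolynomial.C c ∈ RingHom.ker (reduction ρ p) ↔ c ∈ p := by
  rw [RingHom.mem_ker, reduction_apply, algHom_mvPolynomial_C, mapRingHom_C, ← Ideal.Quotient.eq_zero_iff_mem,
    ← map_zero LaurentPolynomial.C]
  refine ⟨fun h => ?_, fun h => by rw [h]⟩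
  have := congrArg (fun f => eval₂ (RingHom.id _) (1 : (A ⧸ p)ˣ) f) h
  simpa [eval₂_C] using this

theorem Ideal.exists_isAss_of_mem_minimalPrimes {R : Type*} [CommRing R] [IsNoetherianRing R]
    {𝔞 P : Ideal R} (hP : P ∈ 𝔞.minimalPrimes) : P.IsAss 𝔞 := by
  rw [isAss_iff]
  refine Module.associatedPrimes.minimalPrimes_annihilator_subset_associatedPrimes R (R ⧸ 𝔞) ?_
  rwa [Ideal.annihilator_quotient]

variable {ρ}

theorem MvPolynomial.IsChart.card_le_height_add_one [Fintype σ] {p : Ideal A} [p.IsPrime] {i₀ : σ}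
    {v : MvPolynomial σ A} {w : σ → MvPolynomial σ A} (hc : IsChart ρ p i₀ v w) :
    (Fintype.card σ : ℕ∞) ≤ (RingHom.ker (reduction ρ p)).height + 1 :=
  card_le_height_ker_add_one (reduction ρ p) i₀ v w hc.mem_adjoin hc.mem_adjoin' hc.map_ne_zero
    fun j hj => by rw [reduction_apply, hc.map_relation j hj, map_zero]

variable [IsNoetherianRing A] [IsLocalRing A]

theorem IsCohenMacaulayLocal.height_eq_zero (hA : IsCohenMacaulayLocal A) {p : Ideal A}
    (hp : p.IsAss ⊥) : p.height = 0 := by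
  simpa using hA.isUnmixedRing 0 ⊥ ⊥ p .zero hp

/-- An inclusion of associated primes of the kernel restricts to an inclusion of associated primes
of A. These all have height 0, so the inclusion is an equality. -/
theorem IsCohenMacaulayLocal.mem_minimalPrimes_of_isAss (hA : IsCohenMacaulayLocal A) [Finite σ]
    {P : Ideal (MvPolynomial σ A)} (hP : P.IsAss (RingHom.ker ρ)) :
    P ∈ (RingHom.ker ρ).minimalPrimes := by
  have := hP.1
  obtain ⟨P₀, hP₀, hle⟩ := Ideal.exists_minimalPrimes_le hP.le
  obtain ⟨p, hp, rfl⟩ := exists_eq_ker_reduction ρ hP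
  obtain ⟨p₀, hp₀, rfl⟩ := exists_eq_ker_reduction ρ (Ideal.exists_isAss_of_mem_minimalPrimes hP₀)
  have hle' : p₀ ≤ p := fun c hc =>
    (C_mem_ker_reduction ρ).1 (hle ((C_mem_ker_reduction ρ).2 hc))
  have := hp.1
  have := hp₀.1
  rcases hle'.eq_or_lt with rfl | hlt
  · exact hP₀
  · have := Ideal.height_add_one_le_of_lt_of_isPrime hlt
    rw [hA.height_eq_zero hp, hA.height_eq_zero hp₀] at this
    exact absurd this (by simp)

variable [Fintype σ]

/-- The dimension of the components of the image of `ρ`. -/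
theorem MvPolynomial.IsChart.ringKrullDim_quotient (hA : IsCohenMacaulayLocal A) {p : Ideal A}
    (hp : p.IsAss ⊥) {i₀ : σ}
    {v : MvPolynomial σ A} {w : σ → MvPolynomial σ A} (hc : IsChart ρ p i₀ v w) :
    ringKrullDim (MvPolynomial σ A ⧸ RingHom.ker (reduction ρ p)) = ringKrullDim A + 1 := by
  have := hp.1
  have hP := RingHom.ker_isPrime (reduction ρ p).toRingHom
  have hP' : (RingHom.ker (reduction ρ p)).IsPrime := hP
  obtain ⟨d, 𝔡, hd, -⟩ := hA.exists_regChain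
  refine le_antisymm ?_ ?_
  -- The polynomial ring has dimension dim A + |σ|, and the height is at least |σ| - 1.
  · have h1 := (RingHom.ker (reduction ρ p)).height_add_ringKrullDim_quotient_le
    have h2 := hc.card_le_height_add_one
    rw [MvPolynomial.ringKrullDim_of_isNoetherianRing, hd, Nat.card_eq_fintype_card] at h1
    rw [hd]
    have hne : ringKrullDim (MvPolynomial σ A ⧸ RingHom.ker (reduction ρ p)) ≠ ⊥ := by
      have := ringKrullDim_nonneg_of_nontrivial
        (R := MvPolynomial σ A ⧸ RingHom.ker (reduction ρ p))
      intro h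
      rw [h] at this
      exact absurd this (by simp)
    generalize ringKrullDim (MvPolynomial σ A ⧸ RingHom.ker (reduction ρ p)) = e at h1 hne ⊢
    generalize (RingHom.ker (reduction ρ p)).height = h at h1 h2
    lift e to ℕ∞ using hne
    have h1' : h + e ≤ d + Fintype.card σ := by exact_mod_cast h1
    have he : e ≠ ⊤ := by rintro rfl; simp at h1'
    have hh : h ≠ ⊤ := by rintro rfl; simp at h1'
    lift e to ℕ using he
    lift h to ℕ using hh
    norm_cast at h1' h2 ⊢
    omega
  · have hφC : ∀ c, (LaurentPolynomial.eval₂ (RingHom.id (A ⧸ p)) 1)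
        (reduction ρ p (MvPolynomial.C c)) = Ideal.Quotient.mk p c := fun c => by
      rw [reduction_apply, algHom_mvPolynomial_C, mapRingHom_C, LaurentPolynomial.eval₂_C]
      rfl
    rw [← hA.ringKrullDim_quotient hp]
    -- Setting t = 1 maps the domain onto A/p and kills the nonzero class of `X i₀` minus its value
    -- at t = 1, so the dimension drops by at least one.
    refine Ideal.ringKrullDim_add_one_le_quotient _ (RingHom.comp
      (LaurentPolynomial.eval₂ (RingHom.id (A ⧸ p)) 1) (reduction ρ p).toRingHom) (fun c => ?_)
      (fun x hx => ?_)
      (X i₀ - MvPolynomial.C (LaurentPolynomial.eval₂ (RingHom.id A) 1 (ρ (X i₀)))) ?_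
      hc.map_sub_ne_zero
    · obtain ⟨c, rfl⟩ := Ideal.Quotient.mk_surjective c
      exact ⟨MvPolynomial.C c, hφC c⟩
    · exact (congrArg (LaurentPolynomial.eval₂ (RingHom.id (A ⧸ p)) 1) ((RingHom.mem_ker).1 hx)).trans
        (map_zero _)
    · rw [map_sub, sub_eq_zero]
      exact (eval₂_mapRingHom p _).trans (hφC _).symm

end AssociatedPrimes

/-! ### The criterion for algebras with charts -/

section Dimension

theorem Ideal.ringKrullDim_quotient_le_of_minimalPrimes {T : Type*} [CommRing T] (I : Ideal T)
    {e : WithBot ℕ∞} (h : ∀ P ∈ I.minimalPrimes, ringKrullDim (T ⧸ P) ≤ e) :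
    ringKrullDim (T ⧸ I) ≤ e := by
  rw [ringKrullDim_quotient, Order.krullDim_eq_iSup_coheight]
  refine iSup_le fun a => ?_
  obtain ⟨P, hP, hle⟩ := Ideal.exists_minimalPrimes_le (I := I) (J := a.1.asIdeal) a.2
  refine le_trans ?_ (h P hP)
  rw [Order.coheight_eq_krullDim_Ici, ringKrullDim_quotient]
  exact Order.krullDim_le_of_strictMono
    (fun b : Set.Ici a => (⟨b.1.1, hle.trans b.2⟩ : PrimeSpectrum.zeroLocus (P : Set T)))
    fun _ _ hb => hb

/-- The support is the union of the closed sets of the minimal primes of the annihilator. -/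
theorem Module.supportDim_eq_of_minimalPrimes {T H : Type*} [CommRing T] [AddCommGroup H]
    [Module T H] [Module.Finite T H] {e : WithBot ℕ∞}
    (h : ∀ P ∈ (Module.annihilator T H).minimalPrimes, ringKrullDim (T ⧸ P) = e)
    {P : Ideal T} (hP : P ∈ (Module.annihilator T H).minimalPrimes) :
    Module.supportDim T H = e := by
  rw [Module.supportDim_eq_ringKrullDim_quotient_annihilator]
  refine le_antisymm (Ideal.ringKrullDim_quotient_le_of_minimalPrimes _ fun P hP => (h P hP).le) ?_
  rw [← h P hP]
  exact ringKrullDim_le_of_surjective (Ideal.Quotient.factor hP.1.2)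
    (Ideal.Quotient.factor_surjective hP.1.2)

theorem Ideal.ringKrullDim_quotient_comap {S T : Type*} [CommRing S] [CommRing T] (φ : S →+* T)
    (hφ : Function.Surjective φ) (P : Ideal T) :
    ringKrullDim (S ⧸ P.comap φ) = ringKrullDim (T ⧸ P) := by
  have h : RingHom.ker ((Ideal.Quotient.mk P).comp φ) = P.comap φ := by
    rw [← RingHom.comap_ker, mk_ker]
  rw [← h]
  exact ringKrullDim_eq_of_ringEquiv (RingHom.quotientKerEquivOfSurjective
    (Ideal.Quotient.mk_surjective.comp hφ))

theorem Ideal.mem_minimalPrimes_of_comap {S T : Type*} [CommRing S] [CommRing T] {φ : S →+* T}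
    (hφ : Function.Surjective φ) {P 𝔞 : Ideal T} {J : Ideal S} (hP : P.comap φ ∈ J.minimalPrimes)
    (hJ : J ≤ RingHom.ker φ) [P.IsPrime] (h : 𝔞 ≤ P) : P ∈ 𝔞.minimalPrimes := by
  refine ⟨⟨‹_›, h⟩, fun Q hQ hQP => ?_⟩
  have := hQ.1
  have hle := hP.2 (y := Q.comap φ) ⟨inferInstance, fun x hx => by
    rw [mem_comap, (RingHom.mem_ker).1 (hJ hx)]; exact zero_mem _⟩ (comap_mono hQP)
  intro x hx
  obtain ⟨x, rfl⟩ := hφ x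
  exact hle hx

end Dimension

namespace Koszul

variable {S : Type u} [CommRing S] {s : ℕ} (f : Fin s → S)

/-- The homology class of a cycle. -/
noncomputable def cls (z : Fin s → S) (hz : d₁ f z = 0) : H₁ f :=
  Submodule.Quotient.mk (⟨z, hz⟩ : LinearMap.ker (d₁ f))

theorem exists_eq_cls (h : H₁ f) : ∃ z hz, h = cls f z hz := by
  obtain ⟨⟨z, hz⟩, rfl⟩ := Submodule.Quotient.mk_surjective _ h
  exact ⟨z, hz, rfl⟩

theorem cls_eq_zero {z : Fin s → S} {hz : d₁ f z = 0} : cls f z hz = 0 ↔ z ∈ boundaries f :=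
  Submodule.Quotient.mk_eq_zero _

theorem smul_cls (x : S) (z : Fin s → S) (hz : d₁ f z = 0) :
    (Ideal.Quotient.mk (Ideal.span (Set.range f)) x) • cls f z hz =
      cls f (x • z) (by rw [map_smul, hz, smul_zero]) := rfl

instance : IsScalarTower S (S ⧸ Ideal.span (Set.range f)) (H₁ f) :=
  (H₁_isTorsion f).isScalarTower

instance [IsNoetherianRing S] : Module.Finite (S ⧸ Ideal.span (Set.range f)) (H₁ f) :=
  Module.Finite.of_restrictScalars_finite S _ _

theorem mem_associatedPrimes_iff [IsNoetherianRing S]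
    {P : Ideal (S ⧸ Ideal.span (Set.range f))} :
    P ∈ associatedPrimes (S ⧸ Ideal.span (Set.range f)) (H₁ f) ↔
      P.IsPrime ∧ ∃ z, d₁ f z = 0 ∧ ∀ x, Ideal.Quotient.mk _ x ∈ P ↔ x • z ∈ boundaries f := by
  rw [AssociatedPrimes.mem_iff, isAssociatedPrime_iff]
  refine and_congr_right fun _ => ⟨?_, ?_⟩
  · rintro ⟨h, rfl⟩
    obtain ⟨z, hz, rfl⟩ := exists_eq_cls f h
    refine ⟨z, hz, fun x => ?_⟩
    rw [Submodule.mem_colon_singleton, Submodule.mem_bot, smul_cls, cls_eq_zero]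
  · rintro ⟨z, hz, h⟩
    refine ⟨cls f z hz, Ideal.ext fun x => ?_⟩
    obtain ⟨x, rfl⟩ := Ideal.Quotient.mk_surjective x
    rw [h, Submodule.mem_colon_singleton, Submodule.mem_bot, smul_cls, cls_eq_zero]

/-- A cycle that is not a boundary has a multiple whose annihilator is prime. -/
theorem exists_mem_associatedPrimes [IsNoetherianRing S] {z : Fin s → S} (hz : d₁ f z = 0)
    (hz' : z ∉ boundaries f) :
    ∃ P ∈ associatedPrimes (S ⧸ Ideal.span (Set.range f)) (H₁ f), ∃ b : S,
      ∀ x, Ideal.Quotient.mk _ x ∈ P ↔ x • b • z ∈ boundaries f := by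
  set T := S ⧸ Ideal.span (Set.range f)
  have hne : Nontrivial (Submodule.span T {cls f z hz}) := by
    refine Submodule.nontrivial_span_singleton ?_
    rwa [Ne, cls_eq_zero]
  obtain ⟨P, hP⟩ := associatedPrimes.nonempty T (Submodule.span T {cls f z hz})
  refine ⟨P, associatedPrimes.subset_of_injective
    (Submodule.injective_subtype (Submodule.span T {cls f z hz})) hP, ?_⟩
  rw [AssociatedPrimes.mem_iff, isAssociatedPrime_iff] at hP
  obtain ⟨-, ⟨y, hy⟩, rfl⟩ := hP
  obtain ⟨b, rfl⟩ := Submodule.mem_span_singleton.1 hy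
  obtain ⟨b, rfl⟩ := Ideal.Quotient.mk_surjective b
  refine ⟨b, fun x => ?_⟩
  rw [Submodule.mem_colon_singleton, Submodule.mem_bot, Subtype.ext_iff]
  change Ideal.Quotient.mk _ x • Ideal.Quotient.mk _ b • cls f z hz = 0 ↔ _
  rw [smul_cls, smul_cls, cls_eq_zero]

/-- If the first Koszul homology embeds into `(S/I)ˢ`, then its associated primes are
associated primes of `S/I`. -/
theorem isAss_comap_of_isSyzygetic [IsNoetherianRing S] {I : Ideal S}
    (hI : Ideal.span (Set.range f) = I) (hS : I.IsSyzygetic)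
    {P : Ideal (S ⧸ Ideal.span (Set.range f))}
    (hP : P ∈ associatedPrimes (S ⧸ Ideal.span (Set.range f)) (H₁ f)) :
    (P.comap (Ideal.Quotient.mk _)).IsAss I := by
  obtain ⟨hP, z, hz, h⟩ := (mem_associatedPrimes_iff f).1 hP
  rw [isSyzygetic_iff f hI] at hS
  have h1 : ∀ x ∈ P.comap (Ideal.Quotient.mk _), ∀ i, x * z i ∈ I := fun x hx i => by
    rw [← hI]
    exact apply_mem_of_mem_boundaries f ((h x).1 hx) i
  by_contra hcon
  -- If no single coordinate has annihilator P modulo `I`, each coordinate is killed by something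
  -- outside P. The product of these elements puts all entries of the cycle into `I`, so it makes
  -- the cycle a boundary and lies in P, against primality.
  have h2 : ∀ i, ∃ x, x * z i ∈ I ∧ x ∉ P.comap (Ideal.Quotient.mk _) := fun i => by
    by_contra! hi
    exact hcon ⟨inferInstance, z i, fun a => ⟨fun ha => h1 a ha i, hi a⟩⟩
  choose x hx hxP using h2
  have h3 : ∏ i, x i ∈ P.comap (Ideal.Quotient.mk _) := by
    refine (h _).2 (hS _ (by rw [map_smul, hz, smul_zero]) fun i => ?_)
    obtain ⟨c, hc⟩ := Finset.dvd_prod_of_mem x (Finset.mem_univ i)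
    rw [Pi.smul_apply, smul_eq_mul, hc, mul_right_comm]
    exact I.mul_mem_right _ (hx i)
  obtain ⟨i, -, hi⟩ := (inferInstance : (P.comap (Ideal.Quotient.mk _)).IsPrime).prod_mem_iff.1 h3
  exact hxP i hi

end Koszul

section Criterion

open MvPolynomial LaurentPolynomial Koszul

variable {A : Type u} [CommRing A] [IsLocalRing A] [IsNoetherianRing A] {σ : Type} [Fintype σ]

/-- The first Koszul homology of the kernel of a map to `A[T;T⁻¹]` with charts is unmixed and
equidimensional if and only if the kernel is syzygetic. -/
theorem IsCohenMacaulayLocal.isUnmixedModule_and_isEquidimensionalModule_iff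
    (hA : IsCohenMacaulayLocal A) (ρ : MvPolynomial σ A →ₐ[A] A[T;T⁻¹])
    (hρ : ∀ p : Ideal A, p.IsPrime → p.height = 0 → ∃ i₀ v w, IsChart ρ p i₀ v w)
    {s : ℕ} (f : Fin s → MvPolynomial σ A) (hf : Ideal.span (Set.range f) = RingHom.ker ρ) :
    (IsUnmixedModule (MvPolynomial σ A ⧸ Ideal.span (Set.range f)) (H₁ f) ∧
      IsEquidimensionalModule (MvPolynomial σ A ⧸ Ideal.span (Set.range f)) (H₁ f)) ↔
      (RingHom.ker ρ).IsSyzygetic := by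
  set T := MvPolynomial σ A ⧸ Ideal.span (Set.range f) with hT
  have hmk := Ideal.Quotient.mk_surjective (I := Ideal.span (Set.range f))
  have hker : RingHom.ker ρ ≤ RingHom.ker (Ideal.Quotient.mk (Ideal.span (Set.range f))) := by
    rw [Ideal.mk_ker, hf]
  have hass : ∀ P : Ideal (MvPolynomial σ A), P.IsAss (RingHom.ker ρ) →
      ∃ p, p.IsAss ⊥ ∧ P = RingHom.ker (reduction ρ p) ∧ ∃ i₀ v w, IsChart ρ p i₀ v w := by
    intro P hP
    obtain ⟨p, hp, rfl⟩ := exists_eq_ker_reduction ρ hP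
    exact ⟨p, hp, rfl, hρ p hp.1 (hA.height_eq_zero hp)⟩
  constructor
  · rintro ⟨hunm, -⟩
    rw [isSyzygetic_iff f hf]
    intro z hz hzI
    -- With fewer generators than variables, the height of the kernel is at least s and H₁ vanishes
    -- altogether. Otherwise there are more generators than the |σ| - 1 needed on a chart.
    rcases lt_or_ge s (Fintype.card σ) with hs | hs
    · refine mem_boundaries_of_le_height
        (hA.isUnmixedRing.hasRegularSequences.mvPolynomial σ).isUnmixedRing f ?_ hz
      rw [hf, Ideal.height_eq_inf_minimalPrimes]
      refine le_iInf₂ fun P hP => ?_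
      obtain ⟨p, hp, rfl, i₀, v, w, hc⟩ := hass P (Ideal.exists_isAss_of_mem_minimalPrimes hP)
      have := hp.1
      have h1 := hc.card_le_height_add_one
      have h2 : (s : ℕ∞) + 1 ≤ (RingHom.ker (reduction ρ p)).height + 1 :=
        le_trans (by exact_mod_cast hs) h1
      exact (ENat.add_le_add_iff_right (by simp)).1 h2
    · by_contra hzB
      obtain ⟨P, hP, b, hb⟩ := exists_mem_associatedPrimes f hz hzB
      have hPp : P.IsPrime := hP.1
      have hle : RingHom.ker ρ ≤ P.comap (Ideal.Quotient.mk _) := hker.trans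
        (Ideal.comap_mono bot_le)
      obtain ⟨P₀, hP₀, hle₀⟩ := Ideal.exists_minimalPrimes_le hle
      have hP₀p := hP₀.1.1
      obtain ⟨p, hp, rfl, i₀, v, w, hc⟩ := hass P₀ (Ideal.exists_isAss_of_mem_minimalPrimes hP₀)
      obtain ⟨z₀, hz₀, k, hk⟩ := hc.exists_syzygy_notMem hf hs (RingHom.ker (reduction ρ p))
        hc.map_ne_zero
      -- An annihilator of H₁ multiplies the syzygy `z₀` into boundaries, whose entries lie in the
      -- kernel of ρ; the entry of `z₀` outside the minimal prime forces the annihilator into that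
      -- prime.
      have hann : (Module.annihilator T (H₁ f)).comap (Ideal.Quotient.mk _) ≤
          RingHom.ker (reduction ρ p) := by
        intro x hx
        have h0 : Ideal.Quotient.mk (Ideal.span (Set.range f)) x • cls f z₀ hz₀ = 0 :=
          Module.mem_annihilator.1 (show Ideal.Quotient.mk (Ideal.span (Set.range f)) x ∈
            Module.annihilator T (H₁ f) from hx) (cls f z₀ hz₀)
        rw [smul_cls, cls_eq_zero] at h0
        have h1 := apply_mem_of_mem_boundaries f h0 k
        rw [hf] at h1
        exact (hP₀p.mem_or_mem (hP₀.1.2 h1)).resolve_right hk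
      have hprime : ((RingHom.ker (reduction ρ p)).map
          (Ideal.Quotient.mk (Ideal.span (Set.range f)))).IsPrime :=
        Ideal.map_isPrime_of_surjective hmk (by rw [Ideal.mk_ker, hf]; exact hP₀.1.2)
      have hmap : Module.annihilator T (H₁ f) ≤ (RingHom.ker (reduction ρ p)).map
          (Ideal.Quotient.mk (Ideal.span (Set.range f))) := by
        intro x hx
        obtain ⟨x, rfl⟩ := hmk x
        exact Ideal.mem_map_of_mem _ (hann hx)
      have hPle : P ≤ (RingHom.ker (reduction ρ p)).map
          (Ideal.Quotient.mk (Ideal.span (Set.range f))) :=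
        (hunm P hP).2 ⟨hprime, hmap⟩ (Ideal.map_le_iff_le_comap.2 hle₀)
      obtain ⟨N, hN⟩ := hc.exists_pow_smul_mem_boundaries hf (z := b • z)
        (by rw [map_smul, hz, smul_zero])
        (fun i => by rw [Pi.smul_apply, smul_eq_mul, map_mul, (RingHom.mem_ker).1 (hzI i), mul_zero])
      -- The multiple b • z still has entries in the kernel, so a power of v makes it a boundary and
      -- thus lies in its annihilator P, which is now contained in the minimal prime.
      have hv := hPle ((hb _).2 hN)
      have hv' : v ^ N ∈ RingHom.ker (reduction ρ p) := by
        have hcm : ((RingHom.ker (reduction ρ p)).map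
            (Ideal.Quotient.mk (Ideal.span (Set.range f)))).comap
            (Ideal.Quotient.mk (Ideal.span (Set.range f))) = RingHom.ker (reduction ρ p) := by
          rw [Ideal.comap_map_of_surjective _ hmk, ← RingHom.ker_eq_comap_bot, Ideal.mk_ker, hf]
          exact sup_eq_left.2 hP₀.1.2
        rw [← hcm]
        exact hv
      exact hc.map_ne_zero (hP₀p.mem_of_pow_mem N hv')
  · intro hS
    have key : ∀ P ∈ associatedPrimes T (H₁ f), P ∈ (Module.annihilator T (H₁ f)).minimalPrimes ∧
        ringKrullDim (T ⧸ P) = ringKrullDim A + 1 := by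
      intro P hP
      have hPp : P.IsPrime := hP.1
      have hP' := isAss_comap_of_isSyzygetic f hf hS hP
      refine ⟨Ideal.mem_minimalPrimes_of_comap hmk (hA.mem_minimalPrimes_of_isAss hP') hker ?_, ?_⟩
      · have := IsAssociatedPrime.annihilator_le hP
        rwa [Submodule.annihilator_top] at this
      · rw [← Ideal.ringKrullDim_quotient_comap _ hmk]
        obtain ⟨p, hp, h, i₀, v, w, hc⟩ := hass _ hP'
        rw [h]
        exact hc.ringKrullDim_quotient hA hp
    refine ⟨fun P hP => (key P hP).1, fun P hP => ?_⟩
    have h1 : ∀ P ∈ (Module.annihilator T (H₁ f)).minimalPrimes,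
        ringKrullDim (T ⧸ P) = ringKrullDim A + 1 := fun P hP => (key P
      (Module.associatedPrimes.minimalPrimes_annihilator_subset_associatedPrimes T (H₁ f) hP)).2
    rw [h1 P hP, Module.supportDim_eq_of_minimalPrimes h1 hP]

end Criterion

/-! ### Charts of Rees algebras -/

theorem LaurentPolynomial.T_ne_one {D : Type*} [CommRing D] [Nontrivial D] {n : ℤ} (hn : n ≠ 0) :
    (LaurentPolynomial.T n : LaurentPolynomial D) ≠ 1 := by
  intro h
  have := congrArg (fun f => f.coeff n) (h.trans LaurentPolynomial.T_zero.symm)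
  simp only [LaurentPolynomial.T_apply, if_true, if_neg hn.symm] at this
  exact one_ne_zero this

namespace Rees

open LaurentPolynomial

variable {A : Type u} [CommRing A] {I : Ideal A} {r : ℕ} (a : Fin r → I)

/-- The map `X_i ↦ a_i t` to the Laurent polynomials. -/
noncomputable def toLaurent : MvPolynomial (Fin r) A →ₐ[A] A[T;T⁻¹] :=
  MvPolynomial.aeval fun i => C (a i : A) * T 1

/-- The map `X_i ↦ a_i t`, `T ↦ t⁻¹` to the Laurent polynomials. -/
noncomputable def extendedToLaurent : MvPolynomial (Option (Fin r)) A →ₐ[A] A[T;T⁻¹] :=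
  MvPolynomial.aeval fun i => i.elim (T (-1)) fun i => C (a i : A) * T 1

/-- The map `X_i ↦ a_i t` to the polynomials. -/
noncomputable def toPolynomial : MvPolynomial (Fin r) A →ₐ[A] Polynomial A :=
  MvPolynomial.aeval fun i => Polynomial.C (a i : A) * Polynomial.X

theorem toLaurent_toPolynomial (x : MvPolynomial (Fin r) A) :
    (toPolynomial a x).toLaurent = toLaurent a x := by
  have : (Polynomial.toLaurentAlg).comp (toPolynomial a) = toLaurent a := by
    ext i : 1
    simp [toPolynomial, toLaurent]
  exact DFunLike.congr_fun this x

theorem toPolynomial_apply (x : MvPolynomial (Fin r) A) :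
    toPolynomial a x = (presentation a x : Polynomial A) := by
  have : toPolynomial a = (reesAlgebra I).val.comp (presentation a) := by
    ext i : 1
    simp [toPolynomial, presentation, Polynomial.C_mul_X_eq_monomial]
  exact DFunLike.congr_fun this x

theorem extendedToLaurent_apply (x : MvPolynomial (Option (Fin r)) A) :
    extendedToLaurent a x = (extendedPresentation a x : A[T;T⁻¹]) := by
  have : extendedToLaurent a = (extended I).val.comp (extendedPresentation a) := by
    ext i : 1
    cases i <;> simp [extendedToLaurent, extendedPresentation]
  exact DFunLike.congr_fun this x

theorem ker_presentation : RingHom.ker (presentation a) = RingHom.ker (toLaurent a) := by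
  ext x
  rw [RingHom.mem_ker, RingHom.mem_ker, ← toLaurent_toPolynomial, Polynomial.toLaurent_eq_zero,
    toPolynomial_apply, ZeroMemClass.coe_eq_zero]

theorem ker_extendedPresentation :
    RingHom.ker (extendedPresentation a) = RingHom.ker (extendedToLaurent a) := by
  ext x
  rw [RingHom.mem_ker, RingHom.mem_ker, extendedToLaurent_apply, ZeroMemClass.coe_eq_zero]

variable (ha : Ideal.span (Set.range fun i => (a i : A)) = I)

include ha

theorem presentation_surjective : Function.Surjective (presentation a) := by
  have h : reesAlgebra I ≤ ((reesAlgebra I).val.comp (presentation a)).range := by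
    conv_lhs => rw [← adjoin_monomial_eq_reesAlgebra]
    refine Algebra.adjoin_le ?_
    rintro _ ⟨c, hc, rfl⟩
    rw [SetLike.mem_coe, ← ha, Ideal.mem_span_range_iff_exists_fun] at hc
    obtain ⟨b, rfl⟩ := hc
    refine ⟨∑ i, MvPolynomial.C (b i) * MvPolynomial.X i, ?_⟩
    change ((reesAlgebra I).val.comp (presentation a)) _ = _
    rw [AlgHom.comp_apply, Subalgebra.coe_val, ← toPolynomial_apply, map_sum, map_sum]
    refine Finset.sum_congr rfl fun i _ => ?_
    rw [map_mul, toPolynomial, MvPolynomial.aeval_X, MvPolynomial.aeval_C, ← mul_assoc,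
      Polynomial.algebraMap_eq, ← Polynomial.C_mul, Polynomial.C_mul_X_eq_monomial]
  intro y
  obtain ⟨x, hx⟩ := h y.2
  exact ⟨x, Subtype.ext hx⟩

theorem extendedPresentation_surjective : Function.Surjective (extendedPresentation a) := by
  have h : extended I ≤ ((extended I).val.comp (extendedPresentation a)).range := by
    refine Algebra.adjoin_le ?_
    rintro _ (rfl | ⟨c, hc, rfl⟩)
    · exact ⟨MvPolynomial.X none, (extendedToLaurent_apply a _).symm.trans (by
        simp [extendedToLaurent])⟩
    · rw [← ha, Ideal.mem_span_range_iff_exists_fun] at hc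
      obtain ⟨b, rfl⟩ := hc
      refine ⟨∑ i, MvPolynomial.C (b i) * MvPolynomial.X (some i),
        (extendedToLaurent_apply a _).symm.trans ?_⟩
      rw [map_sum, map_sum, Finset.sum_mul]
      refine Finset.sum_congr rfl fun i _ => ?_
      rw [map_mul, extendedToLaurent, MvPolynomial.aeval_X, MvPolynomial.aeval_C, Option.elim_some,
        ← C_eq_algebraMap, ← mul_assoc, map_mul]
  intro y
  obtain ⟨x, hx⟩ := h y.2
  exact ⟨x, Subtype.ext hx⟩

omit ha in
/-- The chart of the Rees algebra where `aᵢ` is invertible. -/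
theorem isChart_toLaurent {p : Ideal A} [p.IsPrime] {i₀ : Fin r} (hi : (a i₀ : A) ∉ p) :
    MvPolynomial.IsChart (toLaurent a) p i₀ (MvPolynomial.C (a i₀ : A))
      (fun j => MvPolynomial.C (a j : A) * MvPolynomial.X i₀) := by
  have hX : ∀ i, toLaurent a (MvPolynomial.X i) = C (a i : A) * T 1 := fun i => by
    rw [toLaurent, MvPolynomial.aeval_X]
  have hC : ∀ c, toLaurent a (MvPolynomial.C c) = C c := fun c => algHom_mvPolynomial_C _ c
  have hne : C (Ideal.Quotient.mk p (a i₀ : A)) ≠ 0 := by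
    intro h
    have := congrArg (fun f => f.coeff 0) h
    simp only [C_apply, if_true] at this
    exact hi (Ideal.Quotient.eq_zero_iff_mem.1 this)
  refine ⟨Subalgebra.algebraMap_mem _ _, fun j => mul_mem (Subalgebra.algebraMap_mem _ _)
    (Algebra.subset_adjoin rfl), fun j _ => ?_, ?_, ?_, ?_⟩
  · rw [map_sub, map_mul, map_mul, hX, hX, hC, hC]
    ring
  · rwa [hC, mapRingHom_C]
  · rw [map_sub, hX, hC, map_mul, eval₂_C, eval₂_T, one_zpow, Units.val_one, mul_one,
      RingHom.id_apply]
    have : C (a i₀ : A) * T 1 - C (a i₀ : A) = C (a i₀ : A) * (T 1 - 1) := by ring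
    rw [this, map_mul, map_sub, mapRingHom_C, mapRingHom_T, map_one]
    exact mul_ne_zero hne (sub_ne_zero.2 (T_ne_one one_ne_zero))
  · set v : MvPolynomial (Fin r) A := MvPolynomial.C (a i₀ : A)
    obtain ⟨y, hy⟩ : ∃ y, algebraMap _ (Localization.Away v) v * y = 1 :=
      (IsLocalization.Away.algebraMap_isUnit v).exists_right_inv
    -- The retraction substitutes t = X_{i₀} / a_{i₀}. It factors through A[t], so it kills the
    -- kernel.
    let ψ : MvPolynomial (Fin r) A →ₐ[A] Localization.Away v :=
      (Polynomial.aeval (algebraMap (MvPolynomial (Fin r) A) _ (MvPolynomial.X i₀) * y)).comp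
        (toPolynomial a)
    have hψ : ∀ j, ψ (MvPolynomial.X j) =
        algebraMap _ _ (MvPolynomial.C (a j : A) * MvPolynomial.X i₀) * y := fun j => by
      simp only [ψ, AlgHom.comp_apply, toPolynomial, MvPolynomial.aeval_X, map_mul,
        Polynomial.aeval_C, Polynomial.aeval_X, mul_assoc]
      rfl
    refine ⟨ψ, fun x hx => ?_, ?_, fun j _ => ?_⟩
    · have : toPolynomial a x = 0 := by
        rw [← Polynomial.toLaurent_eq_zero, toLaurent_toPolynomial, hx]
      rw [AlgHom.comp_apply, this, map_zero]
    · rw [hψ, map_mul, mul_right_comm, hy, one_mul]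
    · rw [hψ, mul_left_comm, hy, mul_one]

omit ha in
/-- The chart of the extended Rees algebra where `t⁻¹` is invertible. -/
theorem isChart_extendedToLaurent (p : Ideal A) [p.IsPrime] :
    MvPolynomial.IsChart (extendedToLaurent a) p none (MvPolynomial.X none)
      (fun j => j.elim 0 fun j => MvPolynomial.C (a j : A)) := by
  have hN : extendedToLaurent a (MvPolynomial.X none) = T (-1) := by
    rw [extendedToLaurent, MvPolynomial.aeval_X]; rfl
  have hX : ∀ i, extendedToLaurent a (MvPolynomial.X (some i)) = C (a i : A) * T 1 := fun i => by
    rw [extendedToLaurent, MvPolynomial.aeval_X]; rfl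
  have hC : ∀ c, extendedToLaurent a (MvPolynomial.C c) = C c := fun c => algHom_mvPolynomial_C _ c
  refine ⟨Algebra.subset_adjoin rfl, fun j => ?_, fun j hj => ?_, ?_, ?_, ?_⟩
  · cases j with
    | none => exact zero_mem _
    | some j => exact Subalgebra.algebraMap_mem _ _
  · obtain ⟨j, rfl⟩ := Option.ne_none_iff_exists'.1 hj
    rw [map_sub, map_mul, hX, hN, Option.elim_some, hC, mul_left_comm, ← T_add, neg_add_cancel,
      T_zero, mul_one, sub_self]
  · rw [hN, mapRingHom_T]
    exact (isUnit_T _).ne_zero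
  · rw [map_sub, hN, hC, eval₂_T, one_zpow, Units.val_one, map_one, map_sub, mapRingHom_T, map_one]
    exact sub_ne_zero.2 (T_ne_one (by decide))
  · set v : MvPolynomial (Option (Fin r)) A := MvPolynomial.X none
    let y : (Localization.Away v)ˣ := (IsLocalization.Away.algebraMap_isUnit v).unit
    have hy : (y : Localization.Away v) = algebraMap _ _ v := rfl
    -- The retraction sends t to the inverse of the variable that presents t⁻¹.
    let ψ : MvPolynomial (Option (Fin r)) A →ₐ[A] Localization.Away v :=
      { (eval₂ (algebraMap A (Localization.Away v)) y⁻¹).comp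
          (extendedToLaurent a : MvPolynomial (Option (Fin r)) A →+* A[T;T⁻¹]) with
        commutes' := fun c => by
          change eval₂ _ _ (extendedToLaurent a (MvPolynomial.C c)) = _
          rw [hC, eval₂_C] }
    have hψ : ∀ x, ψ x = eval₂ (algebraMap A (Localization.Away v)) y⁻¹
      (extendedToLaurent a x) := fun x => rfl
    refine ⟨ψ, fun x hx => ?_, ?_, fun j hj => ?_⟩
    · rw [hψ, hx, map_zero]
    · rw [hψ, hN, eval₂_T, zpow_neg_one, inv_inv, hy]
    · obtain ⟨j, rfl⟩ := Option.ne_none_iff_exists'.1 hj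
      rw [hψ, hX, map_mul, eval₂_C, eval₂_T, zpow_one, mul_left_comm, ← hy, Units.mul_inv, mul_one]
      rfl

end Rees

theorem theorem1p6 {A : Type u} [CommRing A] [IsLocalRing A] [IsNoetherianRing A]
    (hA : IsCohenMacaulayLocal A) (I : Ideal A) (hI : 0 < I.height)
    {r : ℕ} (a : Fin r → I) (ha : Ideal.span (Set.range fun i => (a i : A)) = I)
    {s : ℕ} (f : Fin s → MvPolynomial (Fin r) A)
    (hf : Ideal.span (Set.range f) = RingHom.ker (Rees.presentation a))
    {s' : ℕ} (g : Fin s' → MvPolynomial (Option (Fin r)) A)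
    (hg : Ideal.span (Set.range g) = RingHom.ker (Rees.extendedPresentation a)) :
    ((IsUnmixedModule (MvPolynomial (Fin r) A ⧸ Ideal.span (Set.range f)) (Koszul.H₁ f) ∧
        IsEquidimensionalModule (MvPolynomial (Fin r) A ⧸ Ideal.span (Set.range f))
          (Koszul.H₁ f)) ↔
      Limits.IsZero (AndreQuillen.homology A (reesAlgebra I) 2 (reesAlgebra I))) ∧
    ((IsUnmixedModule (MvPolynomial (Option (Fin r)) A ⧸ Ideal.span (Set.range g))
        (Koszul.H₁ g) ∧
        IsEquidimensionalModule (MvPolynomial (Option (Fin r)) A ⧸ Ideal.span (Set.range g))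
          (Koszul.H₁ g)) ↔
      Limits.IsZero (AndreQuillen.homology A (Rees.extended I) 2 (Rees.extended I))) := by
  constructor
  · rw [AndreQuillen.isZero_homology_two_iff_isSyzygetic _ (Rees.presentation_surjective a ha),
      Rees.ker_presentation]
    refine hA.isUnmixedModule_and_isEquidimensionalModule_iff (Rees.toLaurent a)
      (fun p hp h0 => ?_) f (hf.trans (Rees.ker_presentation a))
    -- Positive height of `I` keeps it out of the primes of height 0, so some generator aᵢ is
    -- outside p and gives a chart.
    have hIp : ¬ I ≤ p := fun hle => by
      have := Ideal.height_mono hle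
      rw [h0] at this
      exact absurd hI this.not_gt
    rw [← ha, Ideal.span_le, Set.range_subset_iff] at hIp
    push Not at hIp
    obtain ⟨i₀, hi⟩ := hIp
    exact ⟨i₀, _, _, Rees.isChart_toLaurent a hi⟩
  · rw [AndreQuillen.isZero_homology_two_iff_isSyzygetic _
      (Rees.extendedPresentation_surjective a ha), Rees.ker_extendedPresentation]
    exact hA.isUnmixedModule_and_isEquidimensionalModule_iff (Rees.extendedToLaurent a)
      (fun p hp _ => ⟨none, _, _, Rees.isChart_extendedToLaurent a p⟩) g
      (hg.trans (Rees.ker_extendedPresentation a))
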